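/- Let $n\ge 3$, $\lambda=\frac{n-2}{2}$, and let $V\in C^1(\mathbb R^n\setminus\{0\})$ be real-valued; write $V_\pm=\max\{\pm V,0\}$, $\tilde V(x)=-\partial_r\big(rV\big)(x)$ with $r=|x|$, and let $\nabla_{\!S}$ denote the spherical gradient on the unit sphere (for $x=r\theta$, $|\theta|=1$, it acts in the variable $\theta$). Assume: (A1) $\sup_{x}|x|^2V_\pm(x)<\infty$; and that there is a $\delta>0$ such that for every $r>0$ and every complex-valued $C^1$ function $u$ on $\mathbb R^n\setminus\{0\}$ (A2) $\displaystyle\int_{|x|=r}|\nabla_{\!S}u|^2+(\lambda^2+|x|^2V)|u|^2\,d\sigma\ \ge\ \delta^2\int_{|x|=r}|u|^2\,d\sigma$; (A3) $\displaystyle\int_{|x|=r}|\nabla_{\!S}u|^2+(\lambda^2+|x|^2\tilde V)|u|^2\,d\sigma\ \ge\ \delta^2\int_{|x|=r}|u|^2\,d\sigma$. Let $P$ be the Friedrichs extension in $L^2(\mathbb R^n)$ of $-\Delta+V$ with domain $C_c^\infty(\mathbb R^n\setminus\{0\})$, and let $\Omega^{-1}$ be multiplication by $|x|^{-1}$ with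 its maximal domain $D(\Omega^{-1})$ in $L^2(\mathbb R^n)$. Then for every $\mu\in\mathbb C\setminus[0,\infty)$ the resolvent $R(\mu)=(P-\mu)^{-1}$ exists as a bounded operator on $L^2(\mathbb R^n)$, it maps $\Omega^{-1}f$ into $D(\Omega^{-1})$ for all $f\in D(\Omega^{-1})$, and $\Omega^{-1}R(\mu)\Omega^{-1}$ extends to a bounded operator on $L^2(\mathbb R^n)$ with $$\sup_{\mu\in\mathbb C\setminus[0,\infty)}\big\|\Omega^{-1}R(\mu)\Omega^{-1}f\big\|_{L^2}\le C\,\|f\|_{L^2}\qquad (f\in L^2(\mathbb R^n)),\qquad C=\max\Big\{\frac1{\delta^2},\frac{\sqrt2}{\delta}\Big\}.$$ -/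

import Mathlib

open MeasureTheory Filter Topology

noncomputable section

namespace CriticalDecay

/-! ### Unbounded operators: Friedrichs extension and resolvent -/

section Operators

variable {H : Type*} [NormedAddCommGroup H] [InnerProductSpace ℂ H]

/-- The quadratic form `φ ↦ Re ⟨φ, A φ⟩` of an operator `A` on its domain. -/
def opForm (A : H →ₗ.[ℂ] H) (φ : A.domain) : ℝ := (inner ℂ (φ : H) (A φ)).re

/-- `A` is bounded below. -/
def IsSemibounded (A : H →ₗ.[ℂ] H) : Prop :=
  ∃ c : ℝ, ∀ φ : A.domain, -c * ‖(φ : H)‖ ^ 2 ≤ opForm A φ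

/-- `u` is the limit in `H` of a sequence in the domain of `A` which is Cauchy for the quadratic
form of `A`. -/
def IsFormLimit (A : H →ₗ.[ℂ] H) (u : H) : Prop :=
  ∃ φ : ℕ → A.domain, Tendsto (fun k => (φ k : H)) atTop (𝓝 u) ∧
    Tendsto (fun p : ℕ × ℕ => opForm A (φ p.1 - φ p.2)) atTop (𝓝 0)

/-- The domain of the closure of the quadratic form of `A`. For `A` bounded below, the span is only
there to make it a subspace by definition: see `mem_formDomain_iff`. -/
def formDomain (A : H →ₗ.[ℂ] H) : Submodule ℂ H := Submodule.span ℂ {u | IsFormLimit A u}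

/-- The Friedrichs extension of a densely defined symmetric operator `A` bounded below: the
restriction of the adjoint `A†` to the vectors of its domain that lie in the form domain of `A`. -/
def friedrichsExtension [CompleteSpace H] (A : H →ₗ.[ℂ] H) : H →ₗ.[ℂ] H :=
  A.adjoint.domRestrict (formDomain A)

/-- `R` is the resolvent `(P - μ)⁻¹`, an everywhere defined bounded operator. -/
structure IsResolvent (P : H →ₗ.[ℂ] H) (μ : ℂ) (R : H →L[ℂ] H) : Prop where
  right_inv : ∀ g : H, ∃ h : R g ∈ P.domain, P ⟨R g, h⟩ - μ • R g = g
  left_inv : ∀ u : P.domain, R (P u - μ • (u : H)) = u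

lemma opForm_add_add_sub (A : H →ₗ.[ℂ] H) (φ ψ : A.domain) :
    opForm A (φ + ψ) + opForm A (φ - ψ) = 2 * opForm A φ + 2 * opForm A ψ := by
  simp only [opForm, LinearPMap.map_add, LinearPMap.map_sub, Submodule.coe_add,
    AddSubgroupClass.coe_sub, inner_add_left, inner_add_right, inner_sub_left, inner_sub_right,
    Complex.add_re, Complex.sub_re]
  ring

lemma opForm_smul (A : H →ₗ.[ℂ] H) (c : ℂ) (φ : A.domain) :
    opForm A (c • φ) = ‖c‖ ^ 2 * opForm A φ := by
  have h : inner ℂ ((c • φ : A.domain) : H) (A (c • φ))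
      = ((‖c‖ ^ 2 : ℝ) : ℂ) * inner ℂ (φ : H) (A φ) := by
    rw [LinearPMap.map_smul, Submodule.coe_smul, inner_smul_left, inner_smul_right, ← mul_assoc,
      Complex.conj_mul']
    push_cast
    ring
  rw [opForm, h, Complex.re_ofReal_mul, opForm]

lemma IsFormLimit.add {A : H →ₗ.[ℂ] H} (hA : IsSemibounded A) {u v : H}
    (hu : IsFormLimit A u) (hv : IsFormLimit A v) : IsFormLimit A (u + v) := by
  obtain ⟨c, hc⟩ := hA
  obtain ⟨φ, hφ, hφ'⟩ := hu
  obtain ⟨ψ, hψ, hψ'⟩ := hv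
  have hd : ∀ (χ : ℕ → A.domain) (w : H), Tendsto (fun k => (χ k : H)) atTop (𝓝 w) →
      Tendsto (fun p : ℕ × ℕ => ‖((χ p.1 - χ p.2 : A.domain) : H)‖ ^ 2) atTop (𝓝 0) := by
    intro χ w hχ
    have h1 : Tendsto (fun p : ℕ × ℕ => (χ p.1 : H)) atTop (𝓝 w) := by
      rw [← prod_atTop_atTop_eq]; exact hχ.comp tendsto_fst
    have h2 : Tendsto (fun p : ℕ × ℕ => (χ p.2 : H)) atTop (𝓝 w) := by
      rw [← prod_atTop_atTop_eq]; exact hχ.comp tendsto_snd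
    simpa using ((h1.sub h2).norm).pow 2
  refine ⟨fun k => φ k + ψ k, by simpa using hφ.add hψ, ?_⟩
  have hsum : Tendsto (fun k => ((φ k + ψ k : A.domain) : H)) atTop (𝓝 (u + v)) := by
    simpa using hφ.add hψ
  have hdif : Tendsto (fun k => ((φ k - ψ k : A.domain) : H)) atTop (𝓝 (u - v)) := by
    simpa using hφ.sub hψ
  have hs := hd (fun k => φ k + ψ k) _ hsum
  have ht := hd (fun k => φ k - ψ k) _ hdif
  have lo : Tendsto (fun p : ℕ × ℕ =>
      -c * ‖((φ p.1 + ψ p.1 - (φ p.2 + ψ p.2) : A.domain) : H)‖ ^ 2) atTop (𝓝 0) := by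
    simpa using hs.const_mul (-c)
  have hi : Tendsto (fun p : ℕ × ℕ =>
      2 * opForm A (φ p.1 - φ p.2) + 2 * opForm A (ψ p.1 - ψ p.2)
        + c * ‖((φ p.1 - ψ p.1 - (φ p.2 - ψ p.2) : A.domain) : H)‖ ^ 2) atTop (𝓝 0) := by
    simpa using ((hφ'.const_mul 2).add (hψ'.const_mul 2)).add (ht.const_mul c)
  refine tendsto_of_tendsto_of_tendsto_of_le_of_le lo hi (fun p => hc _) (fun p => ?_)
  have key := opForm_add_add_sub A (φ p.1 - φ p.2) (ψ p.1 - ψ p.2)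
  have e1 : φ p.1 - φ p.2 + (ψ p.1 - ψ p.2) = φ p.1 + ψ p.1 - (φ p.2 + ψ p.2) := by abel
  have e2 : φ p.1 - φ p.2 - (ψ p.1 - ψ p.2) = φ p.1 - ψ p.1 - (φ p.2 - ψ p.2) := by abel
  rw [e1, e2] at key
  have h3 := hc (φ p.1 - ψ p.1 - (φ p.2 - ψ p.2))
  simp only
  linarith

lemma IsFormLimit.smul {A : H →ₗ.[ℂ] H} (c : ℂ) {u : H} (hu : IsFormLimit A u) :
    IsFormLimit A (c • u) := by
  obtain ⟨φ, hφ, hφ'⟩ := hu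
  refine ⟨fun k => c • φ k, by simpa using hφ.const_smul c, ?_⟩
  simpa only [← smul_sub, opForm_smul, mul_zero] using hφ'.const_mul (‖c‖ ^ 2)

lemma mem_formDomain_iff {A : H →ₗ.[ℂ] H} (hA : IsSemibounded A) (u : H) :
    u ∈ formDomain A ↔ IsFormLimit A u := by
  refine ⟨fun hu => ?_, fun hu => Submodule.subset_span hu⟩
  refine Submodule.span_induction (p := fun v _ => IsFormLimit A v) (fun v hv => hv)
    ⟨fun _ => 0, by simp, by simp [opForm]⟩ (fun v w _ _ hv hw => hv.add hA hw)
    (fun c v _ hv => hv.smul c) hu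

end Operators

/-! ### The operators on `L²(ℝⁿ)` -/

/-- `ℝⁿ` with the Euclidean norm. -/
abbrev Euc (n : ℕ) : Type := EuclideanSpace ℝ (Fin n)

/-- Complex-valued `L²(ℝⁿ)`. -/
abbrev L2 (n : ℕ) : Type := Lp ℂ 2 (volume : Measure (Euc n))

/-- `ℝⁿ ∖ {0}` as an open set. -/
def punctured (n : ℕ) : TopologicalSpace.Opens (Euc n) := ⟨{0}ᶜ, isOpen_compl_singleton⟩

open scoped Distributions Laplacian

/-- Complex-valued test functions `C_c^∞(ℝⁿ ∖ {0})`. -/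
abbrev TestFun (n : ℕ) : Type := 𝓓(punctured n, ℂ)

lemma TestFun.memLp {n : ℕ} (φ : TestFun n) : MemLp φ 2 (volume : Measure (Euc n)) :=
  φ.contDiff.continuous.memLp_of_hasCompactSupport φ.hasCompactSupport

/-- The inclusion `C_c^∞(ℝⁿ ∖ {0}) → L²(ℝⁿ)`. -/
def testToL2 (n : ℕ) : TestFun n →ₗ[ℂ] L2 n where
  toFun φ := φ.memLp.toLp φ
  map_add' _ _ := rfl
  map_smul' _ _ := rfl

lemma testToL2_injective (n : ℕ) : Function.Injective (testToL2 n) := by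
  intro φ ψ h
  have h1 : (φ : Euc n → ℂ) =ᵐ[volume] ψ := (MemLp.toLp_eq_toLp_iff φ.memLp ψ.memLp).1 h
  have h2 := (Continuous.ae_eq_iff_eq volume φ.continuous ψ.continuous).1 h1
  exact DFunLike.coe_injective h2

/-- The classical expression `-Δφ + Vφ`. -/
def schrodingerExpr {n : ℕ} (V : Euc n → ℝ) (φ : Euc n → ℂ) (x : Euc n) : ℂ :=
  -(Δ φ) x + (V x : ℂ) * φ x

lemma schrodingerExpr_memLp {n : ℕ} {V : Euc n → ℝ} (hV : ContinuousOn V {0}ᶜ) (φ : TestFun n) :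
    MemLp (schrodingerExpr V φ) 2 (volume : Measure (Euc n)) := by
  have hd : ContDiff ℝ 2 φ := φ.contDiff.of_le (WithTop.coe_le_coe.2 (le_top : (2 : ℕ∞) ≤ ⊤))
  have hsupp : ∀ x, x ∉ tsupport φ → schrodingerExpr V φ x = 0 := by
    intro x hx
    have h0 : (φ : Euc n → ℂ) =ᶠ[𝓝 x] fun _ => 0 := notMem_tsupport_iff_eventuallyEq.1 hx
    have h1 := (InnerProductSpace.laplacian_congr_nhds h0).self_of_nhds
    simp [schrodingerExpr, h1, h0.self_of_nhds]
  have hlap : Continuous (Δ (φ : Euc n → ℂ)) := by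
    rw [InnerProductSpace.laplacian_eq_iteratedFDeriv_orthonormalBasis _
      (EuclideanSpace.basisFun (Fin n) ℝ)]
    refine continuous_finsetSum _ fun i _ => ?_
    exact (ContinuousMultilinearMap.apply ℝ (fun _ : Fin 2 => Euc n) ℂ _).continuous.comp
      (hd.continuous_iteratedFDeriv (by norm_num))
  have hmul : Continuous fun x => (V x : ℂ) * φ x := by
    refine continuous_iff_continuousAt.2 fun x => ?_
    by_cases hx : x = 0
    · have hx' : x ∉ tsupport φ := fun h => (φ.tsupport_subset h) hx
      have h0 : (φ : Euc n → ℂ) =ᶠ[𝓝 x] fun _ => 0 := notMem_tsupport_iff_eventuallyEq.1 hx'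
      have h1 : (fun x => (V x : ℂ) * φ x) =ᶠ[𝓝 x] fun _ => 0 := by
        filter_upwards [h0] with y hy
        simp [hy]
      exact continuousAt_const.congr h1.symm
    · have h1 : ContinuousAt V x := hV.continuousAt (isOpen_compl_singleton.mem_nhds hx)
      exact (Complex.continuous_ofReal.continuousAt.comp h1).mul φ.continuous.continuousAt
  exact (hlap.neg.add hmul).memLp_of_hasCompactSupport
    (HasCompactSupport.intro φ.hasCompactSupport hsupp)

/-- `φ ↦ -Δφ + Vφ` as a linear map `C_c^∞(ℝⁿ ∖ {0}) → L²(ℝⁿ)`. -/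
def schrodingerTest {n : ℕ} (V : Euc n → ℝ) (hV : ContinuousOn V {0}ᶜ) :
    TestFun n →ₗ[ℂ] L2 n where
  toFun φ := (schrodingerExpr_memLp hV φ).toLp (schrodingerExpr V φ)
  map_add' φ ψ := by
    rw [← MemLp.toLp_add]
    refine MemLp.toLp_congr _ _ (Eventually.of_forall fun x => ?_)
    have hφ : ContDiff ℝ 2 φ := φ.contDiff.of_le (WithTop.coe_le_coe.2 (le_top : (2 : ℕ∞) ≤ ⊤))
    have hψ : ContDiff ℝ 2 ψ := ψ.contDiff.of_le (WithTop.coe_le_coe.2 (le_top : (2 : ℕ∞) ≤ ⊤))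
    have h : Δ (⇑(φ + ψ) : Euc n → ℂ) x = (Δ (φ : Euc n → ℂ)) x + (Δ (ψ : Euc n → ℂ)) x :=
      hφ.contDiffAt.laplacian_add hψ.contDiffAt
    have h' : (φ + ψ : TestFun n) x = φ x + ψ x := rfl
    simp only [schrodingerExpr, h, h', Pi.add_apply]
    ring
  map_smul' c φ := by
    rw [RingHom.id_apply, ← MemLp.toLp_const_smul]
    refine MemLp.toLp_congr _ _ (Eventually.of_forall fun x => ?_)
    have hφ : ContDiff ℝ 2 φ := φ.contDiff.of_le (WithTop.coe_le_coe.2 (le_top : (2 : ℕ∞) ≤ ⊤))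
    have h : Δ (⇑(c • φ) : Euc n → ℂ) x = c • (Δ (φ : Euc n → ℂ)) x :=
      InnerProductSpace.laplacian_smul c hφ.contDiffAt
    have h' : (c • φ : TestFun n) x = c • φ x := rfl
    simp only [schrodingerExpr, h, h', Pi.smul_apply, smul_eq_mul]
    ring

/-- The symmetric operator `-Δ + V` in `L²(ℝⁿ)` with domain `C_c^∞(ℝⁿ ∖ {0})`. -/
def schrodingerOp {n : ℕ} (V : Euc n → ℝ) (hV : ContinuousOn V {0}ᶜ) : L2 n →ₗ.[ℂ] L2 n where
  domain := LinearMap.range (testToL2 n)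
  toFun := schrodingerTest V hV ∘ₗ
    (LinearEquiv.ofInjective (testToL2 n) (testToL2_injective n)).symm.toLinearMap

lemma schrodingerOp_apply {n : ℕ} {V : Euc n → ℝ} (hV : ContinuousOn V {0}ᶜ) (φ : TestFun n) :
    schrodingerOp V hV ⟨testToL2 n φ, LinearMap.mem_range_self _ φ⟩ = schrodingerTest V hV φ := by
  change schrodingerTest V hV ((LinearEquiv.ofInjective (testToL2 n) (testToL2_injective n)).symm
    (LinearEquiv.ofInjective (testToL2 n) (testToL2_injective n) φ)) = _
  rw [LinearEquiv.symm_apply_apply]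

/-- `|x|⁻¹ f(x)`. -/
def divNorm {n : ℕ} (f : Euc n → ℂ) (x : Euc n) : ℂ := ((‖x‖⁻¹ : ℝ) : ℂ) * f x

lemma divNorm_zero_ae (n : ℕ) : divNorm (0 : L2 n) =ᵐ[volume] (0 : Euc n → ℂ) := by
  filter_upwards [Lp.coeFn_zero ℂ 2 (volume : Measure (Euc n))] with x hx
  simp only [divNorm, hx, Pi.zero_apply, mul_zero]

lemma divNorm_add_ae {n : ℕ} (f g : L2 n) :
    divNorm (f + g : L2 n) =ᵐ[volume] divNorm f + divNorm g := by
  filter_upwards [Lp.coeFn_add f g] with x hx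
  simp only [divNorm, hx, Pi.add_apply, mul_add]

lemma divNorm_smul_ae {n : ℕ} (c : ℂ) (f : L2 n) :
    divNorm (c • f : L2 n) =ᵐ[volume] c • divNorm f := by
  filter_upwards [Lp.coeFn_smul c f] with x hx
  simp only [divNorm, hx, Pi.smul_apply, smul_eq_mul]
  ring

/-- The domain `{f ∈ L² : |x|⁻¹ f ∈ L²}` of `Ω⁻¹`. -/
def invOmegaDomain (n : ℕ) : Submodule ℂ (L2 n) where
  carrier := {f | MemLp (divNorm f) 2 (volume : Measure (Euc n))}
  zero_mem' := (MemLp.zero (ε := ℂ)).ae_eq (divNorm_zero_ae n).symm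
  add_mem' hf hg := (MemLp.add hf hg).ae_eq (divNorm_add_ae _ _).symm
  smul_mem' c _ hf := (MemLp.const_smul hf c).ae_eq (divNorm_smul_ae c _).symm

lemma invOmegaDomain.memLp {n : ℕ} (f : invOmegaDomain n) :
    MemLp (divNorm (f : L2 n)) 2 (volume : Measure (Euc n)) := f.2

/-- The operator `Ω⁻¹` of multiplication by `|x|⁻¹` in `L²(ℝⁿ)`, with its maximal domain. -/
def invOmega (n : ℕ) : L2 n →ₗ.[ℂ] L2 n where
  domain := invOmegaDomain n
  toFun :=
    { toFun := fun f => (invOmegaDomain.memLp f).toLp (divNorm (f : L2 n))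
      map_add' := fun f g => by
        rw [← MemLp.toLp_add]
        exact MemLp.toLp_congr _ _ (divNorm_add_ae _ _)
      map_smul' := fun c f => by
        rw [RingHom.id_apply, ← MemLp.toLp_const_smul]
        exact MemLp.toLp_congr _ _ (divNorm_smul_ae c _) }

/-! ### Assumptions on the potential -/

/-- `∫_{|x| = r} g dσ`, with `σ` the surface measure, written over the unit sphere. -/
def sphereIntegral {n : ℕ} (r : ℝ) (g : Euc n → ℝ) : ℝ :=
  r ^ (n - 1) * ∫ θ : Metric.sphere (0 : Euc n) 1, g (r • (θ : Euc n))
    ∂(volume : Measure (Euc n)).toSphere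

/-- The radial derivative `∂_r u (x)`, for `x ≠ 0`. -/
def radialDeriv {n : ℕ} (u : Euc n → ℂ) (x : Euc n) : ℂ := fderiv ℝ u x (‖x‖⁻¹ • x)

/-- The square of the norm of the spherical gradient of `u` at `x ≠ 0`. The spherical gradient is
the gradient on the unit sphere in the angular variable `θ`, `x = rθ`; it is `|x|` times the
tangential part `∇u - (x/|x|) ∂_r u` of the gradient. -/
def sphGradSq {n : ℕ} (u : Euc n → ℂ) (x : Euc n) : ℝ :=
  ‖x‖ ^ 2 * ∑ i : Fin n, ‖fderiv ℝ u x (EuclideanSpace.single i 1)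
    - ((x i / ‖x‖ : ℝ) : ℂ) * radialDeriv u x‖ ^ 2

/-- `λ = (n - 2) / 2`. -/
def lam (n : ℕ) : ℝ := ((n : ℝ) - 2) / 2

/-- The positive and the negative part of `|x|² V(x)` are bounded above. -/
def CriticalBound {n : ℕ} (V : Euc n → ℝ) : Prop :=
  BddAbove (Set.range fun x => ‖x‖ ^ 2 * max (V x) 0) ∧
    BddAbove (Set.range fun x => ‖x‖ ^ 2 * max (-V x) 0)

/-- `-Δ_sph + |x|² W + λ² ≥ δ²` on every sphere centred at the origin, in the sense of quadratic
forms. -/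
def PositiveOnSpheres {n : ℕ} (W : Euc n → ℝ) (δ : ℝ) : Prop :=
  ∀ u : Euc n → ℂ, ContDiffOn ℝ 1 u {0}ᶜ → ∀ r : ℝ, 0 < r →
    δ ^ 2 * sphereIntegral r (fun x => ‖u x‖ ^ 2) ≤
      sphereIntegral r (fun x => sphGradSq u x + (lam n ^ 2 + ‖x‖ ^ 2 * W x) * ‖u x‖ ^ 2)

/-- `Ṽ(x) = -∂_r (r V)(x)`, for `x ≠ 0`. -/
def tildeV {n : ℕ} (V : Euc n → ℝ) (x : Euc n) : ℝ :=
  -deriv (fun s : ℝ => s * V (s • (‖x‖⁻¹ • x))) ‖x‖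

end CriticalDecay

end

open CriticalDecay

/-! Existence of the resolvent. Completing the square radially (Hardy's identity with constant `λ²`)
and using (A2) on each sphere gives `⟨φ, (-Δ + V)φ⟩ ≥ ‖(∂_r + λ/r)φ‖² + δ²‖φ/r‖²` for test
functions, so the operator `A` on test functions is symmetric and nonnegative. Let `J` be the
canonical map to `L²` from the completion of the domain for `⟨φ, ψ⟩ + ⟨φ, Aψ⟩`. Riesz representation
gives `J J* = (P + 1)⁻¹`. This is a positive contraction, so `1 - (μ + 1) J J*` is invertible for
every `μ` outside `[0, ∞)`, and `(P - μ)⁻¹ = J J* (1 - (μ + 1) J J*)⁻¹`.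

Uniform bound for test functions. Write `μ = k²` with `Im k > 0` and pair `(-Δ + V - k²)φ` with the
multiplier `Mφ = r∂_rφ + ((n - 1)/2 - ikr)φ = rDφ + φ/2`, where `Dφ = ∂_rφ + (λ/r - ik)φ`. Up to
divergences, the real part of the product is a sum of squares, the form of (A3) with weight
`1/(2r²)` and the form of (A2) with weight `Im k / r` (`mult_identity`). With `e = ∫|Dφ|²`, `Y =
∫|φ|²/r²` and `B = Im k ∫|φ|²/r`, this bounds the pairing below by `e/2 + δ²Y/2 + δ²B`
(`le_integral_mult_mul`), while `‖Mφ/r‖² = e + Y/4 + B` (`integral_normSq_mult`). Cauchy-Schwarz and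
an elementary inequality (`le_max_sq_mul`) give `‖φ/r‖ ≤ C‖r(-Δ + V - k²)φ‖` with `C` independent of
`k` (`integral_normSq_le`).

Passage to the domain of `P`. For `u = R(μ)Ω⁻¹f`, coercivity of the form puts `u/r` in `L²` and
yields an `L²` limit `G` of `(∂_r + λ/r)φ_j` along test functions `φ_j → u`. Multiplication by a
cutoff `h(log r / R)` localizes `u` to an annulus, where mollification reduces the estimate to test
functions (`eLpNorm_norm_inv_smul_le_of_weak`). The commutator of `Δ` with this cutoff involves only
`G` and `u`; after multiplication by `r` it is `O(1/R)` in `L²`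
(`eLpNorm_logCutoff_smul_divNorm_le`). Letting `R → ∞` with Fatou's lemma gives the estimate for
`u`, and density of `D(Ω⁻¹)` extends it to `L²`. -/

noncomputable section

namespace CriticalDecay

/-! ### Resolvents of Friedrichs extensions -/

section FormSpace

variable {H : Type*} [NormedAddCommGroup H] [InnerProductSpace ℂ H]

/-- A symmetric operator with nonnegative quadratic form. -/
structure IsSymmNonneg (A : H →ₗ.[ℂ] H) : Prop where
  symm : ∀ φ ψ : A.domain, inner ℂ (A φ) (ψ : H) = inner ℂ (φ : H) (A ψ)
  nonneg : ∀ φ : A.domain, 0 ≤ opForm A φ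

/-- The domain of `A`, to be equipped with the inner product `⟨φ, ψ⟩ + ⟨φ, A ψ⟩`. -/
def FormSpace (A : H →ₗ.[ℂ] H) (_ : IsSymmNonneg A) : Type _ := A.domain

variable {A : H →ₗ.[ℂ] H} (hA : IsSymmNonneg A)

instance : AddCommGroup (FormSpace A hA) := inferInstanceAs (AddCommGroup A.domain)

instance : Module ℂ (FormSpace A hA) := inferInstanceAs (Module ℂ A.domain)

/-- The identity from the domain of `A` to the form space. -/
def toFormSpace : A.domain ≃ₗ[ℂ] FormSpace A hA := LinearEquiv.refl ℂ A.domain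

/-- The inner product `⟨φ, ψ⟩ + ⟨φ, A ψ⟩` on the domain of `A`. -/
abbrev formCore : InnerProductSpace.Core ℂ (FormSpace A hA) where
  inner φ ψ := inner ℂ ((toFormSpace hA).symm φ : H) ((toFormSpace hA).symm ψ : H)
    + inner ℂ ((toFormSpace hA).symm φ : H) (A ((toFormSpace hA).symm ψ))
  conj_inner_symm φ ψ := by
    simp only [map_add, inner_conj_symm, hA.symm]
  re_inner_nonneg φ := by
    simp only [map_add]
    exact add_nonneg inner_self_nonneg (hA.nonneg _)
  add_left φ ψ χ := by
    simp only [map_add, Submodule.coe_add, inner_add_left]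
    ring
  smul_left φ ψ c := by
    simp only [map_smul, Submodule.coe_smul, inner_smul_left]
    ring
  definite φ h := by
    have h1 := congrArg Complex.re h
    rw [Complex.add_re, Complex.zero_re] at h1
    have h2 : 0 ≤ (inner ℂ ((toFormSpace hA).symm φ : H) ((toFormSpace hA).symm φ : H)).re :=
      inner_self_nonneg (𝕜 := ℂ)
    have h3 := hA.nonneg ((toFormSpace hA).symm φ)
    rw [opForm] at h3
    have h4 : (inner ℂ ((toFormSpace hA).symm φ : H) ((toFormSpace hA).symm φ : H)).re = 0 := by
      linarith
    have h5 : ‖((toFormSpace hA).symm φ : H)‖ ^ 2 = 0 := by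
      rw [← h4]; exact norm_sq_eq_re_inner (𝕜 := ℂ) _
    simpa using h5

instance : NormedAddCommGroup (FormSpace A hA) :=
  @InnerProductSpace.Core.toNormedAddCommGroup ℂ _ _ _ _ (formCore hA)

instance : InnerProductSpace ℂ (FormSpace A hA) :=
  InnerProductSpace.ofCore (formCore hA).toCore

lemma inner_toFormSpace (φ ψ : A.domain) :
    inner ℂ (toFormSpace hA φ) (toFormSpace hA ψ) = inner ℂ (φ : H) (ψ : H)
      + inner ℂ (φ : H) (A ψ) := rfl

lemma norm_sq_toFormSpace (φ : A.domain) :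
    ‖toFormSpace hA φ‖ ^ 2 = ‖(φ : H)‖ ^ 2 + opForm A φ := by
  rw [norm_sq_eq_re_inner (𝕜 := ℂ), inner_toFormSpace, map_add, ← norm_sq_eq_re_inner]
  rfl

/-- The inclusion of the form space, as a contraction. -/
def formIncl : FormSpace A hA →L[ℂ] H :=
  (A.domain.subtype ∘ₗ (toFormSpace hA).symm.toLinearMap).mkContinuous 1 fun φ => by
    have h := norm_sq_toFormSpace hA ((toFormSpace hA).symm φ)
    rw [LinearEquiv.apply_symm_apply] at h
    have h' := hA.nonneg ((toFormSpace hA).symm φ)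
    rw [one_mul]
    refine le_of_sq_le_sq ?_ (norm_nonneg _)
    simp only [LinearMap.comp_apply, LinearEquiv.coe_coe, Submodule.subtype_apply]
    linarith

lemma formIncl_toFormSpace (φ : A.domain) : formIncl hA (toFormSpace hA φ) = φ := rfl

lemma norm_formIncl_le : ‖formIncl hA‖ ≤ 1 := LinearMap.mkContinuous_norm_le _ zero_le_one _

lemma IsSymmNonneg.isSemibounded (hA : IsSymmNonneg A) : IsSemibounded A :=
  ⟨0, fun φ => by simpa using hA.nonneg φ⟩

variable {hA} in
lemma exists_seq_tendsto_completion (x : UniformSpace.Completion (FormSpace A hA)) :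
    ∃ φ : ℕ → A.domain, Tendsto (fun k => ((toFormSpace hA (φ k) : FormSpace A hA) :
      UniformSpace.Completion (FormSpace A hA))) atTop (𝓝 x) := by
  obtain ⟨u, hu, hu'⟩ := mem_closure_iff_seq_limit.1
    ((UniformSpace.Completion.denseRange_coe (α := FormSpace A hA)).closure_range ▸ Set.mem_univ x)
  choose v hv using hu
  exact ⟨fun k => (toFormSpace hA).symm (v k), by simpa [hv] using hu'⟩

variable [CompleteSpace H]

/-- The extension of the inclusion to the completion of the form space. -/
def complIncl : UniformSpace.Completion (FormSpace A hA) →L[ℂ] H :=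
  (formIncl hA).extend (UniformSpace.Completion.toComplL (𝕜 := ℂ) (E := FormSpace A hA))

lemma complIncl_coe (φ : A.domain) : complIncl hA (toFormSpace hA φ :) = φ := by
  have h := ContinuousLinearMap.extend_eq (formIncl hA)
    (e := UniformSpace.Completion.toComplL (𝕜 := ℂ) (E := FormSpace A hA))
    UniformSpace.Completion.denseRange_coe
    (UniformSpace.Completion.isUniformInducing_coe _) (toFormSpace hA φ)
  exact h

lemma norm_complIncl_le : ‖complIncl hA‖ ≤ 1 := by
  refine ContinuousLinearMap.opNorm_le_bound _ zero_le_one fun x => ?_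
  refine UniformSpace.Completion.induction_on x
    (isClosed_le (by fun_prop) (by fun_prop)) fun φ => ?_
  obtain ⟨φ, rfl⟩ := (toFormSpace hA).surjective φ
  rw [UniformSpace.Completion.norm_coe, complIncl_coe, ← formIncl_toFormSpace hA φ]
  exact (formIncl hA).le_of_opNorm_le (norm_formIncl_le hA) _

/-- The operator `(P + 1)⁻¹`, where `P` is the Friedrichs extension of `A`. -/
def invAddOne : H →L[ℂ] H := complIncl hA ∘L (complIncl hA).adjoint

lemma norm_invAddOne_le : ‖invAddOne hA‖ ≤ 1 := by
  refine (ContinuousLinearMap.opNorm_comp_le _ _).trans ?_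
  rw [LinearIsometryEquiv.norm_map]
  exact mul_le_one₀ (norm_complIncl_le hA) (norm_nonneg _) (norm_complIncl_le hA)

lemma invAddOne_isPositive : (invAddOne hA).IsPositive :=
  ContinuousLinearMap.isPositive_self_comp_adjoint _

variable {hA}

/-- By density it is enough to take `x` in the domain of `A`, where this is symmetry. It turns
pairings in the completion into pairings in `H` with `A` on the test vector, which is the weak form
of the equation. -/
lemma inner_coe_completion (ψ : A.domain) (x : UniformSpace.Completion (FormSpace A hA)) :
    inner ℂ ((toFormSpace hA ψ : FormSpace A hA) : UniformSpace.Completion (FormSpace A hA)) x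
      = inner ℂ ((ψ : H) + A ψ) (complIncl hA x) := by
  refine UniformSpace.Completion.induction_on x
    (isClosed_eq (by fun_prop) (by fun_prop)) fun φ => ?_
  obtain ⟨φ, rfl⟩ := (toFormSpace hA).surjective φ
  rw [UniformSpace.Completion.inner_coe, inner_toFormSpace, complIncl_coe, inner_add_left, hA.symm]

/-- Together with `IsFormLimit.exists_complIncl_eq`, this identifies the form domain with the range
of `complIncl`. Injectivity of that map, that is closability of the form, plays no role. -/
lemma isFormLimit_complIncl (x : UniformSpace.Completion (FormSpace A hA)) :
    IsFormLimit A (complIncl hA x) := by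
  obtain ⟨φ, hφ⟩ := exists_seq_tendsto_completion x
  refine ⟨φ, by
    simpa only [Function.comp_def, complIncl_coe] using ((complIncl hA).continuous.tendsto x).comp hφ, ?_⟩
  have h1 : Tendsto (fun p : ℕ × ℕ => ((toFormSpace hA (φ p.1) : FormSpace A hA) :
      UniformSpace.Completion (FormSpace A hA))) atTop (𝓝 x) := by
    rw [← prod_atTop_atTop_eq]; exact hφ.comp tendsto_fst
  have h2 : Tendsto (fun p : ℕ × ℕ => ((toFormSpace hA (φ p.2) : FormSpace A hA) :
      UniformSpace.Completion (FormSpace A hA))) atTop (𝓝 x) := by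
    rw [← prod_atTop_atTop_eq]; exact hφ.comp tendsto_snd
  have h3 := ((h1.sub h2).norm).pow 2
  simp only [sub_self, norm_zero, ne_eq, OfNat.ofNat_ne_zero, not_false_eq_true, zero_pow] at h3
  refine squeeze_zero (fun p => hA.nonneg _) (fun p => ?_) h3
  rw [← UniformSpace.Completion.coe_sub, ← map_sub, UniformSpace.Completion.norm_coe,
    norm_sq_toFormSpace]
  exact le_add_of_nonneg_left (sq_nonneg _)

lemma IsFormLimit.exists_complIncl_eq {u : H} (hu : IsFormLimit A u) :
    ∃ x, complIncl hA x = u := by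
  obtain ⟨φ, hφ, hφ'⟩ := hu
  have h1 : Tendsto (fun p : ℕ × ℕ => (φ p.1 : H)) atTop (𝓝 u) := by
    rw [← prod_atTop_atTop_eq]; exact hφ.comp tendsto_fst
  have h2 : Tendsto (fun p : ℕ × ℕ => (φ p.2 : H)) atTop (𝓝 u) := by
    rw [← prod_atTop_atTop_eq]; exact hφ.comp tendsto_snd
  have h3 := (((h1.sub h2).norm).pow 2).add hφ'
  simp only [sub_self, norm_zero, ne_eq, OfNat.ofNat_ne_zero, not_false_eq_true, zero_pow,
    add_zero] at h3
  have hc : CauchySeq fun k => ((toFormSpace hA (φ k) : FormSpace A hA) :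
      UniformSpace.Completion (FormSpace A hA)) := by
    -- The distance in the form space is the square root of the quantity in `h3`: squared distance
    -- in `H` plus the form of the difference.
    rw [cauchySeq_iff_tendsto_dist_atTop_0]
    have h4 := (Real.continuous_sqrt.tendsto 0).comp h3
    rw [Real.sqrt_zero] at h4
    refine h4.congr fun p => ?_
    rw [dist_eq_norm, ← UniformSpace.Completion.coe_sub, ← map_sub, UniformSpace.Completion.norm_coe,
      ← Real.sqrt_sq (norm_nonneg (toFormSpace hA _)), norm_sq_toFormSpace]
    rfl
  obtain ⟨x, hx⟩ := cauchySeq_tendsto_of_complete hc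
  refine ⟨x, tendsto_nhds_unique ?_ hφ⟩
  simpa only [Function.comp_def, complIncl_coe] using ((complIncl hA).continuous.tendsto x).comp hx

end FormSpace

/-! ### The Friedrichs extension: weak equation, inverse of `P + 1`, resolvent. -/

section Friedrichs

variable {H : Type*} [NormedAddCommGroup H] [InnerProductSpace ℂ H] [CompleteSpace H]
  {A : H →ₗ.[ℂ] H}

lemma IsSymmNonneg.isFormLimit (hA : IsSymmNonneg A) (u : (friedrichsExtension A).domain) :
    IsFormLimit A (u : H) := (mem_formDomain_iff hA.isSemibounded _).1 u.2.1

lemma inner_friedrichsExtension (hd : Dense (A.domain : Set H))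
    (u : (friedrichsExtension A).domain) (ψ : A.domain) :
    inner ℂ (ψ : H) (friedrichsExtension A u) = inner ℂ (A ψ) (u : H) := by
  have h := LinearPMap.adjoint_isFormalAdjoint hd ⟨(u : H), u.2.2⟩ ψ
  have h' : friedrichsExtension A u = A.adjoint ⟨(u : H), u.2.2⟩ :=
    LinearPMap.domRestrict_apply rfl
  rw [h', ← inner_conj_symm, h, inner_conj_symm]

lemma exists_friedrichsExtension_eq (hd : Dense (A.domain : Set H)) {u w : H}
    (hu : IsFormLimit A u) (h : ∀ ψ : A.domain, inner ℂ (ψ : H) w = inner ℂ (A ψ) u) :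
    ∃ hu : u ∈ (friedrichsExtension A).domain, friedrichsExtension A ⟨u, hu⟩ = w := by
  have h0 : ∀ ψ : A.domain, inner ℂ w (ψ : H) = inner ℂ u (A ψ) := fun ψ => by
    rw [← inner_conj_symm, h, inner_conj_symm]
  have h1 : u ∈ A.adjoint.domain := LinearPMap.mem_adjoint_domain_of_exists _ ⟨w, h0⟩
  refine ⟨⟨Submodule.subset_span hu, h1⟩, ?_⟩
  have h' : friedrichsExtension A ⟨u, ⟨Submodule.subset_span hu, h1⟩⟩ = A.adjoint ⟨u, h1⟩ :=
    LinearPMap.domRestrict_apply rfl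
  rw [h']
  exact LinearPMap.adjoint_apply_eq hd _ h0

/-- For `x = J* g` and `u = J x`, the number `⟨ψ, x⟩` in the completion equals both `⟨ψ, g⟩` and `⟨ψ
+ Aψ, u⟩`. Hence `⟨Aψ, u⟩ = ⟨ψ, g - u⟩` for all `ψ`, so that `A† u = g - u`. -/
lemma friedrichsExtension_invAddOne (hA : IsSymmNonneg A) (hd : Dense (A.domain : Set H)) (g : H) :
    ∃ h : invAddOne hA g ∈ (friedrichsExtension A).domain,
      friedrichsExtension A ⟨invAddOne hA g, h⟩ = g - invAddOne hA g := by
  refine exists_friedrichsExtension_eq hd (isFormLimit_complIncl _) fun ψ => ?_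
  have h := inner_coe_completion (hA := hA) ψ ((complIncl hA).adjoint g)
  rw [ContinuousLinearMap.adjoint_inner_right, complIncl_coe, inner_add_left] at h
  rw [inner_sub_right, h]
  exact add_sub_cancel_left _ _

lemma invAddOne_friedrichsExtension (hA : IsSymmNonneg A) (hd : Dense (A.domain : Set H))
    (u : (friedrichsExtension A).domain) :
    invAddOne hA (friedrichsExtension A u + u) = u := by
  obtain ⟨x, hx⟩ := (hA.isFormLimit u).exists_complIncl_eq (hA := hA)
  -- Once `u = J x`, the claim reduces to `J*(Pu + u) = x`, an identity in the completion that can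
  -- be tested against the dense image of the domain of `A`.
  have hx' : (complIncl hA).adjoint (friedrichsExtension A u + u) = x := by
    refine DenseRange.eq_of_inner_right ℂ
      (UniformSpace.Completion.denseRange_coe (α := FormSpace A hA)) fun ψ => ?_
    obtain ⟨ψ, rfl⟩ := (toFormSpace hA).surjective ψ
    rw [ContinuousLinearMap.adjoint_inner_right, complIncl_coe, inner_coe_completion, hx,
      inner_add_right, inner_add_left, inner_friedrichsExtension hd, add_comm]
  rw [invAddOne, ContinuousLinearMap.comp_apply, hx', hx]

/-- The spectrum of a positive contraction lies in `[0, 1]`. Failure of invertibility would make `(μ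
+ 1)⁻¹` a spectral value `t` in `(0, 1]`, hence `μ = 1/t - 1 ≥ 0`. -/
lemma isUnit_one_sub_smul_invAddOne (hA : IsSymmNonneg A) {μ : ℂ}
    (hμ : ∀ t : ℝ, 0 ≤ t → μ ≠ (t : ℂ)) : IsUnit (1 - (μ + 1) • invAddOne hA) := by
  by_cases h0 : μ + 1 = 0
  · rw [h0, zero_smul, sub_zero]
    exact isUnit_one
  by_contra hu
  have hsp : (μ + 1)⁻¹ ∈ spectrum ℂ (invAddOne hA) := by
    rw [spectrum.mem_iff]
    intro h
    refine hu ?_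
    have h1 : 1 - (μ + 1) • invAddOne hA
        = (μ + 1) • (algebraMap ℂ (H →L[ℂ] H) (μ + 1)⁻¹ - invAddOne hA) := by
      rw [smul_sub, Algebra.algebraMap_eq_smul_one, smul_smul, mul_inv_cancel₀ h0, one_smul]
    rw [h1]
    exact (isUnit_smul_iff (Units.mk0 _ h0) _).2 h
  have hpos : 0 ≤ invAddOne hA :=
    (ContinuousLinearMap.nonneg_iff_isPositive _).2 (invAddOne_isPositive hA)
  have hre := (invAddOne_isPositive hA).isSelfAdjoint.mem_spectrum_eq_re hsp
  have hle : ‖(μ + 1)⁻¹‖ ≤ 1 := by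
    -- On the zero space every operator is a unit; otherwise the identity has norm one and the norm
    -- bounds the spectrum.
    rcases subsingleton_or_nontrivial H with hH | hH
    · exact absurd (isUnit_of_subsingleton _) hu
    exact (spectrum.norm_le_norm_of_mem hsp).trans (norm_invAddOne_le hA)
  set t := ((μ + 1)⁻¹).re
  have ht0 : 0 ≤ t := spectrum_nonneg_of_nonneg (𝕜 := ℝ) hpos
    ((spectrum.algebraMap_mem_iff ℂ).1 (by rw [hre] at hsp; exact hsp))
  have ht1 : t ≤ 1 := (Complex.re_le_norm _).trans hle
  have htne : t ≠ 0 := fun h => h0 (by rw [h] at hre; simpa using hre)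
  have hpos' : 0 < t := lt_of_le_of_ne ht0 (Ne.symm htne)
  refine hμ (t⁻¹ - 1) (sub_nonneg.2 (one_le_inv_iff₀.2 ⟨hpos', ht1⟩)) ?_
  push_cast
  rw [← hre, inv_inv, add_sub_cancel_right]

lemma exists_isResolvent (hA : IsSymmNonneg A) (hd : Dense (A.domain : Set H)) {μ : ℂ}
    (hμ : ∀ t : ℝ, 0 ≤ t → μ ≠ (t : ℂ)) :
    ∃ R : H →L[ℂ] H, IsResolvent (friedrichsExtension A) μ R := by
  obtain ⟨S, hS⟩ := isUnit_one_sub_smul_invAddOne hA hμ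
  have hS1 : ∀ g, (S⁻¹ : (H →L[ℂ] H)ˣ).val g - (μ + 1) • invAddOne hA ((S⁻¹ : (H →L[ℂ] H)ˣ).val g)
      = g := fun g => by
    have h := congrArg (fun B : H →L[ℂ] H => B g) S.mul_inv
    rw [hS] at h
    exact h
  have hS2 : ∀ g, (S⁻¹ : (H →L[ℂ] H)ˣ).val (g - (μ + 1) • invAddOne hA g) = g := fun g => by
    have h := congrArg (fun B : H →L[ℂ] H => B g) S.inv_mul
    rw [hS] at h
    exact h
  -- With `B = (P + 1)⁻¹` one has `P - μ = (1 - (μ + 1)B)(P + 1)`, hence `(P - μ)⁻¹ = B (1 - (μ +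
  -- 1)B)⁻¹`.
  refine ⟨invAddOne hA ∘L (S⁻¹ : (H →L[ℂ] H)ˣ).val, ⟨fun g => ?_, fun u => ?_⟩⟩
  · obtain ⟨h, h'⟩ := friedrichsExtension_invAddOne hA hd ((S⁻¹ : (H →L[ℂ] H)ˣ).val g)
    refine ⟨h, ?_⟩
    refine Eq.trans ?_ (hS1 g)
    refine (congrArg (· - μ • _) h').trans ?_
    simp only [ContinuousLinearMap.comp_apply, add_smul, one_smul]
    abel
  · have h := invAddOne_friedrichsExtension hA hd u
    have h1 : friedrichsExtension A u - μ • (u : H) = (friedrichsExtension A u + u)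
        - (μ + 1) • invAddOne hA (friedrichsExtension A u + u) := by
      rw [h, add_smul, one_smul]
      abel
    rw [ContinuousLinearMap.comp_apply, h1, hS2, h]

end Friedrichs


/-! ### Integration by parts away from the origin -/

section Away

variable {n : ℕ} {F : Type*} [NormedAddCommGroup F]

lemma TestFun.zero_notMem_tsupport (φ : TestFun n) : (0 : Euc n) ∉ tsupport φ :=
  fun h => φ.tsupport_subset h rfl

/-- A test function vanishes near the origin, so any expression that vanishes wherever `φ` vanishes
locally extends across the origin by zero. This lets singular weights such as `‖x‖⁻¹` and `V` enter
every integral below. -/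
lemma continuous_of_continuousOn_compl_zero {f : Euc n → F} (φ : TestFun n)
    (hf : ContinuousOn f {0}ᶜ) (h0 : ∀ x, φ =ᶠ[𝓝 x] 0 → f x = 0) : Continuous f := by
  refine continuous_iff_continuousAt.2 fun x => ?_
  by_cases hx : x = 0
  · have h1 : (φ : Euc n → ℂ) =ᶠ[𝓝 x] 0 :=
      notMem_tsupport_iff_eventuallyEq.1 (hx ▸ φ.zero_notMem_tsupport)
    have h2 : f =ᶠ[𝓝 x] fun _ => 0 := by
      filter_upwards [h1.eventually_nhds] with y hy using h0 y hy
    exact continuousAt_const.congr h2.symm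
  · exact hf.continuousAt (isOpen_compl_singleton.mem_nhds hx)

lemma hasCompactSupport_of_testFun {f : Euc n → F} (φ : TestFun n)
    (h0 : ∀ x, φ =ᶠ[𝓝 x] 0 → f x = 0) : HasCompactSupport f :=
  HasCompactSupport.intro φ.hasCompactSupport fun x hx =>
    h0 x (notMem_tsupport_iff_eventuallyEq.1 hx)

lemma integrable_of_testFun {f : Euc n → F} (φ : TestFun n)
    (hf : ContinuousOn f {0}ᶜ) (h0 : ∀ x, φ =ᶠ[𝓝 x] 0 → f x = 0) : Integrable f :=
  (continuous_of_continuousOn_compl_zero φ hf h0).integrable_of_hasCompactSupport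
    (hasCompactSupport_of_testFun φ h0)

variable [NormedSpace ℝ F]

lemma contDiff_of_contDiffOn_compl_zero {f : Euc n → F} {m : WithTop ℕ∞} (φ : TestFun n)
    (hf : ContDiffOn ℝ m f {0}ᶜ) (h0 : ∀ x, φ =ᶠ[𝓝 x] 0 → f x = 0) : ContDiff ℝ m f := by
  refine contDiff_iff_contDiffAt.2 fun x => ?_
  by_cases hx : x = 0
  · have h1 : (φ : Euc n → ℂ) =ᶠ[𝓝 x] 0 :=
      notMem_tsupport_iff_eventuallyEq.1 (hx ▸ φ.zero_notMem_tsupport)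
    have h2 : f =ᶠ[𝓝 x] fun _ => 0 := by
      filter_upwards [h1.eventually_nhds] with y hy using h0 y hy
    exact contDiffAt_const.congr_of_eventuallyEq h2
  · exact hf.contDiffAt (isOpen_compl_singleton.mem_nhds hx)

/-- Integration by parts against the constant function `1`. -/
lemma integral_fderiv_apply_eq_zero {f : Euc n → ℝ} (hf : ContDiff ℝ 1 f)
    (hc : HasCompactSupport f) (v : Euc n) : ∫ x, fderiv ℝ f x v = 0 := by
  have h := integral_mul_fderiv_eq_neg_fderiv_mul_of_integrable (μ := (volume : Measure (Euc n)))
    (f := fun _ => (1 : ℝ)) (g := f) (v := v) (by simp)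
    (by
      simp only [one_mul]
      exact ((hf.continuous_fderiv one_ne_zero).clm_apply
        continuous_const).integrable_of_hasCompactSupport (hc.fderiv_apply (𝕜 := ℝ) v))
    (by simpa using hf.continuous.integrable_of_hasCompactSupport hc)
    (fun _ _ => differentiableAt_const _) (fun x _ => hf.differentiable one_ne_zero x)
  simpa using h

/-- The divergence theorem for a compactly supported vector field. -/
lemma integral_sum_fderiv_eq_zero {f : Fin n → Euc n → ℝ} (hf : ∀ i, ContDiff ℝ 1 (f i))
    (hc : ∀ i, HasCompactSupport (f i)) :
    ∫ x, ∑ i, fderiv ℝ (f i) x (EuclideanSpace.single i 1) = 0 := by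
  rw [integral_finsetSum _ fun i _ => (((hf i).continuous_fderiv one_ne_zero).clm_apply
    continuous_const).integrable_of_hasCompactSupport ((hc i).fderiv_apply (𝕜 := ℝ) _)]
  exact Finset.sum_eq_zero fun i _ => integral_fderiv_apply_eq_zero (hf i) (hc i) _

lemma sum_smul_single (x : Euc n) : ∑ i, x i • EuclideanSpace.single i (1 : ℝ) = x := by
  have h := (EuclideanSpace.basisFun (Fin n) ℝ).sum_repr x
  simpa using h

lemma clm_apply_eq_sum (L : Euc n →L[ℝ] F) (x : Euc n) :
    L x = ∑ i, x i • L (EuclideanSpace.single i 1) := by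
  conv_lhs => rw [← sum_smul_single x, map_sum]
  simp

lemma fderiv_coord_mul {f : Euc n → ℝ} (hf : ContDiff ℝ 1 f) (i : Fin n) (x : Euc n) :
    fderiv ℝ (fun y : Euc n => y i * f y) x (EuclideanSpace.single i 1)
      = f x + x i * fderiv ℝ f x (EuclideanSpace.single i 1) := by
  have h1 : HasFDerivAt (fun y : Euc n => y i) (EuclideanSpace.proj (𝕜 := ℝ) i) x :=
    (EuclideanSpace.proj (𝕜 := ℝ) i).hasFDerivAt
  have h2 : fderiv ℝ (fun y : Euc n => y i * f y) x
      = x i • fderiv ℝ f x + f x • EuclideanSpace.proj i :=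
    (h1.mul (hf.differentiable one_ne_zero x).hasFDerivAt).fderiv
  rw [h2]
  simp
  ring

/-- The divergence theorem for the vector field `x ↦ f(x) x`. -/
lemma integral_radial_div_eq_zero {f : Euc n → ℝ} (hf : ContDiff ℝ 1 f)
    (hc : HasCompactSupport f) : ∫ x, (n * f x + fderiv ℝ f x x) = 0 := by
  have h := integral_sum_fderiv_eq_zero (f := fun i (y : Euc n) => y i * f y)
    (fun i => ((EuclideanSpace.proj (𝕜 := ℝ) i).contDiff).mul hf) (fun i => hc.mul_left)
  rw [← h]
  congr 1
  ext x
  simp_rw [fderiv_coord_mul hf, Finset.sum_add_distrib]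
  rw [clm_apply_eq_sum (fderiv ℝ f x) x]
  simp

end Away

/-! ### Derivatives of test functions -/

section Derivatives

variable {n : ℕ}

open scoped Laplacian

lemma TestFun.contDiff_two (φ : TestFun n) : ContDiff ℝ 2 φ :=
  φ.contDiff.of_le (WithTop.coe_le_coe.2 (le_top : (2 : ℕ∞) ≤ ⊤))

lemma laplacian_eq_sum {F : Type*} [NormedAddCommGroup F] [NormedSpace ℝ F] (f : Euc n → F)
    (x : Euc n) :
    (Δ f) x = ∑ i, fderiv ℝ (fderiv ℝ f) x (EuclideanSpace.single i 1)
      (EuclideanSpace.single i 1) := by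
  rw [InnerProductSpace.laplacian_eq_iteratedFDeriv_orthonormalBasis _
      (EuclideanSpace.basisFun (Fin n) ℝ)]
  simp [iteratedFDeriv_two_apply]

/-- The square of the norm of the gradient. -/
def gradSq (f : Euc n → ℂ) (x : Euc n) : ℝ :=
  ∑ i : Fin n, ‖fderiv ℝ f x (EuclideanSpace.single i 1)‖ ^ 2

/-- Pythagoras: the tangential part of the gradient is what remains after subtracting the radial
part. Expanding the square and summing over `i` uses `∑ x_i² = ‖x‖²` and `∑ x_i ∂_i f = x · ∇f`. -/
lemma sphGradSq_eq (f : Euc n → ℂ) {x : Euc n} (hx : x ≠ 0) :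
    sphGradSq f x = ‖x‖ ^ 2 * gradSq f x - ‖fderiv ℝ f x x‖ ^ 2 := by
  have hr : ‖x‖ ≠ 0 := norm_ne_zero_iff.2 hx
  have h1 : radialDeriv f x = ((‖x‖⁻¹ : ℝ) : ℂ) * fderiv ℝ f x x := by
    simp [radialDeriv]
  have h2 : ‖x‖ ^ 2 = ∑ i, x i ^ 2 := by
    simp [EuclideanSpace.norm_sq_eq]
  set d := fderiv ℝ f x x with hd
  have h3 : d = ∑ i, ((x i : ℝ) : ℂ) * fderiv ℝ f x (EuclideanSpace.single i 1) := by
    rw [hd]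
    conv_lhs => rw [clm_apply_eq_sum (fderiv ℝ f x) x]
    simp
  have h4 : ∀ i : Fin n, ‖fderiv ℝ f x (EuclideanSpace.single i 1)
      - ((x i / ‖x‖ : ℝ) : ℂ) * radialDeriv f x‖ ^ 2
      = ‖fderiv ℝ f x (EuclideanSpace.single i 1)‖ ^ 2
        - 2 * (‖x‖ ^ 2)⁻¹ * (((x i : ℝ) : ℂ) * fderiv ℝ f x (EuclideanSpace.single i 1)
          * starRingEnd ℂ d).re + x i ^ 2 * ((‖x‖ ^ 2)⁻¹ ^ 2 * ‖d‖ ^ 2) := by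
    intro i
    rw [h1, Complex.sq_norm, Complex.sq_norm, Complex.sq_norm, Complex.normSq_apply,
      Complex.normSq_apply, Complex.normSq_apply]
    simp only [Complex.sub_re, Complex.mul_re, Complex.sub_im, Complex.mul_im, Complex.ofReal_re,
      Complex.ofReal_im, Complex.conj_re, Complex.conj_im]
    field_simp
    ring
  rw [sphGradSq, gradSq]
  simp_rw [h4]
  rw [Finset.sum_add_distrib, Finset.sum_sub_distrib, ← Finset.mul_sum, ← Finset.sum_mul, ← h2,
    ← Complex.re_sum, ← Finset.sum_mul, ← h3, Complex.mul_conj, Complex.ofReal_re,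
    ← Complex.sq_norm]
  field_simp
  ring

/-- In this form `tildeV` is what the commutator of `V` with the dilation generator `x · ∇`
produces. -/
lemma tildeV_eq {V : Euc n → ℝ} {x : Euc n} (hx : x ≠ 0) (hV : DifferentiableAt ℝ V x) :
    tildeV V x = -V x - fderiv ℝ V x x := by
  have hr : ‖x‖ ≠ 0 := norm_ne_zero_iff.2 hx
  have hx1 : ‖x‖ • (‖x‖⁻¹ • x) = x := by rw [smul_smul, mul_inv_cancel₀ hr, one_smul]
  have h1 : HasDerivAt (fun s : ℝ => s • (‖x‖⁻¹ • x)) (‖x‖⁻¹ • x) ‖x‖ := by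
    simpa using (hasDerivAt_id ‖x‖).smul_const (‖x‖⁻¹ • x)
  have h2 : HasDerivAt (fun s : ℝ => V (s • (‖x‖⁻¹ • x))) (fderiv ℝ V x (‖x‖⁻¹ • x)) ‖x‖ := by
    have h3 : HasFDerivAt V (fderiv ℝ V x) (‖x‖ • (‖x‖⁻¹ • x)) := by
      rw [hx1]; exact hV.hasFDerivAt
    exact h3.comp_hasDerivAt ‖x‖ h1
  have h4 := (hasDerivAt_id ‖x‖).mul h2
  have h5 : deriv (fun s : ℝ => s * V (s • (‖x‖⁻¹ • x))) ‖x‖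
      = 1 * V (‖x‖ • (‖x‖⁻¹ • x)) + ‖x‖ * fderiv ℝ V x (‖x‖⁻¹ • x) := h4.deriv
  rw [tildeV, h5, hx1, map_smul, smul_eq_mul, ← mul_assoc, mul_inv_cancel₀ hr]
  ring

lemma hasFDerivAt_norm {x : Euc n} (hx : x ≠ 0) :
    HasFDerivAt (fun y : Euc n => ‖y‖) (‖x‖⁻¹ • innerSL ℝ x) x := by
  have hr : ‖x‖ ≠ 0 := norm_ne_zero_iff.2 hx
  have h1 := ((hasFDerivAt_id x).norm_sq).sqrt (pow_ne_zero 2 hr)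
  simp only [id, Real.sqrt_sq (norm_nonneg _)] at h1
  refine h1.congr_fderiv ?_
  ext v
  simp
  field_simp

/-- The multiplier `r ∂_r φ + ((n - 1) / 2 - i k r) φ`. -/
def mult (k : ℂ) (φ : Euc n → ℂ) (x : Euc n) : ℂ :=
  fderiv ℝ φ x x + ((((n : ℝ) - 1) / 2 : ℝ) - Complex.I * k * (‖x‖ : ℝ)) * φ x

lemma fderiv_mult (k : ℂ) {φ : Euc n → ℂ} (hφ : ContDiff ℝ 2 φ) {x : Euc n} (hx : x ≠ 0)
    (v : Euc n) :
    HasFDerivAt (mult k φ) (fderiv ℝ (mult k φ) x) x ∧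
    fderiv ℝ (mult k φ) x v = fderiv ℝ (fderiv ℝ φ) x v x + fderiv ℝ φ x v
      + (-(Complex.I * k) * (‖x‖⁻¹ * inner ℝ x v : ℝ)) * φ x
      + ((((n : ℝ) - 1) / 2 : ℝ) - Complex.I * k * (‖x‖ : ℝ)) * fderiv ℝ φ x v := by
  have h1 : HasFDerivAt φ (fderiv ℝ φ x) x := (hφ.differentiable two_ne_zero x).hasFDerivAt
  have h2 : HasFDerivAt (fderiv ℝ φ) (fderiv ℝ (fderiv ℝ φ) x) x :=
    ((hφ.fderiv_right (m := 1) (by norm_num)).differentiable one_ne_zero x).hasFDerivAt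
  have h3 := (Complex.ofRealCLM.hasFDerivAt (x := ‖x‖)).comp x (hasFDerivAt_norm hx)
  have h4 := (h2.clm_apply (hasFDerivAt_id x)).add
    (((h3.const_mul (Complex.I * k)).const_sub ((((n : ℝ) - 1) / 2 : ℝ) : ℂ)).mul h1)
  have h5 := HasFDerivAt.fderiv (f := mult k φ) h4
  refine ⟨h5 ▸ h4, ?_⟩
  rw [h5]
  simp
  ring

lemma hasFDerivAt_normSq {f : Euc n → ℂ} {f' : Euc n →L[ℝ] ℂ} {x : Euc n}
    (hf : HasFDerivAt f f' x) : HasFDerivAt (fun y => ‖f y‖ ^ 2)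
      ((2 : ℕ) • (innerSL ℝ (f x)).comp f') x := hf.norm_sq

lemma fderiv_gradSq {φ : Euc n → ℂ} (hφ : ContDiff ℝ 2 φ) (x v : Euc n) :
    HasFDerivAt (gradSq φ) (fderiv ℝ (gradSq φ) x) x ∧
    fderiv ℝ (gradSq φ) x v = 2 * ∑ i : Fin n, (starRingEnd ℂ
      (fderiv ℝ φ x (EuclideanSpace.single i 1))
        * fderiv ℝ (fderiv ℝ φ) x v (EuclideanSpace.single i 1)).re := by
  have h2 : HasFDerivAt (fderiv ℝ φ) (fderiv ℝ (fderiv ℝ φ) x) x :=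
    ((hφ.fderiv_right (m := 1) (by norm_num)).differentiable one_ne_zero x).hasFDerivAt
  have h3 := HasFDerivAt.fun_sum (u := Finset.univ) fun (i : Fin n) _ =>
    hasFDerivAt_normSq (h2.clm_apply (hasFDerivAt_const (EuclideanSpace.single i (1 : ℝ)) x))
  have h5 := HasFDerivAt.fderiv (f := gradSq φ) h3
  refine ⟨h5 ▸ h3, ?_⟩
  rw [h5, Finset.mul_sum]
  simp [Complex.inner]
  refine Finset.sum_congr rfl fun i _ => ?_
  ring

end Derivatives


/-! ### Pointwise multiplier identities -/

section Pointwise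

variable {n : ℕ}

open scoped Laplacian ComplexConjugate

/-- The modified radial derivative `∂_r φ + (λ / r - i k) φ`. -/
def modDeriv (k : ℂ) (φ : Euc n → ℂ) (x : Euc n) : ℂ :=
  (‖x‖⁻¹ : ℝ) * fderiv ℝ φ x x + ((lam n * ‖x‖⁻¹ : ℝ) - Complex.I * k) * φ x

/-- A flux `Re(φ̄ ∂_i ψ)`. -/
def flux (f φ : Euc n → ℂ) (i : Fin n) (x : Euc n) : ℝ :=
  (conj (f x) * fderiv ℝ φ x (EuclideanSpace.single i 1)).re

lemma sum_fderiv_flux {f φ : Euc n → ℂ} (hφ : ContDiff ℝ 2 φ) {x : Euc n}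
    (hf : HasFDerivAt f (fderiv ℝ f x) x) :
    ∑ i, fderiv ℝ (flux f φ i) x (EuclideanSpace.single i 1)
      = (conj (f x) * (Δ φ) x).re + ∑ i : Fin n, (conj (fderiv ℝ f x (EuclideanSpace.single i 1))
        * fderiv ℝ φ x (EuclideanSpace.single i 1)).re := by
  have h2 : HasFDerivAt (fderiv ℝ φ) (fderiv ℝ (fderiv ℝ φ) x) x :=
    ((hφ.fderiv_right (m := 1) (by norm_num)).differentiable one_ne_zero x).hasFDerivAt
  rw [laplacian_eq_sum, Finset.mul_sum, Complex.re_sum, ← Finset.sum_add_distrib]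
  refine Finset.sum_congr rfl fun i _ => ?_
  have h3 := h2.clm_apply (hasFDerivAt_const (EuclideanSpace.single i (1 : ℝ)) x)
  have h4 := Complex.reCLM.hasFDerivAt.comp x
    ((Complex.conjCLE.toContinuousLinearMap.hasFDerivAt.comp x hf).mul h3)
  have h5 := HasFDerivAt.fderiv (f := flux f φ i) h4
  rw [h5]
  simp
  ring

lemma sum_conj_mul_self (L : Euc n →L[ℝ] ℂ) (a : ℂ) :
    ∑ i : Fin n, (a * (conj (L (EuclideanSpace.single i 1))
      * L (EuclideanSpace.single i 1))).re
      = a.re * ∑ i : Fin n, ‖L (EuclideanSpace.single i 1)‖ ^ 2 := by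
  rw [Finset.mul_sum]
  refine Finset.sum_congr rfl fun i _ => ?_
  rw [Complex.conj_mul']
  norm_cast
  exact Complex.re_mul_ofReal _ _

/-- The second-order part of `∇(mult k φ)` is the Hessian applied to `x`; paired with `∇φ` it
becomes half the derivative of `|∇φ|²` along `x`, which `radialFlux` later absorbs into a
divergence. The coefficient of `|∇φ|²` is `1 + (n - 1)/2` plus the real part `Im k · r` of `-ikr`.
-/
lemma sum_fderiv_flux_mult (k : ℂ) {φ : Euc n → ℂ} (hφ : ContDiff ℝ 2 φ) {x : Euc n}
    (hx : x ≠ 0) :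
    ∑ i, fderiv ℝ (flux (mult k φ) φ i) x (EuclideanSpace.single i 1)
      = (conj (mult k φ x) * (Δ φ) x).re + fderiv ℝ (gradSq φ) x x / 2
        + (((n : ℝ) + 1) / 2 + k.im * ‖x‖) * gradSq φ x
        + ‖x‖⁻¹ * (conj (-(Complex.I * k) * φ x) * fderiv ℝ φ x x).re := by
  rw [sum_fderiv_flux hφ (fderiv_mult k hφ hx 0).1, (fderiv_gradSq hφ x x).2]
  have hsymm : ∀ v w, fderiv ℝ (fderiv ℝ φ) x v w = fderiv ℝ (fderiv ℝ φ) x w v :=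
    fun v w => (hφ.contDiffAt.isSymmSndFDerivAt (by simp)) v w
  have h1 : ∀ i : Fin n, (conj (fderiv ℝ (mult k φ) x (EuclideanSpace.single i 1))
        * fderiv ℝ φ x (EuclideanSpace.single i 1)).re
      = (conj (fderiv ℝ φ x (EuclideanSpace.single i 1))
          * fderiv ℝ (fderiv ℝ φ) x x (EuclideanSpace.single i 1)).re
        + ((1 + conj (((((n : ℝ) - 1) / 2 : ℝ) : ℂ) - Complex.I * k * (‖x‖ : ℝ))) *
          (conj (fderiv ℝ φ x (EuclideanSpace.single i 1))
            * fderiv ℝ φ x (EuclideanSpace.single i 1))).re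
        + ‖x‖⁻¹ * (conj (-(Complex.I * k) * φ x)
          * (((x i : ℝ) : ℂ) * fderiv ℝ φ x (EuclideanSpace.single i 1))).re := by
    intro i
    rw [(fderiv_mult k hφ hx _).2, hsymm (EuclideanSpace.single i 1) x]
    have hi : inner ℝ x (EuclideanSpace.single i (1 : ℝ)) = x i := by
      simp [EuclideanSpace.inner_single_right]
    rw [hi]
    simp
    ring
  simp_rw [h1]
  rw [Finset.sum_add_distrib, Finset.sum_add_distrib, sum_conj_mul_self, ← Finset.mul_sum,
    ← Complex.re_sum, ← Complex.re_sum, ← Finset.mul_sum, Complex.re_sum]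
  have h3 : fderiv ℝ φ x x = ∑ i, ((x i : ℝ) : ℂ) * fderiv ℝ φ x (EuclideanSpace.single i 1) := by
    conv_lhs => rw [clm_apply_eq_sum (fderiv ℝ φ x) x]
    simp
  rw [← h3, gradSq]
  -- Writing `n = 2c + 1` replaces the cast of `(n - 1)/2` by an atom, so that `ring` can close the
  -- goal.
  obtain ⟨c, hc⟩ : ∃ c : ℝ, (n : ℝ) = 2 * c + 1 := ⟨((n : ℝ) - 1) / 2, by ring⟩
  have hc' : (2 * c + 1 - 1) / 2 = c := by ring
  rw [hc, hc']
  simp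
  ring

lemma hasFDerivAt_norm_inv {x : Euc n} (hx : x ≠ 0) :
    HasFDerivAt (fun y : Euc n => ‖y‖⁻¹) (-(‖x‖⁻¹ ^ 3) • innerSL ℝ x) x := by
  have hr : ‖x‖ ≠ 0 := norm_ne_zero_iff.2 hx
  refine ((hasDerivAt_inv hr).comp_hasFDerivAt x (hasFDerivAt_norm hx)).congr_fderiv ?_
  rw [smul_smul]
  congr 1
  field_simp

/-- The potential of the radial vector field in the multiplier identity. -/
def radialFlux (k : ℂ) (V : Euc n → ℝ) (φ : Euc n → ℂ) (x : Euc n) : ℝ :=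
  1 / 2 * gradSq φ x
    + (1 / 2 * V x - ‖k‖ ^ 2 / 2 - lam n * (1 / 2 * ‖x‖⁻¹ ^ 2 + k.im * ‖x‖⁻¹)) * ‖φ x‖ ^ 2

lemma fderiv_radialFlux (k : ℂ) {V : Euc n → ℝ} {φ : Euc n → ℂ} (hφ : ContDiff ℝ 2 φ)
    {x : Euc n} (hx : x ≠ 0) (hV : DifferentiableAt ℝ V x) :
    fderiv ℝ (radialFlux k V φ) x x = fderiv ℝ (gradSq φ) x x / 2
      + (fderiv ℝ V x x / 2 + lam n * (‖x‖⁻¹ ^ 2 + k.im * ‖x‖⁻¹)) * ‖φ x‖ ^ 2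
      + (V x / 2 - ‖k‖ ^ 2 / 2 - lam n * (‖x‖⁻¹ ^ 2 / 2 + k.im * ‖x‖⁻¹))
        * (2 * (conj (φ x) * fderiv ℝ φ x x).re) := by
  have hr : ‖x‖ ≠ 0 := norm_ne_zero_iff.2 hx
  have h1 : HasFDerivAt φ (fderiv ℝ φ x) x := (hφ.differentiable two_ne_zero x).hasFDerivAt
  have h2 := hasFDerivAt_norm_inv hx
  have h3 := (((hV.hasFDerivAt.const_mul (1 / 2)).sub_const (‖k‖ ^ 2 / 2)).sub
    ((((h2.pow 2).const_mul (1 / 2)).add (h2.const_mul k.im)).const_mul (lam n))).mul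
    (hasFDerivAt_normSq h1)
  have h4 := ((fderiv_gradSq hφ x x).1.const_mul (1 / 2)).add h3
  have h5 := HasFDerivAt.fderiv (f := radialFlux k V φ) h4
  rw [h5]
  simp [Complex.inner]
  field_simp
  ring

/-- The potential `|φ|² / (2 r²)`. -/
def hardyFlux (φ : Euc n → ℂ) (x : Euc n) : ℝ := 1 / 2 * (‖x‖⁻¹ ^ 2 * ‖φ x‖ ^ 2)

lemma fderiv_hardyFlux {φ : Euc n → ℂ} {x : Euc n} (hφ : DifferentiableAt ℝ φ x)
    (hx : x ≠ 0) :
    fderiv ℝ (hardyFlux φ) x x = ‖x‖⁻¹ ^ 2 * (conj (φ x) * fderiv ℝ φ x x).re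
      - ‖x‖⁻¹ ^ 2 * ‖φ x‖ ^ 2 := by
  have hr : ‖x‖ ≠ 0 := norm_ne_zero_iff.2 hx
  have h4 := (((hasFDerivAt_norm_inv hx).pow 2).mul (hasFDerivAt_normSq hφ.hasFDerivAt)).const_mul (1 / 2)
  have h5 := HasFDerivAt.fderiv (f := hardyFlux φ) h4
  rw [h5]
  simp [Complex.inner]
  field_simp
  ring

lemma normSq_modDeriv (k : ℂ) (φ : Euc n → ℂ) (x : Euc n) :
    ‖modDeriv k φ x‖ ^ 2 = ‖x‖⁻¹ ^ 2 * ‖fderiv ℝ φ x x‖ ^ 2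
      + ((lam n * ‖x‖⁻¹ + k.im) ^ 2 + k.re ^ 2) * ‖φ x‖ ^ 2
      + 2 * ‖x‖⁻¹ * ((lam n * ‖x‖⁻¹ + k.im) * (conj (φ x) * fderiv ℝ φ x x).re
        - k.re * (conj (φ x) * fderiv ℝ φ x x).im) := by
  simp only [modDeriv, Complex.sq_norm, Complex.normSq_apply]
  simp
  ring

/-- This is the central algebraic identity. The dilation part of `mult` produces `tildeV` and the
weight `1/2`; the part `-ikr` produces `V` and the weight `Im k · r`. The `λ` terms of `radialFlux`
complete the radial derivatives to the square of `modDeriv`, leaving exactly the spherical forms of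
(A3) and (A2). After the derivatives are expanded, everything is polynomial in `φ`, `x · ∇φ`, `Δφ`,
`|∇φ|²` and `V`. -/
lemma mult_identity (k : ℂ) {V : Euc n → ℝ} {φ : Euc n → ℂ} (hφ : ContDiff ℝ 2 φ)
    {x : Euc n} (hx : x ≠ 0) (hV : DifferentiableAt ℝ V x) :
    (conj (mult k φ x) * (schrodingerExpr V φ x - k ^ 2 * φ x)).re
      = (1 / 2 + k.im * ‖x‖) * ‖modDeriv k φ x‖ ^ 2 + k.im ^ 2 * ‖φ x‖ ^ 2
        + ‖x‖⁻¹ ^ 2 / 2 * (sphGradSq φ x + (lam n ^ 2 + ‖x‖ ^ 2 * tildeV V x) * ‖φ x‖ ^ 2)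
        + k.im * ‖x‖⁻¹ * (sphGradSq φ x + (lam n ^ 2 + ‖x‖ ^ 2 * V x) * ‖φ x‖ ^ 2)
        + (n * radialFlux k V φ x + fderiv ℝ (radialFlux k V φ) x x)
        - ∑ i, fderiv ℝ (flux (mult k φ) φ i) x (EuclideanSpace.single i 1) := by
  have hr : ‖x‖ ≠ 0 := norm_ne_zero_iff.2 hx
  rw [sum_fderiv_flux_mult k hφ hx, fderiv_radialFlux k hφ hx hV, sphGradSq_eq φ hx,
    tildeV_eq hx hV, normSq_modDeriv, radialFlux, schrodingerExpr, mult, lam]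
  simp only [Complex.sq_norm k, Complex.sq_norm (φ x), Complex.sq_norm (fderiv ℝ φ x x),
    Complex.normSq_apply, pow_two k]
  generalize (Δ φ) x = L
  generalize fderiv ℝ φ x x = d
  generalize fderiv ℝ (gradSq φ) x x = g
  generalize gradSq φ x = N
  generalize fderiv ℝ V x x = W
  generalize φ x = u
  obtain ⟨c, hc⟩ : ∃ c : ℝ, (n : ℝ) = 2 * c + 1 := ⟨((n : ℝ) - 1) / 2, by ring⟩
  have hc' : (2 * c + 1 - 1) / 2 = c := by ring
  rw [hc, hc']
  simp
  field_simp
  ring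

/-- Since `λ + 1/2 = (n - 1)/2`, one has `mult = r · modDeriv + φ/2`. The cross term is `Im k
|φ|²/r` plus the divergence of `x |φ|²/(2r²)`. -/
lemma normSq_mult (k : ℂ) {φ : Euc n → ℂ} {x : Euc n} (hφ : DifferentiableAt ℝ φ x)
    (hx : x ≠ 0) :
    ‖x‖⁻¹ ^ 2 * ‖mult k φ x‖ ^ 2 = ‖modDeriv k φ x‖ ^ 2 + ‖x‖⁻¹ ^ 2 * ‖φ x‖ ^ 2 / 4
      + k.im * ‖x‖⁻¹ * ‖φ x‖ ^ 2 + (n * hardyFlux φ x + fderiv ℝ (hardyFlux φ) x x) := by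
  have hr : ‖x‖ ≠ 0 := norm_ne_zero_iff.2 hx
  rw [normSq_modDeriv, fderiv_hardyFlux hφ hx, hardyFlux, mult, lam]
  simp only [Complex.sq_norm, Complex.normSq_apply]
  generalize fderiv ℝ φ x x = d
  generalize φ x = u
  obtain ⟨c, hc⟩ : ∃ c : ℝ, (n : ℝ) = 2 * c + 1 := ⟨((n : ℝ) - 1) / 2, by ring⟩
  have hc' : (2 * c + 1 - 1) / 2 = c := by ring
  rw [hc, hc']
  simp
  field_simp
  ring

/-- Hardy's inequality as an identity: up to a divergence, `|∂_rφ|² = |∂_rφ + λφ/r|² + λ²|φ|²/r²`,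
and the last term supplies the `λ²` in the form of (A2). -/
lemma form_identity {V : Euc n → ℝ} {φ : Euc n → ℂ} (hφ : ContDiff ℝ 2 φ)
    {x : Euc n} (hx : x ≠ 0) :
    (conj (φ x) * schrodingerExpr V φ x).re
      = ‖modDeriv 0 φ x‖ ^ 2
        + ‖x‖⁻¹ ^ 2 * (sphGradSq φ x + (lam n ^ 2 + ‖x‖ ^ 2 * V x) * ‖φ x‖ ^ 2)
        - 2 * lam n * (n * hardyFlux φ x + fderiv ℝ (hardyFlux φ) x x)
        - ∑ i, fderiv ℝ (flux φ φ i) x (EuclideanSpace.single i 1) := by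
  have hr : ‖x‖ ≠ 0 := norm_ne_zero_iff.2 hx
  have hd : DifferentiableAt ℝ φ x := hφ.differentiable two_ne_zero x
  have h1 := sum_conj_mul_self (fderiv ℝ φ x) 1
  simp only [one_mul, Complex.one_re] at h1
  rw [sum_fderiv_flux hφ hd.hasFDerivAt, h1, ← gradSq, fderiv_hardyFlux hd hx, hardyFlux,
    sphGradSq_eq φ hx, normSq_modDeriv, schrodingerExpr, lam]
  simp only [Complex.sq_norm, Complex.normSq_apply]
  generalize fderiv ℝ φ x x = d
  generalize φ x = u
  simp
  field_simp
  ring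

end Pointwise


/-! ### The a priori estimate for test functions -/

section Spheres

variable {n : ℕ}

/-- Polar coordinates, with the radius as outer variable. -/
lemma integral_nonneg_of_spheres (hn : n ≠ 0) {f : Euc n → ℝ}
    (h : ∀ r : ℝ, 0 < r → 0 ≤ ∫ θ : Metric.sphere (0 : Euc n) 1, f (r • (θ : Euc n))
      ∂(volume : Measure (Euc n)).toSphere) : 0 ≤ ∫ x, f x := by
  have : Nontrivial (Euc n) := by
    have : NeZero n := ⟨hn⟩
    infer_instance
  have h1 : ∫ x, f x = ∫ p : Metric.sphere (0 : Euc n) 1 × Set.Ioi (0 : ℝ),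
      f ((p.2 : ℝ) • (p.1 : Euc n)) ∂(volume : Measure (Euc n)).toSphere.prod
        (.volumeIoiPow (Module.finrank ℝ (Euc n) - 1)) := by
    have h2 := (Measure.measurePreserving_homeomorphUnitSphereProd
      (volume : Measure (Euc n))).integral_comp
      (homeomorphUnitSphereProd (Euc n)).measurableEmbedding (fun p : Metric.sphere (0 : Euc n) 1 × Set.Ioi (0 : ℝ) =>
        f ((p.2 : ℝ) • (p.1 : Euc n)))
    have h3 := integral_subtype_comap (μ := (volume : Measure (Euc n)))
      (measurableSet_singleton (0 : Euc n)).compl f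
    rw [restrict_compl_singleton] at h3
    rw [← h2, ← h3]
    have h4 : ∀ x : ({0}ᶜ : Set (Euc n)), f ((homeomorphUnitSphereProd (Euc n) x).2.1 •
        ((homeomorphUnitSphereProd (Euc n) x).1 : Euc n)) = f x := fun x => by
      have hx : ‖(x : Euc n)‖ ≠ 0 := norm_ne_zero_iff.2 x.2
      simp [smul_smul, hx]
    simp_rw [h4]
  rw [h1]
  by_cases hi : Integrable (fun p : Metric.sphere (0 : Euc n) 1 × Set.Ioi (0 : ℝ) =>
      f ((p.2 : ℝ) • (p.1 : Euc n))) ((volume : Measure (Euc n)).toSphere.prod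
        (.volumeIoiPow (Module.finrank ℝ (Euc n) - 1)))
  · rw [integral_prod_symm _ hi]
    exact integral_nonneg fun r => h r r.2
  -- Without integrability the integral is `0` by convention, so no integrability hypothesis is
  -- needed.
  · rw [integral_undef hi]

end Spheres

/-! ### Continuity away from the origin of the quantities in the identities. -/

section Continuity

variable {n : ℕ} {φ : Euc n → ℂ}

lemma continuousOn_norm_inv : ContinuousOn (fun x : Euc n => ‖x‖⁻¹) {0}ᶜ :=
  continuous_norm.continuousOn.inv₀ fun _ hx => norm_ne_zero_iff.2 hx

lemma continuous_fderiv_apply_self (hφ : ContDiff ℝ 2 φ) :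
    Continuous fun x => fderiv ℝ φ x x :=
  (hφ.continuous_fderiv two_ne_zero).clm_apply continuous_id

lemma continuous_gradSq (hφ : ContDiff ℝ 2 φ) : Continuous (gradSq φ) :=
  continuous_finsetSum _ fun _ _ =>
    (((hφ.continuous_fderiv two_ne_zero).clm_apply continuous_const).norm).pow 2

lemma continuousOn_sphGradSq (hφ : ContDiff ℝ 2 φ) : ContinuousOn (sphGradSq φ) {0}ᶜ := by
  refine ContinuousOn.congr (f := fun x => ‖x‖ ^ 2 * gradSq φ x - ‖fderiv ℝ φ x x‖ ^ 2) ?_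
    fun x hx => sphGradSq_eq φ hx
  exact (((continuous_norm.pow 2).mul (continuous_gradSq hφ)).sub
    ((continuous_fderiv_apply_self hφ).norm.pow 2)).continuousOn

lemma continuousOn_modDeriv (k : ℂ) (hφ : ContDiff ℝ 2 φ) :
    ContinuousOn (modDeriv k φ) {0}ᶜ :=
  ((Complex.continuous_ofReal.comp_continuousOn continuousOn_norm_inv).mul
    (continuous_fderiv_apply_self hφ).continuousOn).add
    (((Complex.continuous_ofReal.comp_continuousOn
      (continuousOn_const.mul continuousOn_norm_inv)).sub continuousOn_const).mul
      hφ.continuous.continuousOn)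

lemma continuous_mult (k : ℂ) (hφ : ContDiff ℝ 2 φ) : Continuous (mult k φ) :=
  (continuous_fderiv_apply_self hφ).add ((continuous_const.sub (continuous_const.mul
    (Complex.continuous_ofReal.comp continuous_norm))).mul hφ.continuous)

lemma continuousOn_tildeV {V : Euc n → ℝ} (hV : ContDiffOn ℝ 1 V {0}ᶜ) :
    ContinuousOn (tildeV V) {0}ᶜ := by
  refine ContinuousOn.congr (f := fun x => -V x - fderiv ℝ V x x) ?_
    fun x hx => tildeV_eq hx ((hV.differentiableOn one_ne_zero).differentiableAt
      (isOpen_compl_singleton.mem_nhds hx))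
  exact hV.continuousOn.neg.sub ((hV.continuousOn_fderiv_of_isOpen isOpen_compl_singleton
    (by norm_num)).clm_apply continuousOn_id)

end Continuity

/-! ### Integrated identities and the a priori estimates. -/

section TestFunctions

variable {n : ℕ} (φ : TestFun n)

open scoped Laplacian

lemma TestFun.fderiv_eq_zero {x : Euc n} (h : φ =ᶠ[𝓝 x] 0) : fderiv ℝ φ x = 0 := by
  rw [h.fderiv_eq]
  simp

/-- A radial weight is constant on each sphere and comes out of the spherical integral, so the
hypothesis applies sphere by sphere. -/
lemma integral_positive_on_spheres {W : Euc n → ℝ} {δ : ℝ} (hn : n ≠ 0)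
    (hW : ContinuousOn W {0}ᶜ) (hpos : PositiveOnSpheres W δ) {m : ℝ → ℝ}
    (hm0 : ∀ r, 0 < r → 0 ≤ m r) :
    0 ≤ ∫ x, m ‖x‖ * (sphGradSq φ x + (lam n ^ 2 + ‖x‖ ^ 2 * W x) * ‖φ x‖ ^ 2
      - δ ^ 2 * ‖φ x‖ ^ 2) := by
  refine integral_nonneg_of_spheres hn fun r hr => ?_
  have hmap : Continuous fun θ : Metric.sphere (0 : Euc n) 1 => r • (θ : Euc n) := by fun_prop
  have hne : ∀ θ : Metric.sphere (0 : Euc n) 1, r • (θ : Euc n) ∈ ({0}ᶜ : Set (Euc n)) := fun θ =>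
    smul_ne_zero hr.ne' (ne_zero_of_mem_unit_sphere θ)
  have hnorm : ∀ θ : Metric.sphere (0 : Euc n) 1, ‖r • (θ : Euc n)‖ = r := fun θ => by
    rw [norm_smul, Real.norm_of_nonneg hr.le, norm_eq_of_mem_sphere, mul_one]
  have hi : ∀ f : Euc n → ℝ, ContinuousOn f {0}ᶜ → Integrable
      (fun θ : Metric.sphere (0 : Euc n) 1 => f (r • (θ : Euc n)))
      (volume : Measure (Euc n)).toSphere := fun f hf =>
    (hf.comp_continuous hmap hne).integrable_of_hasCompactSupport
      (HasCompactSupport.of_compactSpace _)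
  simp_rw [hnorm]
  rw [integral_const_mul]
  refine mul_nonneg (hm0 r hr) ?_
  have h := hpos φ (φ.contDiff_two.of_le (by norm_num)).contDiffOn r hr
  rw [sphereIntegral, sphereIntegral, mul_left_comm] at h
  have h' := le_of_mul_le_mul_left h (pow_pos hr _)
  have e1 := hi (fun x => sphGradSq φ x + (lam n ^ 2 + ‖x‖ ^ 2 * W x) * ‖φ x‖ ^ 2)
    ((continuousOn_sphGradSq φ.contDiff_two).add ((continuousOn_const.add
      ((continuous_norm.pow 2).continuousOn.mul hW)).mul (φ.continuous.norm.pow 2).continuousOn))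
  have e2 := hi (fun x => δ ^ 2 * ‖φ x‖ ^ 2)
    (continuous_const.mul (φ.continuous.norm.pow 2)).continuousOn
  simp_rw [hnorm] at e1 e2 h'
  rw [integral_sub e1 e2, integral_const_mul]
  exact sub_nonneg.2 h'

lemma contDiff_hardyFlux : ContDiff ℝ 1 (hardyFlux φ) := by
  refine contDiff_of_contDiffOn_compl_zero φ (fun x hx => ?_) fun x hx => ?_
  · have h1 : ContDiffAt ℝ 1 φ x := (φ.contDiff_two.of_le (by norm_num)).contDiffAt
    have h2 : ContDiffAt ℝ 1 (fun y : Euc n => ‖y‖⁻¹) x :=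
      (contDiffAt_norm ℝ hx).inv (norm_ne_zero_iff.2 hx)
    exact (contDiffAt_const.mul ((h2.pow 2).mul (h1.norm_sq ℝ))).contDiffWithinAt
  · simp [hardyFlux, hx.self_of_nhds]

lemma contDiff_gradSq {φ : Euc n → ℂ} (hφ : ContDiff ℝ 2 φ) : ContDiff ℝ 1 (gradSq φ) :=
  ContDiff.sum fun _ _ =>
    (((hφ.fderiv_right (m := 1) (by norm_num)).clm_apply contDiff_const).norm_sq ℝ)

lemma radialFlux_eq_zero (k : ℂ) (V : Euc n → ℝ) {x : Euc n} (hx : φ =ᶠ[𝓝 x] 0) :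
    radialFlux k V φ x = 0 := by
  simp [radialFlux, gradSq, φ.fderiv_eq_zero hx, hx.self_of_nhds]

lemma contDiff_radialFlux (k : ℂ) {V : Euc n → ℝ} (hV : ContDiffOn ℝ 1 V {0}ᶜ) :
    ContDiff ℝ 1 (radialFlux k V φ) := by
  refine contDiff_of_contDiffOn_compl_zero φ (fun x hx => ?_) fun x hx =>
    radialFlux_eq_zero φ k V hx
  have h1 : ContDiffAt ℝ 1 φ x := (φ.contDiff_two.of_le (by norm_num)).contDiffAt
  have h2 : ContDiffAt ℝ 1 (fun y : Euc n => ‖y‖⁻¹) x :=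
    (contDiffAt_norm ℝ hx).inv (norm_ne_zero_iff.2 hx)
  have h3 : ContDiffAt ℝ 1 V x := hV.contDiffAt (isOpen_compl_singleton.mem_nhds hx)
  exact ((contDiffAt_const.mul (contDiff_gradSq φ.contDiff_two).contDiffAt).add
    ((((contDiffAt_const.mul h3).sub contDiffAt_const).sub (contDiffAt_const.mul
      ((contDiffAt_const.mul (h2.pow 2)).add (contDiffAt_const.mul h2)))).mul
      (h1.norm_sq ℝ))).contDiffWithinAt

lemma contDiff_flux {f : Euc n → ℂ} (hf : ContDiffOn ℝ 1 f {0}ᶜ) (i : Fin n) :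
    ContDiff ℝ 1 (flux f φ i) := by
  refine contDiff_of_contDiffOn_compl_zero φ ?_ fun x hx => by simp [flux, φ.fderiv_eq_zero hx]
  exact Complex.reCLM.contDiff.comp_contDiffOn ((Complex.conjCLE.contDiff.comp_contDiffOn hf).mul
    ((φ.contDiff_two.fderiv_right (m := 1) (by norm_num)).clm_apply
      contDiff_const).contDiffOn)

lemma hasCompactSupport_flux (f : Euc n → ℂ) (i : Fin n) :
    HasCompactSupport (flux f φ i) :=
  hasCompactSupport_of_testFun φ fun x hx => by simp [flux, φ.fderiv_eq_zero hx]

lemma contDiffOn_mult (k : ℂ) : ContDiffOn ℝ 1 (mult k φ) {0}ᶜ := fun x hx => by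
  have h1 : ContDiffAt ℝ 1 φ x := (φ.contDiff_two.of_le (by norm_num)).contDiffAt
  have h2 : ContDiffAt ℝ 1 (fderiv ℝ φ) x :=
    (φ.contDiff_two.fderiv_right (m := 1) (by norm_num)).contDiffAt
  have h3 : ContDiffAt ℝ 1 (fun y : Euc n => ((‖y‖ : ℝ) : ℂ)) x :=
    Complex.ofRealCLM.contDiff.contDiffAt.comp x (contDiffAt_norm ℝ hx)
  exact ((h2.clm_apply contDiffAt_id).add ((contDiffAt_const.sub
    (contDiffAt_const.mul h3)).mul h1)).contDiffWithinAt

lemma integral_sum_fderiv_flux {f : Euc n → ℂ} (hf : ContDiffOn ℝ 1 f {0}ᶜ) :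
    ∫ x, ∑ i, fderiv ℝ (flux f φ i) x (EuclideanSpace.single i 1) = 0 :=
  integral_sum_fderiv_eq_zero (contDiff_flux φ hf) (hasCompactSupport_flux φ f)

lemma integrable_sum_fderiv_flux {f : Euc n → ℂ} (hf : ContDiffOn ℝ 1 f {0}ᶜ) :
    Integrable fun x => ∑ i, fderiv ℝ (flux f φ i) x (EuclideanSpace.single i 1) :=
  integrable_finsetSum _ fun i _ => (((contDiff_flux φ hf i).continuous_fderiv
    one_ne_zero).clm_apply continuous_const).integrable_of_hasCompactSupport
    ((hasCompactSupport_flux φ f i).fderiv_apply (𝕜 := ℝ) _)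

lemma integrable_radial_div {f : Euc n → ℝ} (hf : ContDiff ℝ 1 f) (hc : HasCompactSupport f) :
    Integrable fun x => n * f x + fderiv ℝ f x x := by
  refine ((hf.continuous.integrable_of_hasCompactSupport hc).const_mul _).add ?_
  refine ((hf.continuous_fderiv one_ne_zero).clm_apply
    continuous_id).integrable_of_hasCompactSupport ?_
  exact (hc.fderiv (𝕜 := ℝ)).mono fun x hx => by
    contrapose! hx
    simp only [Function.mem_support, not_not] at hx ⊢
    simp [hx]

lemma hasCompactSupport_hardyFlux : HasCompactSupport (hardyFlux φ) :=
  hasCompactSupport_of_testFun φ fun x hx => by simp [hardyFlux, hx.self_of_nhds]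

lemma ae_ne_zero (hn : n ≠ 0) : ∀ᵐ x : Euc n, x ≠ 0 := by
  have : Nontrivial (Euc n) := by
    have : NeZero n := ⟨hn⟩
    infer_instance
  rw [ae_iff]
  simp

lemma integrable_weight_mul_normSq {g : Euc n → ℝ} (hg : ContinuousOn g {0}ᶜ) :
    Integrable fun x => g x * ‖φ x‖ ^ 2 :=
  integrable_of_testFun φ (hg.mul (φ.continuous.norm.pow 2).continuousOn)
    fun x hx => by simp [hx.self_of_nhds]

lemma integrable_normSq_modDeriv (k : ℂ) {g : Euc n → ℝ} (hg : ContinuousOn g {0}ᶜ) :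
    Integrable fun x => g x * ‖modDeriv k φ x‖ ^ 2 :=
  integrable_of_testFun φ (hg.mul ((continuousOn_modDeriv k φ.contDiff_two).norm.pow 2))
    fun x hx => by simp [modDeriv, φ.fderiv_eq_zero hx, hx.self_of_nhds]

lemma integrable_normSq_mult (k : ℂ) {g : Euc n → ℝ} (hg : ContinuousOn g {0}ᶜ) :
    Integrable fun x => g x * ‖mult k φ x‖ ^ 2 :=
  integrable_of_testFun φ (hg.mul ((continuous_mult k φ.contDiff_two).norm.pow 2).continuousOn)
    fun x hx => by simp [mult, φ.fderiv_eq_zero hx, hx.self_of_nhds]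

lemma integrable_weight_mul_sphGradSq_add {W g : Euc n → ℝ} {c : ℝ} (hg : ContinuousOn g {0}ᶜ)
    (hW : ContinuousOn W {0}ᶜ) :
    Integrable fun x => g x * (sphGradSq φ x + (lam n ^ 2 + ‖x‖ ^ 2 * W x) * ‖φ x‖ ^ 2
      - c * ‖φ x‖ ^ 2) := by
  refine integrable_of_testFun φ ?_ fun x hx => by
    simp [sphGradSq, radialDeriv, φ.fderiv_eq_zero hx, hx.self_of_nhds]
  have h := (φ.continuous.norm.pow 2).continuousOn (s := {0}ᶜ)
  exact hg.mul (((continuousOn_sphGradSq φ.contDiff_two).add ((continuousOn_const.add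
      ((continuous_norm.pow 2).continuousOn.mul hW)).mul h)).sub (continuousOn_const.mul h))

lemma integral_normSq_mult (hn : n ≠ 0) (k : ℂ) :
    ∫ x, ‖x‖⁻¹ ^ 2 * ‖mult k φ x‖ ^ 2
      = (∫ x, ‖modDeriv k φ x‖ ^ 2) + (∫ x, ‖x‖⁻¹ ^ 2 * ‖φ x‖ ^ 2) / 4
        + k.im * ∫ x, ‖x‖⁻¹ * ‖φ x‖ ^ 2 := by
  have h1 : ∀ᵐ x : Euc n, ‖x‖⁻¹ ^ 2 * ‖mult k φ x‖ ^ 2 = ‖modDeriv k φ x‖ ^ 2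
      + ‖x‖⁻¹ ^ 2 * ‖φ x‖ ^ 2 / 4 + k.im * (‖x‖⁻¹ * ‖φ x‖ ^ 2)
      + (n * hardyFlux φ x + fderiv ℝ (hardyFlux φ) x x) := by
    filter_upwards [ae_ne_zero hn] with x hx
    rw [normSq_mult k (φ.contDiff_two.differentiable two_ne_zero x) hx]
    ring
  have i1 : Integrable fun x => ‖modDeriv k φ x‖ ^ 2 := by
    simpa using integrable_normSq_modDeriv φ k (g := fun _ => 1) continuousOn_const
  have i2 : Integrable fun x => ‖x‖⁻¹ ^ 2 * ‖φ x‖ ^ 2 / 4 :=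
    (integrable_weight_mul_normSq φ (continuousOn_norm_inv.pow 2)).div_const 4
  have i3 := (integrable_weight_mul_normSq φ continuousOn_norm_inv).const_mul k.im
  rw [integral_congr_ae h1, integral_add ((i1.fun_add i2).fun_add i3) (integrable_radial_div
    (contDiff_hardyFlux φ) (hasCompactSupport_hardyFlux φ)), integral_radial_div_eq_zero
    (contDiff_hardyFlux φ) (hasCompactSupport_hardyFlux φ), add_zero, integral_add (i1.fun_add i2) i3,
    integral_add i1 i2, integral_div, integral_const_mul]

/-- After integration of `mult_identity` the divergences vanish and the spherical forms are at least
`δ²|φ|²`. The nonnegative terms `Im k · r |modDeriv|²` and `(Im k)² |φ|²` are discarded. -/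
lemma le_integral_mult_mul (hn : n ≠ 0) {V : Euc n → ℝ} (hV : ContDiffOn ℝ 1 V {0}ᶜ) {δ : ℝ}
    (hA2 : PositiveOnSpheres V δ) (hA3 : PositiveOnSpheres (tildeV V) δ) {k : ℂ} (hk : 0 < k.im) :
    (∫ x, ‖modDeriv k φ x‖ ^ 2) / 2 + δ ^ 2 * (∫ x, ‖x‖⁻¹ ^ 2 * ‖φ x‖ ^ 2) / 2
        + δ ^ 2 * (k.im * ∫ x, ‖x‖⁻¹ * ‖φ x‖ ^ 2)
      ≤ ∫ x, (starRingEnd ℂ (mult k φ x) * (schrodingerExpr V φ x - k ^ 2 * φ x)).re := by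
  have h1 : ∀ᵐ x : Euc n,
      (starRingEnd ℂ (mult k φ x) * (schrodingerExpr V φ x - k ^ 2 * φ x)).re
      = ‖modDeriv k φ x‖ ^ 2 / 2 + δ ^ 2 * (‖x‖⁻¹ ^ 2 * ‖φ x‖ ^ 2) / 2
        + δ ^ 2 * (k.im * (‖x‖⁻¹ * ‖φ x‖ ^ 2))
        + (k.im * ‖x‖ * ‖modDeriv k φ x‖ ^ 2 + k.im ^ 2 * ‖φ x‖ ^ 2)
        + ‖x‖⁻¹ ^ 2 / 2 * (sphGradSq φ x + (lam n ^ 2 + ‖x‖ ^ 2 * tildeV V x) * ‖φ x‖ ^ 2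
          - δ ^ 2 * ‖φ x‖ ^ 2)
        + k.im * ‖x‖⁻¹ * (sphGradSq φ x + (lam n ^ 2 + ‖x‖ ^ 2 * V x) * ‖φ x‖ ^ 2
          - δ ^ 2 * ‖φ x‖ ^ 2)
        + (n * radialFlux k V φ x + fderiv ℝ (radialFlux k V φ) x x)
        - ∑ i, fderiv ℝ (flux (mult k φ) φ i) x (EuclideanSpace.single i 1) := by
    filter_upwards [ae_ne_zero hn] with x hx
    rw [mult_identity k φ.contDiff_two hx ((hV.differentiableOn one_ne_zero).differentiableAt
      (isOpen_compl_singleton.mem_nhds hx))]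
    ring
  have hcn : ContinuousOn (fun x : Euc n => ‖x‖) {0}ᶜ := continuous_norm.continuousOn
  have i1 : Integrable fun x => ‖modDeriv k φ x‖ ^ 2 / 2 := by
    simpa using (integrable_normSq_modDeriv φ k (g := fun _ => 1) continuousOn_const).div_const 2
  have i2 : Integrable fun x => δ ^ 2 * (‖x‖⁻¹ ^ 2 * ‖φ x‖ ^ 2) / 2 := ((integrable_weight_mul_normSq φ (continuousOn_norm_inv.pow 2)).const_mul
    (δ ^ 2)).div_const 2
  have i3 := ((integrable_weight_mul_normSq φ continuousOn_norm_inv).const_mul k.im).const_mul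
    (δ ^ 2)
  have i4 : Integrable fun x => k.im * ‖x‖ * ‖modDeriv k φ x‖ ^ 2 + k.im ^ 2 * ‖φ x‖ ^ 2 :=
    (integrable_normSq_modDeriv φ k (continuousOn_const (c := k.im).mul hcn)).add
    (integrable_weight_mul_normSq φ (continuousOn_const (c := k.im ^ 2)))
  have i5 : Integrable fun x => ‖x‖⁻¹ ^ 2 / 2 * (sphGradSq φ x
      + (lam n ^ 2 + ‖x‖ ^ 2 * tildeV V x) * ‖φ x‖ ^ 2 - δ ^ 2 * ‖φ x‖ ^ 2) :=
    integrable_weight_mul_sphGradSq_add φ (c := δ ^ 2)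
    ((continuousOn_norm_inv.pow 2).div_const 2) (continuousOn_tildeV hV)
  have i6 : Integrable fun x => k.im * ‖x‖⁻¹ * (sphGradSq φ x
      + (lam n ^ 2 + ‖x‖ ^ 2 * V x) * ‖φ x‖ ^ 2 - δ ^ 2 * ‖φ x‖ ^ 2) :=
    integrable_weight_mul_sphGradSq_add φ (c := δ ^ 2)
    (continuousOn_const (c := k.im).mul continuousOn_norm_inv) hV.continuousOn
  have hcs : HasCompactSupport (radialFlux k V φ) :=
    hasCompactSupport_of_testFun φ fun x hx => radialFlux_eq_zero φ k V hx
  have i7 := integrable_radial_div (contDiff_radialFlux φ k hV) hcs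
  have i8 := integrable_sum_fderiv_flux φ (contDiffOn_mult φ k)
  have p4 : 0 ≤ ∫ x, (k.im * ‖x‖ * ‖modDeriv k φ x‖ ^ 2 + k.im ^ 2 * ‖φ x‖ ^ 2) :=
    integral_nonneg fun x => by positivity
  have p5 := integral_positive_on_spheres φ hn (continuousOn_tildeV hV) hA3
    (m := fun r => r⁻¹ ^ 2 / 2) fun r hr => by positivity
  have p6 := integral_positive_on_spheres φ hn hV.continuousOn hA2
    (m := fun r => k.im * r⁻¹) fun r hr => by positivity
  rw [integral_congr_ae h1, integral_sub ((((((i1.fun_add i2).fun_add i3).fun_add i4).fun_add i5).fun_add i6).fun_add i7) i8,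
    integral_add (((((i1.fun_add i2).fun_add i3).fun_add i4).fun_add i5).fun_add i6) i7,
    integral_add ((((i1.fun_add i2).fun_add i3).fun_add i4).fun_add i5) i6,
    integral_add (((i1.fun_add i2).fun_add i3).fun_add i4) i5,
    integral_add ((i1.fun_add i2).fun_add i3) i4, integral_add (i1.fun_add i2) i3, integral_add i1 i2,
    integral_radial_div_eq_zero (contDiff_radialFlux φ k hV) hcs,
    integral_sum_fderiv_flux φ (contDiffOn_mult φ k), integral_div, integral_div,
    integral_const_mul, integral_const_mul, integral_const_mul]
  linarith

/-- The elementary inequality behind the value of the constant in the resolvent estimate. -/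
lemma le_max_sq_mul {δ e Y B T F : ℝ} (hδ : 0 < δ) (he : 0 ≤ e) (hY : 0 ≤ Y) (hB : 0 ≤ B)
    (hF : 0 ≤ F) (hT : e / 2 + δ ^ 2 * Y / 2 + δ ^ 2 * B ≤ T)
    (hTF : T ^ 2 ≤ (e + Y / 4 + B) * F) : Y ≤ max (1 / δ ^ 2) (√2 / δ) ^ 2 * F := by
  set c := max (1 / δ ^ 2) (√2 / δ)
  have h0 : 0 ≤ e / 2 + δ ^ 2 * Y / 2 + δ ^ 2 * B := by positivity
  have h1 : (e / 2 + δ ^ 2 * Y / 2 + δ ^ 2 * B) ^ 2 ≤ (e + Y / 4 + B) * F :=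
    (pow_le_pow_left₀ h0 hT 2).trans hTF
  have hc1 : 1 ≤ c ^ 2 * δ ^ 4 := by
    have h : 1 / δ ^ 2 ≤ c := le_max_left _ _
    rw [div_le_iff₀ (by positivity)] at h
    nlinarith
  have hc2 : 2 ≤ c ^ 2 * δ ^ 2 := by
    have h : √2 / δ ≤ c := le_max_right _ _
    rw [div_le_iff₀ hδ] at h
    have h2 := Real.sq_sqrt (zero_le_two (α := ℝ))
    have h3 := Real.sqrt_nonneg 2
    nlinarith
  -- Here the two entries of the maximum arise. The term `eY` on the left needs `c²δ²/2 ≥ 1`, which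
  -- is `hc2`; the terms `Y²/4` and `BY` need `c²δ⁴ ≥ 1`, which is `hc1`. The remaining terms on the
  -- right are nonnegative.
  have key : (e + Y / 4 + B) * Y ≤ c ^ 2 * (e / 2 + δ ^ 2 * Y / 2 + δ ^ 2 * B) ^ 2 := by
    have e1 : c ^ 2 * (e / 2 + δ ^ 2 * Y / 2 + δ ^ 2 * B) ^ 2
        = c ^ 2 * (e ^ 2 / 4) + c ^ 2 * δ ^ 2 * (e * Y / 2 + e * B)
          + c ^ 2 * δ ^ 4 * (Y ^ 2 / 4 + B * Y + B ^ 2) := by ring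
    have e2 := mul_le_mul_of_nonneg_right hc2 (by positivity : 0 ≤ e * Y / 2 + e * B)
    have e3 := mul_le_mul_of_nonneg_right hc1 (by positivity : 0 ≤ Y ^ 2 / 4 + B * Y + B ^ 2)
    have e4 : 0 ≤ c ^ 2 * (e ^ 2 / 4) := by positivity
    have e5 : 0 ≤ e * B := mul_nonneg he hB
    have e6 := sq_nonneg B
    rw [e1]
    nlinarith
  -- For `Y > 0` the common factor `e + Y/4 + B` is positive and can be cancelled.
  rcases hY.eq_or_lt with h | h
  · rw [← h]; positivity
  · have hX : 0 < e + Y / 4 + B := by positivity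
    have h2 : (e + Y / 4 + B) * Y ≤ (e + Y / 4 + B) * (c ^ 2 * F) := by
      calc _ ≤ _ := key
        _ ≤ c ^ 2 * ((e + Y / 4 + B) * F) := mul_le_mul_of_nonneg_left h1 (sq_nonneg c)
        _ = _ := by ring
    exact le_of_mul_le_mul_left h2 hX

lemma continuous_schrodingerExpr {V : Euc n → ℝ} (hV : ContinuousOn V {0}ᶜ) :
    Continuous (schrodingerExpr V φ) := by
  refine continuous_of_continuousOn_compl_zero φ ?_ fun x hx => ?_
  · have h : Continuous fun x => ∑ i : Fin n, fderiv ℝ (fderiv ℝ φ) x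
        (EuclideanSpace.single i 1) (EuclideanSpace.single i 1) :=
      continuous_finsetSum _ fun i _ => (((φ.contDiff_two.fderiv_right (m := 1)
        (by norm_num)).continuous_fderiv one_ne_zero).clm_apply continuous_const).clm_apply
        continuous_const
    have h' : schrodingerExpr V φ = fun x => -(∑ i : Fin n, fderiv ℝ (fderiv ℝ φ) x
        (EuclideanSpace.single i 1) (EuclideanSpace.single i 1)) + (V x : ℂ) * φ x := by
      ext x
      rw [schrodingerExpr, laplacian_eq_sum]
    rw [h']
    exact h.continuousOn.neg.add ((Complex.continuous_ofReal.comp_continuousOn hV).mul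
      φ.continuous.continuousOn)
  · have h := (InnerProductSpace.laplacian_congr_nhds hx).self_of_nhds
    have h0 : (Δ (0 : Euc n → ℂ)) x = 0 := by simp [laplacian_eq_sum]
    simp [schrodingerExpr, hx.self_of_nhds, h, h0]

lemma schrodingerExpr_eq_zero (V : Euc n → ℝ) {x : Euc n} (hx : φ =ᶠ[𝓝 x] 0) :
    schrodingerExpr V φ x = 0 := by
  have h := (InnerProductSpace.laplacian_congr_nhds hx).self_of_nhds
  have h0 : (Δ (0 : Euc n → ℂ)) x = 0 := by simp [laplacian_eq_sum]
  simp [schrodingerExpr, hx.self_of_nhds, h, h0]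

/-- The a priori estimate `‖r⁻¹ φ‖ ≤ C ‖r (-Δ + V - k²) φ‖` for test functions. -/
lemma integral_normSq_le (hn : n ≠ 0) {V : Euc n → ℝ} (hV : ContDiffOn ℝ 1 V {0}ᶜ) {δ : ℝ}
    (hδ : 0 < δ) (hA2 : PositiveOnSpheres V δ) (hA3 : PositiveOnSpheres (tildeV V) δ) {k : ℂ}
    (hk : 0 < k.im) :
    ∫ x, ‖x‖⁻¹ ^ 2 * ‖φ x‖ ^ 2 ≤ max (1 / δ ^ 2) (√2 / δ) ^ 2
      * ∫ x, ‖x‖ ^ 2 * ‖schrodingerExpr V φ x - k ^ 2 * φ x‖ ^ 2 := by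
  have hT := le_integral_mult_mul φ hn hV hA2 hA3 hk
  have hX := integral_normSq_mult φ hn k
  set T := ∫ x, (starRingEnd ℂ (mult k φ x) * (schrodingerExpr V φ x - k ^ 2 * φ x)).re with hTd
  have hcs := continuous_schrodingerExpr φ hV.continuousOn
  have iF : Integrable fun x => ‖x‖ ^ 2 * ‖schrodingerExpr V φ x - k ^ 2 * φ x‖ ^ 2 :=
    integrable_of_testFun φ ((continuous_norm.pow 2).mul ((hcs.sub (continuous_const.mul
      φ.continuous)).norm.pow 2)).continuousOn fun x hx => by
        simp [schrodingerExpr_eq_zero φ V hx, hx.self_of_nhds]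
  have iT : Integrable fun x => (starRingEnd ℂ (mult k φ x)
      * (schrodingerExpr V φ x - k ^ 2 * φ x)).re :=
    integrable_of_testFun φ (Complex.continuous_re.comp ((Complex.continuous_conj.comp
      (continuous_mult k φ.contDiff_two)).mul (hcs.sub (continuous_const.mul
      φ.continuous)))).continuousOn fun x hx => by
        simp [schrodingerExpr_eq_zero φ V hx, hx.self_of_nhds]
  have iX : Integrable fun x => ‖x‖⁻¹ ^ 2 * ‖mult k φ x‖ ^ 2 :=
    integrable_normSq_mult φ k (continuousOn_norm_inv.pow 2)
  refine le_max_sq_mul hδ (integral_nonneg fun x => by positivity)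
    (integral_nonneg fun x => by positivity) (mul_nonneg hk.le (integral_nonneg fun x =>
    by positivity)) (integral_nonneg fun x => by positivity) hT ?_
  rw [← hX]
  -- Cauchy-Schwarz through a discriminant: the quadratic in `s` is the integral of `|s r⁻¹ Mφ - r
  -- g|²`, with `Mφ` the multiplier and `g = (-Δ + V - k²)φ`.
  have hq : ∀ s : ℝ, 0 ≤ (∫ x, ‖x‖⁻¹ ^ 2 * ‖mult k φ x‖ ^ 2) * (s * s) + (-(2 * T)) * s
      + ∫ x, ‖x‖ ^ 2 * ‖schrodingerExpr V φ x - k ^ 2 * φ x‖ ^ 2 := by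
    intro s
    have h : (∫ x, ‖x‖⁻¹ ^ 2 * ‖mult k φ x‖ ^ 2) * (s * s) + (-(2 * T)) * s
      + (∫ x, ‖x‖ ^ 2 * ‖schrodingerExpr V φ x - k ^ 2 * φ x‖ ^ 2)
      = ∫ x, ((s * s) * (‖x‖⁻¹ ^ 2 * ‖mult k φ x‖ ^ 2) + (-(2 * s)) * (starRingEnd ℂ (mult k φ x)
      * (schrodingerExpr V φ x - k ^ 2 * φ x)).re
        + ‖x‖ ^ 2 * ‖schrodingerExpr V φ x - k ^ 2 * φ x‖ ^ 2) := by
      rw [integral_add ((iX.const_mul _).fun_add (iT.const_mul _)) iF,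
        integral_add (iX.const_mul _) (iT.const_mul _), integral_const_mul, integral_const_mul,
        hTd]
      ring
    rw [h]
    refine integral_nonneg_of_ae ?_
    filter_upwards [ae_ne_zero hn] with x hx
    have hr : ‖x‖ ≠ 0 := norm_ne_zero_iff.2 hx
    have e : (s * s) * (‖x‖⁻¹ ^ 2 * ‖mult k φ x‖ ^ 2) + (-(2 * s)) * (starRingEnd ℂ (mult k φ x)
      * (schrodingerExpr V φ x - k ^ 2 * φ x)).re
        + ‖x‖ ^ 2 * ‖schrodingerExpr V φ x - k ^ 2 * φ x‖ ^ 2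
        = ‖((s * ‖x‖⁻¹ : ℝ) : ℂ) * mult k φ x
          - (‖x‖ : ℝ) * (schrodingerExpr V φ x - k ^ 2 * φ x)‖ ^ 2 := by
      generalize schrodingerExpr V φ x - k ^ 2 * φ x = g
      generalize mult k φ x = M
      simp only [Complex.sq_norm, Complex.normSq_apply]
      simp
      field_simp
      ring
    rw [e]
    exact sq_nonneg _
  have hd := discrim_le_zero hq
  rw [discrim] at hd
  nlinarith

/-- The coercivity of the quadratic form of `-Δ + V`. -/
lemma le_integral_form (hn : n ≠ 0) {V : Euc n → ℝ} (hV : ContinuousOn V {0}ᶜ) {δ : ℝ}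
    (hA2 : PositiveOnSpheres V δ) :
    (∫ x, ‖modDeriv 0 φ x‖ ^ 2) + δ ^ 2 * (∫ x, ‖x‖⁻¹ ^ 2 * ‖φ x‖ ^ 2)
      ≤ ∫ x, (starRingEnd ℂ (φ x) * schrodingerExpr V φ x).re := by
  have h1 : ∀ᵐ x : Euc n, (starRingEnd ℂ (φ x) * schrodingerExpr V φ x).re
      = ‖modDeriv 0 φ x‖ ^ 2 + δ ^ 2 * (‖x‖⁻¹ ^ 2 * ‖φ x‖ ^ 2)
        + ‖x‖⁻¹ ^ 2 * (sphGradSq φ x + (lam n ^ 2 + ‖x‖ ^ 2 * V x) * ‖φ x‖ ^ 2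
          - δ ^ 2 * ‖φ x‖ ^ 2)
        + (-(2 * lam n)) * (n * hardyFlux φ x + fderiv ℝ (hardyFlux φ) x x)
        - ∑ i, fderiv ℝ (flux φ φ i) x (EuclideanSpace.single i 1) := by
    filter_upwards [ae_ne_zero hn] with x hx
    rw [form_identity φ.contDiff_two hx]
    ring
  have i1 : Integrable fun x => ‖modDeriv 0 φ x‖ ^ 2 := by
    simpa using integrable_normSq_modDeriv φ 0 (g := fun _ => 1) continuousOn_const
  have i2 : Integrable fun x => δ ^ 2 * (‖x‖⁻¹ ^ 2 * ‖φ x‖ ^ 2) :=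
    (integrable_weight_mul_normSq φ (continuousOn_norm_inv.pow 2)).const_mul (δ ^ 2)
  have i3 : Integrable fun x => ‖x‖⁻¹ ^ 2 * (sphGradSq φ x
      + (lam n ^ 2 + ‖x‖ ^ 2 * V x) * ‖φ x‖ ^ 2 - δ ^ 2 * ‖φ x‖ ^ 2) :=
    integrable_weight_mul_sphGradSq_add φ (c := δ ^ 2) (continuousOn_norm_inv.pow 2) hV
  have i4 := (integrable_radial_div (contDiff_hardyFlux φ)
    (hasCompactSupport_hardyFlux φ)).const_mul (-(2 * lam n))
  have hφ1 : ContDiffOn ℝ 1 φ {0}ᶜ := (φ.contDiff_two.of_le (by norm_num)).contDiffOn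
  have i5 := integrable_sum_fderiv_flux φ hφ1
  have p3 := integral_positive_on_spheres φ hn hV hA2 (m := fun r => r⁻¹ ^ 2)
    fun r hr => by positivity
  rw [integral_congr_ae h1, integral_sub (((i1.fun_add i2).fun_add i3).fun_add i4) i5,
    integral_add ((i1.fun_add i2).fun_add i3) i4, integral_add (i1.fun_add i2) i3, integral_add i1 i2,
    integral_sum_fderiv_flux φ hφ1, integral_const_mul, integral_const_mul,
    integral_radial_div_eq_zero (contDiff_hardyFlux φ) (hasCompactSupport_hardyFlux φ)]
  linarith

end TestFunctions


/-! ### The operator `-Δ + V` on test functions -/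

section Operator

variable {n : ℕ}

open scoped Laplacian ComplexConjugate ContDiff

lemma laplacian_eq_sum_fderiv {F : Type*} [NormedAddCommGroup F] [NormedSpace ℝ F] {f : Euc n → F}
    (hf : ContDiff ℝ 2 f) (x : Euc n) :
    (Δ f) x = ∑ i, fderiv ℝ (fun y => fderiv ℝ f y (EuclideanSpace.single i 1)) x
      (EuclideanSpace.single i 1) := by
  have h2 : HasFDerivAt (fderiv ℝ f) (fderiv ℝ (fderiv ℝ f) x) x :=
    ((hf.fderiv_right (m := 1) (by norm_num)).differentiable one_ne_zero x).hasFDerivAt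
  rw [laplacian_eq_sum]
  refine Finset.sum_congr rfl fun i _ => ?_
  rw [(h2.clm_apply (hasFDerivAt_const (EuclideanSpace.single i (1 : ℝ)) x)).fderiv]
  simp

lemma contDiff_fderiv_dir {F : Type*} [NormedAddCommGroup F] [NormedSpace ℝ F] {f : Euc n → F}
    (hf : ContDiff ℝ 2 f) (v : Euc n) : ContDiff ℝ 1 fun y => fderiv ℝ f y v :=
  (hf.fderiv_right (m := 1) (by norm_num)).clm_apply contDiff_const

lemma continuous_fderiv_fderiv {F : Type*} [NormedAddCommGroup F] [NormedSpace ℝ F]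
    {f : Euc n → F} (hf : ContDiff ℝ 2 f) (v w : Euc n) :
    Continuous fun x => fderiv ℝ (fun y => fderiv ℝ f y v) x w :=
  ((contDiff_fderiv_dir hf v).continuous_fderiv one_ne_zero).clm_apply continuous_const

/-- Green's formula. -/
lemma integral_mul_laplacian {f g : Euc n → ℂ} (hf : ContDiff ℝ 2 f) (hg : ContDiff ℝ 2 g)
    (hc : HasCompactSupport f) : ∫ x, f x * (Δ g) x = ∫ x, (Δ f) x * g x := by
  have hf1 : ContDiff ℝ 1 f := hf.of_le (by norm_num)
  have hg1 : ContDiff ℝ 1 g := hg.of_le (by norm_num)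
  have hcd : ∀ v, HasCompactSupport fun x => fderiv ℝ f x v := fun v => hc.fderiv_apply (𝕜 := ℝ) v
  have c0 : ∀ v, Continuous fun x => fderiv ℝ f x v := fun v => (contDiff_fderiv_dir hf v).continuous
  have c1 : ∀ v, Continuous fun x => fderiv ℝ g x v := fun v => (contDiff_fderiv_dir hg v).continuous
  have i1 : ∀ v, Integrable fun x => f x * fderiv ℝ (fun y => fderiv ℝ g y v) x v := fun v =>
    (hf.continuous.mul (continuous_fderiv_fderiv hg v v)).integrable_of_hasCompactSupport
      hc.mul_right
  have i2 : ∀ v, Integrable fun x => fderiv ℝ f x v * fderiv ℝ g x v := fun v =>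
    ((c0 v).mul (c1 v)).integrable_of_hasCompactSupport (hcd v).mul_right
  have i3 : ∀ v, Integrable fun x => fderiv ℝ (fun y => fderiv ℝ f y v) x v * g x := fun v =>
    ((continuous_fderiv_fderiv hf v v).mul hg.continuous).integrable_of_hasCompactSupport
      ((hcd v).fderiv_apply (𝕜 := ℝ) v).mul_right
  have i4 : ∀ v, Integrable fun x => f x * fderiv ℝ g x v := fun v =>
    (hf.continuous.mul (c1 v)).integrable_of_hasCompactSupport hc.mul_right
  have i5 : ∀ v, Integrable fun x => fderiv ℝ f x v * g x := fun v =>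
    ((c0 v).mul hg.continuous).integrable_of_hasCompactSupport (hcd v).mul_right
  have key : ∀ v, ∫ x, f x * fderiv ℝ (fun y => fderiv ℝ g y v) x v
      = ∫ x, fderiv ℝ (fun y => fderiv ℝ f y v) x v * g x := fun v => by
    rw [integral_mul_fderiv_eq_neg_fderiv_mul_of_integrable (i2 v) (i1 v) (i4 v)
      (fun x _ => hf1.differentiable one_ne_zero x)
      (fun x _ => (contDiff_fderiv_dir hg v).differentiable one_ne_zero x),
      integral_mul_fderiv_eq_neg_fderiv_mul_of_integrable (i3 v) (i2 v) (i5 v)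
      (fun x _ => (contDiff_fderiv_dir hf v).differentiable one_ne_zero x)
      (fun x _ => hg1.differentiable one_ne_zero x), neg_neg]
  simp_rw [laplacian_eq_sum_fderiv hf, laplacian_eq_sum_fderiv hg, Finset.mul_sum, Finset.sum_mul]
  rw [integral_finsetSum _ fun i _ => i1 _, integral_finsetSum _ fun i _ => i3 _]
  exact Finset.sum_congr rfl fun i _ => key _

lemma laplacian_conj {f : Euc n → ℂ} (hf : ContDiff ℝ 2 f) (x : Euc n) :
    (Δ fun y => conj (f y)) x = conj ((Δ f) x) :=
  (hf.contDiffAt (x := x)).laplacian_CLM_comp_left (l := Complex.conjCLE.toContinuousLinearMap)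

lemma inner_toLp {f g : Euc n → ℂ} (hf : MemLp f 2 volume) (hg : MemLp g 2 volume) :
    inner ℂ (hf.toLp f) (hg.toLp g) = ∫ x, conj (f x) * g x := by
  rw [L2.inner_def]
  refine integral_congr_ae ?_
  filter_upwards [hf.coeFn_toLp, hg.coeFn_toLp] with x h1 h2
  rw [h1, h2, RCLike.inner_apply, mul_comm]

lemma inner_toLp_left {f : Euc n → ℂ} (hf : MemLp f 2 volume) (g : L2 n) :
    inner ℂ (hf.toLp f) g = ∫ x, conj (f x) * g x := by
  rw [L2.inner_def]
  refine integral_congr_ae ?_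
  filter_upwards [hf.coeFn_toLp] with x h1
  rw [h1, RCLike.inner_apply, mul_comm]

lemma exists_testFun_eq {V : Euc n → ℝ} (hV : ContinuousOn V {0}ᶜ)
    (φ : (schrodingerOp V hV).domain) : ∃ ψ : TestFun n, (φ : L2 n) = testToL2 n ψ
      ∧ schrodingerOp V hV φ = schrodingerTest V hV ψ := by
  obtain ⟨φ, ψ, rfl⟩ := φ
  exact ⟨ψ, rfl, schrodingerOp_apply hV ψ⟩

lemma inner_testToL2_schrodingerTest {V : Euc n → ℝ} (hV : ContinuousOn V {0}ᶜ)
    (φ ψ : TestFun n) : inner ℂ (testToL2 n φ) (schrodingerTest V hV ψ)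
      = ∫ x, conj (φ x) * schrodingerExpr V ψ x :=
  inner_toLp φ.memLp (schrodingerExpr_memLp hV ψ)

lemma schrodingerTest_symm {V : Euc n → ℝ} (hV : ContinuousOn V {0}ᶜ) (φ ψ : TestFun n) :
    inner ℂ (schrodingerTest V hV φ) (testToL2 n ψ)
      = inner ℂ (testToL2 n φ) (schrodingerTest V hV ψ) := by
  rw [inner_testToL2_schrodingerTest]
  refine (inner_toLp (schrodingerExpr_memLp hV φ) ψ.memLp).trans ?_
  have hφc : ContDiff ℝ 2 fun x => conj (φ x) := Complex.conjCLE.contDiff.comp φ.contDiff_two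
  have hcs : HasCompactSupport fun x => conj (φ x) :=
    φ.hasCompactSupport.comp_left (g := conj) (map_zero _)
  have h := integral_mul_laplacian hφc ψ.contDiff_two hcs
  have hVc : Integrable fun x => (V x : ℂ) * (conj (φ x) * ψ x) :=
    integrable_of_testFun φ ((Complex.continuous_ofReal.comp_continuousOn hV).mul
      (hφc.continuous.mul ψ.continuous).continuousOn) fun x hx => by simp [hx.self_of_nhds]
  have hlap : ∀ {f : Euc n → ℂ}, ContDiff ℝ 2 f → Continuous (Δ f) := fun {f} hf => by
    rw [show Δ f = fun x => _ from funext (laplacian_eq_sum_fderiv hf)]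
    exact continuous_finsetSum _ fun i _ => continuous_fderiv_fderiv hf _ _
  have j1 : Integrable fun x => conj (φ x) * (Δ (ψ : Euc n → ℂ)) x :=
    (hφc.continuous.mul (hlap ψ.contDiff_two)).integrable_of_hasCompactSupport hcs.mul_right
  have j2 : Integrable fun x => (Δ fun y => conj (φ y)) x * ψ x :=
    ((hlap hφc).mul ψ.continuous).integrable_of_hasCompactSupport ψ.hasCompactSupport.mul_left
  have e1 : ∀ x, conj (schrodingerExpr V φ x) * ψ x
      = (V x : ℂ) * (conj (φ x) * ψ x) - (Δ fun y => conj (φ y)) x * ψ x := fun x => by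
    rw [laplacian_conj φ.contDiff_two, schrodingerExpr]
    simp
    ring
  have e2 : ∀ x, conj (φ x) * schrodingerExpr V ψ x
      = (V x : ℂ) * (conj (φ x) * ψ x) - conj (φ x) * (Δ (ψ : Euc n → ℂ)) x := fun x => by
    rw [schrodingerExpr]
    ring
  simp_rw [e1, e2]
  rw [integral_sub hVc j1, integral_sub hVc j2, h]

lemma opForm_testToL2 (hn : n ≠ 0) {V : Euc n → ℝ} (hV : ContinuousOn V {0}ᶜ) {δ : ℝ}
    (hA2 : PositiveOnSpheres V δ) (ψ : TestFun n) :
    (∫ x, ‖modDeriv 0 ψ x‖ ^ 2) + δ ^ 2 * (∫ x, ‖x‖⁻¹ ^ 2 * ‖ψ x‖ ^ 2)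
      ≤ (inner ℂ (testToL2 n ψ) (schrodingerTest V hV ψ)).re := by
  have hi : Integrable fun x => conj (ψ x) * schrodingerExpr V ψ x :=
    ((Complex.continuous_conj.comp ψ.continuous).mul
      (continuous_schrodingerExpr ψ hV)).integrable_of_hasCompactSupport
      (hasCompactSupport_of_testFun ψ fun x hx => by simp [hx.self_of_nhds])
  rw [inner_testToL2_schrodingerTest]
  have h := le_integral_form ψ hn hV hA2
  have h1 : ∫ x, (conj (ψ x) * schrodingerExpr V ψ x).re
      = (∫ x, conj (ψ x) * schrodingerExpr V ψ x).re := integral_re hi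
  rwa [h1] at h

lemma schrodingerOp_isSymmNonneg (hn : n ≠ 0) {V : Euc n → ℝ} (hV : ContinuousOn V {0}ᶜ) {δ : ℝ}
    (hA2 : PositiveOnSpheres V δ) : IsSymmNonneg (schrodingerOp V hV) where
  symm φ ψ := by
    obtain ⟨f, hf, hf'⟩ := exists_testFun_eq hV φ
    obtain ⟨g, hg, hg'⟩ := exists_testFun_eq hV ψ
    rw [hf, hf', hg, hg', schrodingerTest_symm]
  nonneg φ := by
    obtain ⟨f, hf, hf'⟩ := exists_testFun_eq hV φ
    rw [opForm, hf, hf']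
    refine le_trans ?_ (opForm_testToL2 hn hV hA2 f)
    have h1 : 0 ≤ ∫ x, ‖modDeriv 0 f x‖ ^ 2 := integral_nonneg fun x => by positivity
    have h2 : 0 ≤ ∫ x, ‖x‖⁻¹ ^ 2 * ‖f x‖ ^ 2 := integral_nonneg fun x => by positivity
    positivity

/-- A real test function as a complex test function. -/
def TestFun.ofReal (g : Euc n → ℝ) (hg : ContDiff ℝ ∞ g) (hc : HasCompactSupport g)
    (h0 : (0 : Euc n) ∉ tsupport g) : TestFun n :=
  ⟨fun x => (g x : ℂ), Complex.ofRealCLM.contDiff.comp hg,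
    hc.comp_left (g := Complex.ofReal) Complex.ofReal_zero, fun x hx => by
      rintro rfl
      exact h0 (closure_mono (fun y hy => by simpa using hy) hx)⟩

/-- A function orthogonal to all test functions supported away from the origin vanishes almost
everywhere there, and the origin is a null set. -/
lemma dense_range_testToL2 (hn : n ≠ 0) : Dense (LinearMap.range (testToL2 n) : Set (L2 n)) := by
  rw [Submodule.dense_iff_topologicalClosure_eq_top,
    Submodule.topologicalClosure_eq_top_iff, Submodule.eq_bot_iff]
  intro h hh
  have h1 : ∀ᵐ x : Euc n, x ∈ ({0}ᶜ : Set (Euc n)) → h x = 0 := by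
    refine isOpen_compl_singleton.ae_eq_zero_of_integral_contDiff_smul_eq_zero
      (((Lp.memLp h).locallyIntegrable (by norm_num)).locallyIntegrableOn _) fun g hg hc hs => ?_
    have h2 := (Submodule.mem_orthogonal _ _).1 hh _ (LinearMap.mem_range_self (testToL2 n)
      (TestFun.ofReal g hg hc fun h => hs h rfl))
    have h3 := (inner_toLp_left (TestFun.ofReal g hg hc fun h => hs h rfl).memLp h).symm.trans h2
    rw [← h3]
    refine integral_congr_ae (Eventually.of_forall fun x => ?_)
    have h4 : (TestFun.ofReal g hg hc fun h => hs h rfl) x = (g x : ℂ) := rfl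
    simp [h4]
  rw [Lp.eq_zero_iff_ae_eq_zero]
  filter_upwards [h1, ae_ne_zero hn] with x hx hx0 using hx hx0

end Operator


/-! ### Mollification -/

section Mollification

variable {n : ℕ}

open scoped Convolution ContDiff Laplacian

/-- The mollification of `f` by a normalized bump function. -/
def mollify (ρ : ContDiffBump (0 : Euc n)) (f : Euc n → ℂ) : Euc n → ℂ :=
  ρ.normed volume ⋆[ContinuousLinearMap.lsmul ℝ ℝ, volume] f

variable (ρ : ContDiffBump (0 : Euc n))

lemma mollify_apply (f : Euc n → ℂ) (x : Euc n) :
    mollify ρ f x = ∫ t, ρ.normed volume (x - t) • f t := convolution_lsmul_swap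

lemma mollify_apply' (f : Euc n → ℂ) (x : Euc n) :
    mollify ρ f x = ∫ t, ρ.normed volume t • f (x - t) := convolution_lsmul

lemma lintegral_enorm_normed : ∫⁻ t, ‖ρ.normed (volume : Measure (Euc n)) t‖ₑ = 1 := by
  have h := ofReal_integral_eq_lintegral_ofReal (ρ.integrable_normed (μ := volume))
    (Eventually.of_forall ρ.nonneg_normed)
  rw [ρ.integral_normed, ENNReal.ofReal_one] at h
  rw [h]
  exact lintegral_congr fun t => Real.enorm_of_nonneg (ρ.nonneg_normed t)

lemma continuous_normed : Continuous (ρ.normed (volume : Measure (Euc n))) :=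
  (ρ.contDiff_normed (n := 0)).continuous

/-- Jensen's inequality for the probability density `ρ`, obtained from Cauchy-Schwarz by splitting
`ρ = ρ^(1/2) ρ^(1/2)`. -/
lemma enorm_mollify_sq_le {f : Euc n → ℂ} (hf : Measurable f) (x : Euc n) :
    ‖mollify ρ f x‖ₑ ^ (2 : ℝ) ≤ ∫⁻ t, ‖ρ.normed volume t‖ₑ * ‖f (x - t)‖ₑ ^ (2 : ℝ) := by
  have hm : Measurable fun t => ‖ρ.normed (volume : Measure (Euc n)) t‖ₑ :=
    (continuous_normed ρ).measurable.enorm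
  have hg : Measurable fun t => ‖f (x - t)‖ₑ := (hf.comp (measurable_const.sub measurable_id)).enorm
  have h1 : ‖mollify ρ f x‖ₑ ≤ ∫⁻ t, ‖ρ.normed volume t‖ₑ * ‖f (x - t)‖ₑ := by
    rw [mollify_apply']
    refine (enorm_integral_le_lintegral_enorm _).trans_eq (lintegral_congr fun t => ?_)
    rw [enorm_smul]
  have h2 := ENNReal.lintegral_mul_le_Lp_mul_Lq (volume : Measure (Euc n))
    (Real.HolderConjugate.two_two) (f := fun t => ‖ρ.normed volume t‖ₑ ^ (1 / 2 : ℝ))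
    (g := fun t => ‖ρ.normed volume t‖ₑ ^ (1 / 2 : ℝ) * ‖f (x - t)‖ₑ)
    (hm.pow_const _).aemeasurable ((hm.pow_const _).mul hg).aemeasurable
  have e1 : ∀ t, (‖ρ.normed (volume : Measure (Euc n)) t‖ₑ ^ (1 / 2 : ℝ)) ^ (2 : ℝ)
      = ‖ρ.normed volume t‖ₑ := fun t => by
    rw [← ENNReal.rpow_mul]
    norm_num
  simp only [Pi.mul_apply, ENNReal.mul_rpow_of_nonneg _ _ zero_le_two, e1] at h2
  rw [lintegral_enorm_normed, ENNReal.one_rpow, one_mul] at h2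
  have e2 : ∀ t, ‖ρ.normed (volume : Measure (Euc n)) t‖ₑ ^ (1 / 2 : ℝ)
      * (‖ρ.normed volume t‖ₑ ^ (1 / 2 : ℝ) * ‖f (x - t)‖ₑ)
      = ‖ρ.normed volume t‖ₑ * ‖f (x - t)‖ₑ := fun t => by
    rw [← mul_assoc, ← ENNReal.rpow_add_of_nonneg _ _ (by norm_num) (by norm_num)]
    norm_num
  simp only [e2] at h2
  calc _ ≤ _ := ENNReal.rpow_le_rpow (h1.trans h2) zero_le_two
    _ = _ := by
      rw [← ENNReal.rpow_mul]
      norm_num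

/-- Young's inequality for mollifications. -/
lemma eLpNorm_mollify_le {f : Euc n → ℂ} (hf : Measurable f) :
    eLpNorm (mollify ρ f) 2 volume ≤ eLpNorm f 2 volume := by
  rw [eLpNorm_eq_lintegral_rpow_enorm_toReal two_ne_zero ENNReal.ofNat_ne_top,
    eLpNorm_eq_lintegral_rpow_enorm_toReal two_ne_zero ENNReal.ofNat_ne_top]
  refine ENNReal.rpow_le_rpow ?_ (by positivity)
  simp only [ENNReal.toReal_ofNat]
  have hm : Measurable fun t => ‖ρ.normed (volume : Measure (Euc n)) t‖ₑ :=
    (continuous_normed ρ).measurable.enorm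
  calc ∫⁻ x, ‖mollify ρ f x‖ₑ ^ (2 : ℝ)
      ≤ ∫⁻ x, ∫⁻ t, ‖ρ.normed volume t‖ₑ * ‖f (x - t)‖ₑ ^ (2 : ℝ) :=
        lintegral_mono fun x => enorm_mollify_sq_le ρ hf x
    _ = ∫⁻ t, ∫⁻ x, ‖ρ.normed volume t‖ₑ * ‖f (x - t)‖ₑ ^ (2 : ℝ) := by
        refine lintegral_lintegral_swap ?_
        exact ((hm.comp measurable_snd).mul ((hf.comp (measurable_fst.sub
          measurable_snd)).enorm.pow_const _)).aemeasurable
    _ = ∫⁻ t, ‖ρ.normed volume t‖ₑ * ∫⁻ x, ‖f x‖ₑ ^ (2 : ℝ) := by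
        refine lintegral_congr fun t => ?_
        have hs : Measurable fun x => ‖f (x - t)‖ₑ ^ (2 : ℝ) :=
          (hf.comp (measurable_id.sub measurable_const)).enorm.pow_const _
        rw [lintegral_const_mul _ hs,
          lintegral_sub_right_eq_self (fun x => ‖f x‖ₑ ^ (2 : ℝ)) t]
    _ = ∫⁻ x, ‖f x‖ₑ ^ (2 : ℝ) := by
        rw [lintegral_mul_const _ hm, lintegral_enorm_normed, one_mul]

lemma contDiff_mollify {f : Euc n → ℂ} (hf : LocallyIntegrable f) : ContDiff ℝ ∞ (mollify ρ f) :=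
  ρ.hasCompactSupport_normed.contDiff_convolution_left _ ρ.contDiff_normed hf

lemma mollify_sub {f g : Euc n → ℂ} (hf : LocallyIntegrable f) (hg : LocallyIntegrable g)
    (x : Euc n) : mollify ρ (f - g) x = mollify ρ f x - mollify ρ g x := by
  have h1 := (ρ.hasCompactSupport_normed (μ := volume)).convolutionExists_left
    (ContinuousLinearMap.lsmul ℝ ℝ) (continuous_normed ρ) hf x
  have h2 := (ρ.hasCompactSupport_normed (μ := volume)).convolutionExists_left
    (ContinuousLinearMap.lsmul ℝ ℝ) (continuous_normed ρ) hg x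
  simp only [mollify, convolution_def]
  rw [← integral_sub h1 h2]
  simp [smul_sub]

lemma mollify_eq_zero {f : Euc n → ℂ} {x : Euc n}
    (h : ∀ y, ‖x - y‖ < ρ.rOut → f y = 0) : mollify ρ f x = 0 := by
  rw [mollify_apply]
  refine integral_eq_zero_of_ae (Eventually.of_forall fun t => ?_)
  by_cases ht : ‖x - t‖ < ρ.rOut
  · simp [h t ht]
  · have : x - t ∉ Function.support (ρ.normed (volume : Measure (Euc n))) := by
      rw [ρ.support_normed_eq]
      simpa using ht
    simp [Function.notMem_support.1 this]

/-- Uniform continuity makes the difference uniformly small. For radii below `1` it lives on the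
compact `1`-thickening of the support, which has finite measure. -/
lemma tendsto_eLpNorm_mollify_sub_of_continuous {ρ : ℕ → ContDiffBump (0 : Euc n)}
    (hρ : Tendsto (fun m => (ρ m).rOut) atTop (𝓝 0)) {g : Euc n → ℂ} (hg : Continuous g)
    (hc : HasCompactSupport g) :
    Tendsto (fun m => eLpNorm (mollify (ρ m) g - g) 2 volume) atTop (𝓝 0) := by
  set K := Metric.cthickening 1 (tsupport g) with hK
  have hKc : IsCompact K := IsCompact.cthickening hc
  have hKv : volume K ≠ ⊤ := hKc.measure_ne_top
  rw [ENNReal.tendsto_atTop_zero]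
  intro ε hε
  obtain ⟨c, hc0, hcε⟩ : ∃ c : ℝ, 0 < c ∧
      ENNReal.ofReal c * volume K ^ (1 / (2 : ENNReal).toReal) ≤ ε := by
    have hfin : volume K ^ (1 / (2 : ENNReal).toReal) ≠ ⊤ :=
      ENNReal.rpow_ne_top_of_nonneg (by positivity) hKv
    have ht : Tendsto (fun c : ℝ => ENNReal.ofReal c * volume K ^ (1 / (2 : ENNReal).toReal))
        (𝓝[>] 0) (𝓝 0) := by
      have h1 : Tendsto (fun c : ℝ => ENNReal.ofReal c) (𝓝[>] 0) (𝓝 0) := by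
        have h2 := (ENNReal.continuous_ofReal.tendsto 0)
        rw [ENNReal.ofReal_zero] at h2
        exact h2.mono_left nhdsWithin_le_nhds
      simpa using ENNReal.Tendsto.mul_const h1 (Or.inr hfin)
    obtain ⟨c, h1, h2⟩ := ((ht.eventually (Iic_mem_nhds hε)).and self_mem_nhdsWithin).exists
    exact ⟨c, h2, h1⟩
  have huc := hc.uniformContinuous_of_continuous hg
  obtain ⟨d, hd, hd'⟩ := Metric.uniformContinuous_iff.1 huc c hc0
  have hev : ∀ᶠ m in atTop, (ρ m).rOut < min d 1 := hρ.eventually (Iio_mem_nhds (lt_min hd one_pos))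
  obtain ⟨N, hN⟩ := eventually_atTop.1 hev
  refine ⟨N, fun m hm => ?_⟩
  have hlt := hN m hm
  have hpt : ∀ x, ‖(mollify (ρ m) g - g) x‖ ≤ ‖K.indicator (fun _ => c) x‖ := by
    intro x
    by_cases hx : x ∈ K
    · rw [Set.indicator_of_mem hx, Real.norm_of_nonneg hc0.le, Pi.sub_apply, ← dist_eq_norm]
      refine (ρ m).dist_normed_convolution_le hg.aestronglyMeasurable fun y hy => ?_
      exact (hd' (lt_trans (Metric.mem_ball.1 hy) (hlt.trans_le (min_le_left _ _)))).le
    · have h0 : ∀ y, ‖x - y‖ < (ρ m).rOut → g y = 0 := fun y hy => by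
        by_contra hgy
        refine hx (Metric.mem_cthickening_of_dist_le x y 1 _ (subset_tsupport g hgy) ?_)
        rw [dist_eq_norm]
        exact (hy.trans (hlt.trans_le (min_le_right _ _))).le
      have hgx : g x = 0 := h0 x (by simpa using (ρ m).rOut_pos)
      rw [Pi.sub_apply, mollify_eq_zero (ρ m) h0, hgx, sub_zero, norm_zero]
      exact norm_nonneg _
  refine (eLpNorm_mono hpt).trans ?_
  rw [eLpNorm_indicator_const hKc.measurableSet two_ne_zero ENNReal.ofNat_ne_top,
    Real.enorm_of_nonneg hc0.le]
  exact hcε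

/-- Mollifications converge in `L²`. -/
lemma tendsto_eLpNorm_mollify_sub {ρ : ℕ → ContDiffBump (0 : Euc n)}
    (hρ : Tendsto (fun m => (ρ m).rOut) atTop (𝓝 0)) {f : Euc n → ℂ} (hf : Measurable f)
    (hf2 : MemLp f 2 volume) :
    Tendsto (fun m => eLpNorm (mollify (ρ m) f - f) 2 volume) atTop (𝓝 0) := by
  rw [ENNReal.tendsto_atTop_zero]
  intro ε hε
  have hε3 : ε / 3 ≠ 0 := (ENNReal.div_pos hε.ne' (by norm_num)).ne'
  obtain ⟨g, hgc, hfg, hg, hg2⟩ := hf2.exists_hasCompactSupport_eLpNorm_sub_le (by norm_num) hε3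
  obtain ⟨N, hN⟩ := ENNReal.tendsto_atTop_zero.1
    (tendsto_eLpNorm_mollify_sub_of_continuous hρ hg hgc) (ε / 3)
    (ENNReal.div_pos hε.ne' (by norm_num))
  refine ⟨N, fun m hm => ?_⟩
  have hfl : LocallyIntegrable f := hf2.locallyIntegrable (by norm_num)
  have hgl : LocallyIntegrable g := hg.locallyIntegrable
  -- The outer two terms are small because `g` approximates `f` and mollification is a contraction
  -- on `L²`.
  have e : mollify (ρ m) f - f = mollify (ρ m) (f - g) + (mollify (ρ m) g - g) + (g - f) := by
    ext x
    simp only [Pi.add_apply, Pi.sub_apply, mollify_sub (ρ m) hfl hgl]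
    ring
  have s1 : AEStronglyMeasurable (mollify (ρ m) (f - g)) volume :=
    (contDiff_mollify _ (hfl.sub hgl)).continuous.aestronglyMeasurable
  have s2 : AEStronglyMeasurable (mollify (ρ m) g - g) volume :=
    ((contDiff_mollify _ hgl).continuous.sub hg).aestronglyMeasurable
  have s3 : AEStronglyMeasurable (g - f) volume :=
    hg.aestronglyMeasurable.sub hf.aestronglyMeasurable
  rw [e]
  calc _ ≤ eLpNorm (mollify (ρ m) (f - g) + (mollify (ρ m) g - g)) 2 volume
        + eLpNorm (g - f) 2 volume := eLpNorm_add_le (s1.add s2) s3 (by norm_num)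
    _ ≤ eLpNorm (mollify (ρ m) (f - g)) 2 volume + eLpNorm (mollify (ρ m) g - g) 2 volume
        + eLpNorm (g - f) 2 volume := by
      gcongr
      exact eLpNorm_add_le s1 s2 (by norm_num)
    _ ≤ ε / 3 + ε / 3 + ε / 3 := by
      gcongr
      · exact (eLpNorm_mollify_le _ (hf.sub hg.measurable)).trans hfg
      · exact hN m hm
      · rw [← eLpNorm_neg, neg_sub]
        exact hfg
    _ = ε := ENNReal.add_thirds ε

lemma fderiv_mollify_dir {k : Euc n → ℝ} {f : Euc n → ℂ} (hk : ContDiff ℝ 1 k)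
    (hc : HasCompactSupport k) (hf : LocallyIntegrable f) (x v : Euc n) :
    fderiv ℝ (k ⋆[ContinuousLinearMap.lsmul ℝ ℝ, volume] f) x v
      = ((fun t => fderiv ℝ k t v) ⋆[ContinuousLinearMap.lsmul ℝ ℝ, volume] f) x := by
  have h := hc.hasFDerivAt_convolution_left (ContinuousLinearMap.lsmul ℝ ℝ) hk hf x
  rw [h.fderiv, convolution_def, convolution_def]
  have hi : Integrable fun t => ((ContinuousLinearMap.lsmul ℝ ℝ).precompL (Euc n)
      (fderiv ℝ k t)) (f (x - t)) :=
    (hc.fderiv (𝕜 := ℝ)).convolutionExists_left _ (hk.continuous_fderiv one_ne_zero) hf x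
  rw [ContinuousLinearMap.integral_apply hi]
  rfl

/-- If `Δw = F` in the sense of distributions, then `Δ(ρ ⋆ w) = ρ ⋆ F`. -/
lemma laplacian_mollify {w F : Euc n → ℂ} (hw : LocallyIntegrable w)
    (h : ∀ ψ : Euc n → ℝ, ContDiff ℝ ∞ ψ → HasCompactSupport ψ →
      ∫ x, (Δ ψ) x • w x = ∫ x, ψ x • F x) (x : Euc n) :
    (Δ (mollify ρ w)) x = mollify ρ F x := by
  set k := ρ.normed (volume : Measure (Euc n)) with hk
  have hk2 : ContDiff ℝ 2 k := ρ.contDiff_normed (n := 2)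
  have hk1 : ContDiff ℝ 1 k := hk2.of_le (by norm_num)
  have hkc : HasCompactSupport k := ρ.hasCompactSupport_normed
  have h1 : ContDiff ℝ 2 (mollify ρ w) :=
    (contDiff_mollify ρ hw).of_le (WithTop.coe_le_coe.2 (le_top : (2 : ℕ∞) ≤ ⊤))
  -- The distributional equation is tested against the reflected, translated kernel. The two signs
  -- from the reflection cancel in second derivatives.
  set ψ : Euc n → ℝ := fun t => k (x - t) with hψ
  have hψc : HasCompactSupport ψ := hkc.comp_homeomorph (Homeomorph.subLeft x)
  have hψs : ContDiff ℝ ∞ ψ :=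
    (ρ.contDiff_normed (n := (⊤ : ℕ∞))).comp (contDiff_const.sub contDiff_id)
  have hψ2 : ContDiff ℝ 2 ψ := hk2.comp (contDiff_const.sub contDiff_id)
  have hd : ∀ {f : Euc n → ℝ} (_ : ContDiff ℝ 1 f) (t v : Euc n),
      fderiv ℝ (fun s => f (x - s)) t v = -fderiv ℝ f (x - t) v := fun {f} hf t v => by
    have e1 := (hf.differentiable one_ne_zero (x - t)).hasFDerivAt.comp t
      ((hasFDerivAt_id t).const_sub x)
    have e2 : fderiv ℝ (fun s => f (x - s)) t = _ := e1.fderiv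
    rw [e2]
    simp
  have e1 : ∀ t, (Δ ψ) t = ∑ i, fderiv ℝ (fun y => fderiv ℝ k y (EuclideanSpace.single i 1))
      (x - t) (EuclideanSpace.single i 1) := fun t => by
    rw [laplacian_eq_sum_fderiv hψ2]
    refine Finset.sum_congr rfl fun i _ => ?_
    simp_rw [hψ, hd hk1]
    rw [fderiv_fun_neg, neg_apply, hd (contDiff_fderiv_dir hk2 _), neg_neg]
  have e2 : ∀ v, fderiv ℝ (fun y => fderiv ℝ (mollify ρ w) y v) x v
      = ∫ t, fderiv ℝ (fun y => fderiv ℝ k y v) (x - t) v • w t := fun v => by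
    have e3 : (fun y => fderiv ℝ (mollify ρ w) y v)
        = (fun t => fderiv ℝ k t v) ⋆[ContinuousLinearMap.lsmul ℝ ℝ, volume] w :=
      funext fun y => fderiv_mollify_dir hk1 hkc hw y v
    rw [e3, fderiv_mollify_dir (contDiff_fderiv_dir hk2 v) (hkc.fderiv_apply (𝕜 := ℝ) v) hw,
      convolution_lsmul_swap]
  have i1 : ∀ v, Integrable fun t => fderiv ℝ (fun y => fderiv ℝ k y v) (x - t) v • w t := fun v =>
    (((hkc.fderiv_apply (𝕜 := ℝ) v).fderiv_apply (𝕜 := ℝ) v).convolutionExists_left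
      (ContinuousLinearMap.lsmul ℝ ℝ) (continuous_fderiv_fderiv hk2 v v) hw x).integrable_swap
  rw [laplacian_eq_sum_fderiv h1, mollify_apply, ← hk]
  simp_rw [e2]
  rw [← integral_finsetSum _ fun i _ => i1 _]
  have h3 := h ψ hψs hψc
  simp_rw [e1, Finset.sum_smul] at h3
  exact h3

end Mollification


/-! ### Logarithmic cutoffs -/

section Cutoff

variable {n : ℕ}

open scoped ContDiff Laplacian

/-- `h(log|x| / R)`, extended by `0` to the origin. -/
def logCutoff (h : ℝ → ℝ) (R : ℝ) (x : Euc n) : ℝ :=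
  if x = 0 then 0 else h (Real.log ‖x‖ / R)

variable {h : ℝ → ℝ} {R : ℝ}

@[simp] lemma logCutoff_zero : logCutoff h R (0 : Euc n) = 0 := if_pos rfl

lemma logCutoff_of_ne {x : Euc n} (hx : x ≠ 0) : logCutoff h R x = h (Real.log ‖x‖ / R) :=
  if_neg hx

lemma abs_logCutoff_le {C : ℝ} (hC : ∀ t, |h t| ≤ C) (x : Euc n) : |logCutoff h R x| ≤ C := by
  by_cases hx : x = 0
  · rw [hx, logCutoff_zero, abs_zero]
    exact (abs_nonneg _).trans (hC 0)
  · rw [logCutoff_of_ne hx]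
    exact hC _

lemma logCutoff_eq_zero (hR : 0 < R) (hh : ∀ t, 2 ≤ |t| → h t = 0) {x : Euc n}
    (hx : ‖x‖ ≤ Real.exp (-(2 * R)) ∨ Real.exp (2 * R) ≤ ‖x‖) : logCutoff h R x = 0 := by
  by_cases h0 : x = 0
  · rw [h0, logCutoff_zero]
  have hpos : 0 < ‖x‖ := norm_pos_iff.2 h0
  rw [logCutoff_of_ne h0]
  refine hh _ ?_
  rcases hx with hx | hx
  · refine le_trans ?_ (neg_le_abs _)
    rw [← neg_div, le_div_iff₀ hR]
    linarith [(Real.log_le_iff_le_exp hpos).2 hx]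
  · refine le_trans ?_ (le_abs_self _)
    rw [le_div_iff₀ hR]
    exact (Real.le_log_iff_exp_le hpos).2 hx

lemma logCutoff_eventuallyEq_zero (hR : 0 < R) (hh : ∀ t, 2 ≤ |t| → h t = 0) :
    (logCutoff h R : Euc n → ℝ) =ᶠ[𝓝 0] 0 := by
  filter_upwards [Metric.ball_mem_nhds (0 : Euc n) (Real.exp_pos (-(2 * R)))] with x hx
  exact logCutoff_eq_zero hR hh (Or.inl (by simpa using (mem_ball_zero_iff.1 hx).le))

lemma hasCompactSupport_logCutoff (hR : 0 < R) (hh : ∀ t, 2 ≤ |t| → h t = 0) :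
    HasCompactSupport (logCutoff h R : Euc n → ℝ) := by
  refine HasCompactSupport.intro (isCompact_closedBall (0 : Euc n) (Real.exp (2 * R)))
    fun x hx => logCutoff_eq_zero hR hh (Or.inr ?_)
  simpa using (not_le.1 (mt mem_closedBall_zero_iff.2 hx)).le

lemma zero_notMem_tsupport_logCutoff (hR : 0 < R) (hh : ∀ t, 2 ≤ |t| → h t = 0) :
    (0 : Euc n) ∉ tsupport (logCutoff h R : Euc n → ℝ) :=
  notMem_tsupport_iff_eventuallyEq.2 (logCutoff_eventuallyEq_zero hR hh)

lemma contDiff_logCutoff_mul {m : WithTop ℕ∞} (hR : 0 < R) (hh : ∀ t, 2 ≤ |t| → h t = 0)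
    (hs : ContDiff ℝ m h) {f : Euc n → ℝ} (hf : ContDiffOn ℝ m f {0}ᶜ) :
    ContDiff ℝ m fun x => logCutoff h R x * f x := by
  refine contDiff_iff_contDiffAt.2 fun x => ?_
  by_cases hx : x = 0
  · subst hx
    have h1 : (fun x : Euc n => logCutoff h R x * f x) =ᶠ[𝓝 0] fun _ => 0 := by
      filter_upwards [logCutoff_eventuallyEq_zero (n := n) hR hh] with y hy
      rw [hy]
      simp
    exact contDiffAt_const.congr_of_eventuallyEq h1
  · have h1 : (fun y : Euc n => logCutoff h R y) =ᶠ[𝓝 x] fun y => h (Real.log ‖y‖ / R) := by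
      filter_upwards [isOpen_compl_singleton.mem_nhds hx] with y hy
      exact logCutoff_of_ne hy
    have h2 : ContDiffAt ℝ m (fun y : Euc n => h (Real.log ‖y‖ / R)) x :=
      hs.contDiffAt.comp x (((contDiffAt_norm ℝ hx).log (norm_ne_zero_iff.2 hx)).div_const R)
    exact (h2.congr_of_eventuallyEq h1).mul
      (hf.contDiffAt (isOpen_compl_singleton.mem_nhds hx))

lemma continuous_logCutoff_mul (hR : 0 < R) (hh : ∀ t, 2 ≤ |t| → h t = 0)
    (hs : Continuous h) {f : Euc n → ℝ} (hf : ContinuousOn f {0}ᶜ) :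
    Continuous fun x => logCutoff h R x * f x :=
  (contDiff_logCutoff_mul hR hh (contDiff_zero.2 hs) (contDiffOn_zero.2 hf)).continuous

lemma contDiff_logCutoff {m : WithTop ℕ∞} (hR : 0 < R) (hh : ∀ t, 2 ≤ |t| → h t = 0)
    (hs : ContDiff ℝ m h) : ContDiff ℝ m (logCutoff h R : Euc n → ℝ) := by
  simpa using contDiff_logCutoff_mul (n := n) (f := fun _ => 1) hR hh hs contDiffOn_const

lemma hasFDerivAt_logCutoff (hR : 0 < R) (hh : ∀ t, 2 ≤ |t| → h t = 0) (hs : Differentiable ℝ h)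
    (x : Euc n) : HasFDerivAt (logCutoff h R : Euc n → ℝ)
      ((logCutoff (deriv h) R x * (R⁻¹ * ‖x‖⁻¹ ^ 2)) • innerSL ℝ x) x := by
  by_cases hx : x = 0
  · subst hx
    simpa using (hasFDerivAt_const (0 : ℝ) (0 : Euc n)).congr_of_eventuallyEq
      (logCutoff_eventuallyEq_zero hR hh)
  · have hr : ‖x‖ ≠ 0 := norm_ne_zero_iff.2 hx
    have h1 : (fun y : Euc n => logCutoff h R y) =ᶠ[𝓝 x] fun y => h (Real.log ‖y‖ / R) := by
      filter_upwards [isOpen_compl_singleton.mem_nhds hx] with y hy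
      exact logCutoff_of_ne hy
    have h2 : HasDerivAt (fun r => h (Real.log r / R)) (deriv h (Real.log ‖x‖ / R) * (‖x‖⁻¹ / R))
        ‖x‖ := (hs _).hasDerivAt.comp ‖x‖ ((Real.hasDerivAt_log hr).div_const R)
    have h3 := h2.comp_hasFDerivAt x (hasFDerivAt_norm hx)
    refine (h3.congr_of_eventuallyEq h1).congr_fderiv ?_
    rw [logCutoff_of_ne hx, smul_smul]
    congr 1
    ring

/-- Passes the vanishing condition from `h` to `h'` and then to `h''`, so that the cutoff lemmas
apply to all three. -/
lemma deriv_eq_zero_of_two_le (hs : ContDiff ℝ 1 h) (hh : ∀ t, 2 ≤ |t| → h t = 0) (t : ℝ)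
    (ht : 2 ≤ |t|) : deriv h t = 0 := by
  have hc : Set.EqOn (deriv h) 0 {t | 2 < |t|} := fun s hs' => by
    have h1 : h =ᶠ[𝓝 s] fun _ => 0 := by
      filter_upwards [(isOpen_lt continuous_const continuous_abs).mem_nhds hs'] with y hy
      exact hh y (le_of_lt hy)
    rw [h1.deriv_eq]
    simp
  -- The endpoints `|t| = 2` are limits of points outside, which suffices because `h'` is
  -- continuous.
  have hcl : t ∈ closure {t : ℝ | 2 < |t|} := by
    refine mem_closure_of_tendsto (f := fun k : ℕ => (1 + 1 / ((k : ℝ) + 1)) * t) (b := atTop) ?_ ?_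
    · simpa using (tendsto_one_div_add_atTop_nhds_zero_nat (𝕜 := ℝ)).const_add 1 |>.mul_const t
    · refine Eventually.of_forall fun k => ?_
      have hk : (0 : ℝ) < 1 / ((k : ℝ) + 1) := by positivity
      rw [Set.mem_ofPred_eq, abs_mul, abs_of_pos (by positivity)]
      nlinarith
  exact (hc.closure (hs.continuous_deriv le_rfl) continuous_const) hcl

lemma laplacian_smul_fun {F : Type*} [NormedAddCommGroup F] [NormedSpace ℝ F] {f : Euc n → ℝ}
    {g : Euc n → F} (hf : ContDiff ℝ 2 f) (hg : ContDiff ℝ 2 g) (x : Euc n) :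
    (Δ fun y => f y • g y) x = f x • (Δ g) x + (2 : ℝ) • (∑ i,
      fderiv ℝ f x (EuclideanSpace.single i 1) • fderiv ℝ g x (EuclideanSpace.single i 1))
      + (Δ f) x • g x := by
  have h1 : ∀ {k : Euc n → ℝ} {l : Euc n → F}, ContDiff ℝ 1 k → ContDiff ℝ 1 l → ∀ y v,
      fderiv ℝ (fun y => k y • l y) y v = k y • fderiv ℝ l y v + fderiv ℝ k y v • l y :=
    fun {k l} hk hl y v => by
      rw [fderiv_fun_smul (hk.differentiable one_ne_zero y) (hl.differentiable one_ne_zero y)]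
      simp
  have hf1 : ContDiff ℝ 1 f := hf.of_le (by norm_num)
  have hg1 : ContDiff ℝ 1 g := hg.of_le (by norm_num)
  rw [laplacian_eq_sum_fderiv (f := fun y => f y • g y) (hf.smul hg), laplacian_eq_sum_fderiv hf, laplacian_eq_sum_fderiv hg,
    Finset.smul_sum, Finset.smul_sum, Finset.sum_smul, ← Finset.sum_add_distrib,
    ← Finset.sum_add_distrib]
  refine Finset.sum_congr rfl fun i _ => ?_
  simp_rw [h1 hf1 hg1]
  have d1 : DifferentiableAt ℝ (fun y => f y • fderiv ℝ g y (EuclideanSpace.single i 1)) x :=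
    (hf1.smul (contDiff_fderiv_dir hg _)).differentiable one_ne_zero x
  have d2 : DifferentiableAt ℝ (fun y => fderiv ℝ f y (EuclideanSpace.single i 1) • g y) x :=
    ((contDiff_fderiv_dir hf _).smul hg1).differentiable one_ne_zero x
  rw [fderiv_fun_add d1 d2, add_apply,
    h1 hf1 (contDiff_fderiv_dir hg _), h1 (contDiff_fderiv_dir hf _) hg1]
  module

lemma laplacian_logCutoff (hR : 0 < R) (hh : ∀ t, 2 ≤ |t| → h t = 0) (hs : ContDiff ℝ ∞ h)
    {x : Euc n} (hx : x ≠ 0) : (Δ (logCutoff h R : Euc n → ℝ)) x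
      = logCutoff (deriv (deriv h)) R x * (R⁻¹ ^ 2 * ‖x‖⁻¹ ^ 2)
        + ((n : ℝ) - 2) * (logCutoff (deriv h) R x * (R⁻¹ * ‖x‖⁻¹ ^ 2)) := by
  have hr : ‖x‖ ≠ 0 := norm_ne_zero_iff.2 hx
  have hs1 : ContDiff ℝ 1 h := hs.of_le (WithTop.coe_le_coe.2 (le_top : (1 : ℕ∞) ≤ ⊤))
  have hs' : ContDiff ℝ ∞ (deriv h) := (contDiff_infty_iff_deriv.1 hs).2
  have hh' := deriv_eq_zero_of_two_le hs1 hh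
  have hs1' : ContDiff ℝ 1 (deriv h) := hs'.of_le (WithTop.coe_le_coe.2 (le_top : (1 : ℕ∞) ≤ ⊤))
  -- The gradient of the cutoff is `s(x) x`, so its Laplacian is `n s + x · ∇s`.
  set s : Euc n → ℝ := fun y => logCutoff (deriv h) R y * (R⁻¹ * ‖y‖⁻¹ ^ 2) with hsdef
  have hsc : ContDiff ℝ 1 s := contDiff_logCutoff_mul hR hh' hs1' fun y hy =>
    (contDiffAt_const.mul (((contDiffAt_norm ℝ hy).inv
      (norm_ne_zero_iff.2 hy)).pow 2)).contDiffWithinAt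
  have e1 : ∀ i y, fderiv ℝ (logCutoff h R : Euc n → ℝ) y (EuclideanSpace.single i 1)
      = y i * s y := fun i y => by
    rw [(hasFDerivAt_logCutoff hR hh (hs1.differentiable one_ne_zero) y).fderiv]
    simp [hsdef, EuclideanSpace.inner_single_right]
    ring
  have e2 : HasFDerivAt s _ x :=
    (hasFDerivAt_logCutoff hR hh' (hs1'.differentiable one_ne_zero) x).mul
      (((hasFDerivAt_norm_inv hx).pow 2).const_mul R⁻¹)
  rw [laplacian_eq_sum_fderiv ((contDiff_logCutoff hR hh hs).of_le
    (WithTop.coe_le_coe.2 (le_top : (2 : ℕ∞) ≤ ⊤)))]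
  simp_rw [e1, fderiv_coord_mul hsc]
  rw [Finset.sum_add_distrib]
  have e3 : ∑ i, x i * fderiv ℝ s x (EuclideanSpace.single i 1) = fderiv ℝ s x x := by
    rw [clm_apply_eq_sum (fderiv ℝ s x) x]
    simp
  rw [e3, e2.fderiv]
  simp [hsdef]
  field_simp
  ring

/-- `Δ(χφ) = χΔφ + a(∂_r φ + λφ/r) + cφ` for a logarithmic cutoff `χ`. -/
lemma laplacian_logCutoff_smul (hR : 0 < R) (hh : ∀ t, 2 ≤ |t| → h t = 0) (hs : ContDiff ℝ ∞ h)
    {φ : Euc n → ℂ} (hφ : ContDiff ℝ 2 φ) {x : Euc n} (hx : x ≠ 0) :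
    (Δ fun y => logCutoff h R y • φ y) x = logCutoff h R x • (Δ φ) x
      + (logCutoff (deriv h) R x * (2 * R⁻¹ * ‖x‖⁻¹)) • modDeriv 0 φ x
      + (logCutoff (deriv (deriv h)) R x * (R⁻¹ ^ 2 * ‖x‖⁻¹ ^ 2)) • φ x := by
  have hr : (‖x‖ : ℂ) ≠ 0 := by exact_mod_cast norm_ne_zero_iff.2 hx
  have hR' : (R : ℂ) ≠ 0 := by exact_mod_cast hR.ne'
  have hs1 : ContDiff ℝ 1 h := hs.of_le (WithTop.coe_le_coe.2 (le_top : (1 : ℕ∞) ≤ ⊤))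
  rw [laplacian_smul_fun ((contDiff_logCutoff hR hh hs).of_le
    (WithTop.coe_le_coe.2 (le_top : (2 : ℕ∞) ≤ ⊤))) hφ, laplacian_logCutoff hR hh hs hx,
    (hasFDerivAt_logCutoff hR hh (hs1.differentiable one_ne_zero) x).fderiv]
  have e : ∑ i, ((logCutoff (deriv h) R x * (R⁻¹ * ‖x‖⁻¹ ^ 2)) • innerSL ℝ x)
      (EuclideanSpace.single i 1) • fderiv ℝ φ x (EuclideanSpace.single i 1)
      = (logCutoff (deriv h) R x * (R⁻¹ * ‖x‖⁻¹ ^ 2)) • fderiv ℝ φ x x := by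
    rw [clm_apply_eq_sum (fderiv ℝ φ x) x, Finset.smul_sum]
    refine Finset.sum_congr rfl fun i _ => ?_
    rw [smul_smul]
    congr 1
    simp [EuclideanSpace.inner_single_right]
  rw [e]
  -- The term `(n - 2) h' / (R r²)` of the Laplacian of the cutoff equals `λ/r` times `2h' / (R r)`.
  -- It is absorbed into `modDeriv 0`, and only `h''` remains as a coefficient of `φ`.
  simp only [modDeriv, lam, Complex.real_smul]
  push_cast
  field_simp
  ring

end Cutoff


/-! ### The weighted estimate for weak solutions -/

section WeakEstimate

variable {n : ℕ}

open scoped ContDiff Laplacian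

lemma eLpNorm_two_sq {f : Euc n → ℂ} (hf : MemLp f 2 volume) :
    eLpNorm f 2 volume ^ 2 = ENNReal.ofReal (∫ x, ‖f x‖ ^ 2) := by
  rw [hf.eLpNorm_eq_integral_rpow_norm two_ne_zero ENNReal.ofNat_ne_top,
    ← ENNReal.ofReal_pow (by positivity), ← Real.rpow_natCast, ← Real.rpow_mul
      (integral_nonneg fun x => by positivity)]
  simp

lemma norm_toLp_sq {f : Euc n → ℂ} (hf : MemLp f 2 volume) :
    ‖hf.toLp f‖ ^ 2 = ∫ x, ‖f x‖ ^ 2 := by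
  rw [Lp.norm_toLp, ← ENNReal.toReal_pow, eLpNorm_two_sq hf,
    ENNReal.toReal_ofReal (integral_nonneg fun x => by positivity)]

lemma memLp_of_testFun {F : Type*} [NormedAddCommGroup F] {f : Euc n → F} (φ : TestFun n)
    (hf : ContinuousOn f {0}ᶜ) (h0 : ∀ x, φ =ᶠ[𝓝 x] 0 → f x = 0) : MemLp f 2 volume :=
  (continuous_of_continuousOn_compl_zero φ hf h0).memLp_of_hasCompactSupport
    (hasCompactSupport_of_testFun φ h0)

lemma memLp_norm_inv_smul (φ : TestFun n) : MemLp (fun x => ‖x‖⁻¹ • φ x) 2 volume :=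
  memLp_of_testFun φ (continuousOn_norm_inv.smul φ.continuous.continuousOn)
    fun x hx => by simp [hx.self_of_nhds]

lemma memLp_modDeriv (k : ℂ) (φ : TestFun n) : MemLp (modDeriv k φ) 2 volume :=
  memLp_of_testFun φ (continuousOn_modDeriv k φ.contDiff_two)
    fun x hx => by simp [modDeriv, φ.fderiv_eq_zero hx, hx.self_of_nhds]

lemma memLp_norm_smul_schrodingerExpr_sub {V : Euc n → ℝ} (hV : ContinuousOn V {0}ᶜ) (μ : ℂ)
    (φ : TestFun n) : MemLp (fun x => ‖x‖ • (schrodingerExpr V φ x - μ * φ x)) 2 volume :=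
  memLp_of_testFun φ (continuous_norm.smul ((continuous_schrodingerExpr φ hV).sub
    (continuous_const.mul φ.continuous))).continuousOn
    fun x hx => by simp [hx.self_of_nhds, schrodingerExpr_eq_zero φ V hx]

lemma eLpNorm_norm_inv_smul_le (hn : n ≠ 0) {V : Euc n → ℝ} (hV : ContDiffOn ℝ 1 V {0}ᶜ) {δ : ℝ}
    (hδ : 0 < δ) (hA2 : PositiveOnSpheres V δ) (hA3 : PositiveOnSpheres (tildeV V) δ) {k : ℂ}
    (hk : 0 < k.im) (φ : TestFun n) :
    eLpNorm (fun x => ‖x‖⁻¹ • φ x) 2 volume ≤ ENNReal.ofReal (max (1 / δ ^ 2) (√2 / δ))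
      * eLpNorm (fun x => ‖x‖ • (schrodingerExpr V φ x - k ^ 2 * φ x)) 2 volume := by
  have hC : 0 ≤ max (1 / δ ^ 2) (√2 / δ) := le_max_of_le_left (by positivity)
  rw [← ENNReal.pow_le_pow_left_iff two_ne_zero, mul_pow,
    eLpNorm_two_sq (memLp_norm_inv_smul φ),
    eLpNorm_two_sq (memLp_norm_smul_schrodingerExpr_sub hV.continuousOn _ φ),
    ← ENNReal.ofReal_pow hC, ← ENNReal.ofReal_mul (by positivity)]
  refine ENNReal.ofReal_le_ofReal ?_
  simpa only [norm_smul, norm_inv, norm_norm, mul_pow] using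
    integral_normSq_le φ hn hV hδ hA2 hA3 hk

/-- The a priori estimate for `L²` functions supported in an annulus, with distributional
Laplacian in `L²`. -/
lemma eLpNorm_norm_inv_smul_le_of_weak (hn : n ≠ 0) {V : Euc n → ℝ}
    (hV : ContDiffOn ℝ 1 V {0}ᶜ) {δ : ℝ} (hδ : 0 < δ) (hA2 : PositiveOnSpheres V δ)
    (hA3 : PositiveOnSpheres (tildeV V) δ) {k : ℂ} (hk : 0 < k.im) {w F : Euc n → ℂ}
    (hwm : Measurable w) (hw : MemLp w 2 volume) (hFm : Measurable F) (hF : MemLp F 2 volume)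
    {r₀ r₁ : ℝ} (hr₀ : 0 < r₀) (hw0 : ∀ x, ‖x‖ < r₀ ∨ r₁ < ‖x‖ → w x = 0)
    (hF0 : ∀ x, ‖x‖ < r₀ ∨ r₁ < ‖x‖ → F x = 0)
    (h : ∀ ψ : Euc n → ℝ, ContDiff ℝ ∞ ψ → HasCompactSupport ψ →
      ∫ x, (Δ ψ) x • w x = ∫ x, ψ x • F x) :
    eLpNorm (fun x => ‖x‖⁻¹ • w x) 2 volume ≤ ENNReal.ofReal (max (1 / δ ^ 2) (√2 / δ))
      * eLpNorm (fun x => ‖x‖ • (-F x + (V x : ℂ) * w x - k ^ 2 * w x)) 2 volume := by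
  set C := ENNReal.ofReal (max (1 / δ ^ 2) (√2 / δ))
  have hwl : LocallyIntegrable w := hw.locallyIntegrable (by norm_num)
  have hFl : LocallyIntegrable F := hF.locallyIntegrable (by norm_num)
  have hVm : Measurable V := measurable_of_continuousOn_compl_singleton 0 hV.continuousOn
  -- mollifiers of radius less than `r₀ / 2`
  have hρpos : ∀ m : ℕ, 0 < r₀ / 2 / ((m : ℝ) + 1) := fun m => by positivity
  set ρ : ℕ → ContDiffBump (0 : Euc n) := fun m =>
    ⟨r₀ / 2 / ((m : ℝ) + 1) / 2, r₀ / 2 / ((m : ℝ) + 1), half_pos (hρpos m), half_lt_self (hρpos m)⟩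
  have hρ : Tendsto (fun m => (ρ m).rOut) atTop (𝓝 0) := by
    simpa [ρ, div_eq_mul_inv] using
      (tendsto_one_div_add_atTop_nhds_zero_nat (𝕜 := ℝ)).const_mul (r₀ / 2)
  have hρle : ∀ m, (ρ m).rOut ≤ r₀ / 2 := fun m =>
    div_le_self (by positivity) (by linarith [(Nat.cast_nonneg m : (0 : ℝ) ≤ m)])
  have hz : ∀ {f : Euc n → ℂ}, (∀ x, ‖x‖ < r₀ ∨ r₁ < ‖x‖ → f x = 0) → ∀ m x,
      ‖x‖ < r₀ / 2 ∨ r₁ + r₀ / 2 < ‖x‖ → mollify (ρ m) f x = 0 := fun {f} hf m x hx => by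
    refine mollify_eq_zero _ fun y hy => hf y ?_
    have h1 := hy.trans_le (hρle m)
    have h2 := norm_sub_norm_le x y
    have h3 := norm_sub_norm_le y x
    rw [norm_sub_rev] at h3
    rcases hx with hx | hx
    · left; linarith
    · right; linarith
  have hcs : ∀ m, HasCompactSupport (mollify (ρ m) w) := fun m =>
    HasCompactSupport.intro (isCompact_closedBall (0 : Euc n) (r₁ + r₀ / 2)) fun x hx =>
      hz hw0 m x (Or.inr (not_le.1 (mt mem_closedBall_zero_iff.2 hx)))
  have h0s : ∀ m, (0 : Euc n) ∉ tsupport (mollify (ρ m) w) := fun m => by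
    refine notMem_tsupport_iff_eventuallyEq.2 ?_
    filter_upwards [Metric.ball_mem_nhds (0 : Euc n) (half_pos hr₀)] with x hx
    exact hz hw0 m x (Or.inl (mem_ball_zero_iff.1 hx))
  set φ : ℕ → TestFun n := fun m => ⟨mollify (ρ m) w, contDiff_mollify (ρ m) hwl, hcs m,
    fun x hx hx0 => h0s m (hx0 ▸ hx)⟩
  have hφ : ∀ m x, φ m x = mollify (ρ m) w x := fun _ _ => rfl
  have hlap : ∀ m x, (Δ (φ m : Euc n → ℂ)) x = mollify (ρ m) F x := fun m x =>
    laplacian_mollify (ρ m) hwl h x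
  -- bounds on a compact annulus
  obtain ⟨M, hM0, hM⟩ : ∃ M : ℝ, 0 ≤ M ∧ ∀ x : Euc n, r₀ / 2 ≤ ‖x‖ → ‖x‖ ≤ r₁ + r₀ / 2 →
      ‖x‖ ≤ M ∧ ‖x‖ * ‖(V x : ℂ) - k ^ 2‖ ≤ M := by
    have hK : IsCompact {x : Euc n | r₀ / 2 ≤ ‖x‖ ∧ ‖x‖ ≤ r₁ + r₀ / 2} := by
      refine (isCompact_closedBall (0 : Euc n) (r₁ + r₀ / 2)).of_isClosed_subset
        ((isClosed_le continuous_const continuous_norm).inter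
          (isClosed_le continuous_norm continuous_const)) fun x hx => ?_
      simpa using hx.2
    have hc : ContinuousOn (fun x : Euc n => ‖x‖ * ‖(V x : ℂ) - k ^ 2‖)
        {x : Euc n | r₀ / 2 ≤ ‖x‖ ∧ ‖x‖ ≤ r₁ + r₀ / 2} := by
      refine ContinuousOn.mono (s := {0}ᶜ) (continuous_norm.continuousOn.mul
        ((Complex.continuous_ofReal.comp_continuousOn hV.continuousOn).sub
          continuousOn_const).norm) fun x hx hx0 => ?_
      rw [Set.mem_singleton_iff.1 hx0, Set.mem_ofPred_eq, norm_zero] at hx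
      linarith [hx.1]
    obtain ⟨M, hM⟩ := hK.bddAbove_image hc
    refine ⟨max 0 (max (r₁ + r₀ / 2) M), le_max_left _ _, fun x h1 h2 => ⟨?_, ?_⟩⟩
    · exact h2.trans ((le_max_left _ _).trans (le_max_right _ _))
    · exact (hM ⟨x, ⟨h1, h2⟩, rfl⟩).trans ((le_max_right _ _).trans (le_max_right _ _))
  set N : ℕ → ENNReal := fun m => eLpNorm (mollify (ρ m) w - w) 2 volume with hN
  set N' : ℕ → ENNReal := fun m => eLpNorm (mollify (ρ m) F - F) 2 volume with hN'
  have hNt : Tendsto N atTop (𝓝 0) := tendsto_eLpNorm_mollify_sub hρ hwm hw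
  have hNt' : Tendsto N' atTop (𝓝 0) := tendsto_eLpNorm_mollify_sub hρ hFm hF
  have sm : ∀ {f : Euc n → ℂ}, LocallyIntegrable f → ∀ m,
      AEStronglyMeasurable (mollify (ρ m) f) volume := fun hf m =>
    (contDiff_mollify _ hf).continuous.aestronglyMeasurable
  have swm := hwm.aestronglyMeasurable (μ := volume)
  have sFm := hFm.aestronglyMeasurable (μ := volume)
  have sinv : AEStronglyMeasurable (fun x : Euc n => ‖x‖⁻¹) volume :=
    measurable_norm.inv.aestronglyMeasurable
  have snorm : AEStronglyMeasurable (fun x : Euc n => ‖x‖) volume :=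
    measurable_norm.aestronglyMeasurable
  have sV : AEStronglyMeasurable (fun x : Euc n => (V x : ℂ)) volume :=
    (Complex.measurable_ofReal.comp hVm).aestronglyMeasurable
  have hzw : ∀ {f : Euc n → ℂ}, (∀ x, ‖x‖ < r₀ ∨ r₁ < ‖x‖ → f x = 0) → ∀ m x,
      ‖x‖ < r₀ / 2 ∨ r₁ + r₀ / 2 < ‖x‖ → (mollify (ρ m) f - f) x = 0 := fun {f} hf m x hx => by
    rw [Pi.sub_apply, hz hf m x hx, hf x (hx.imp (fun h => by linarith) fun h => by linarith),
      sub_zero]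
  -- left-hand side
  have hL : ∀ m, eLpNorm (fun x => ‖x‖⁻¹ • w x) 2 volume
      ≤ eLpNorm (fun x => ‖x‖⁻¹ • φ m x) 2 volume + ENNReal.ofReal (2 / r₀) * N m := fun m => by
    have e : (fun x => ‖x‖⁻¹ • w x)
        = (fun x => ‖x‖⁻¹ • φ m x) - fun x => ‖x‖⁻¹ • (mollify (ρ m) w - w) x := by
      ext x
      simp only [Pi.sub_apply, hφ, smul_sub]
      abel
    have s1 : AEStronglyMeasurable (fun x => ‖x‖⁻¹ • φ m x) volume := sinv.smul (sm hwl m)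
    have s2 : AEStronglyMeasurable (fun x => ‖x‖⁻¹ • (mollify (ρ m) w - w) x) volume :=
      sinv.smul ((sm hwl m).sub swm)
    rw [e]
    refine (eLpNorm_sub_le s1 s2 (by norm_num)).trans ?_
    gcongr
    refine eLpNorm_le_mul_eLpNorm_of_ae_le_mul (Eventually.of_forall fun x => ?_) 2
    -- Outside the annulus enlarged by `r₀ / 2` both functions vanish; inside it `‖x‖⁻¹ ≤ 2 / r₀`.
    by_cases hx : ‖x‖ < r₀ / 2 ∨ r₁ + r₀ / 2 < ‖x‖
    · rw [hzw hw0 m x hx]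
      simp
    · push Not at hx
      rw [norm_smul, norm_inv, norm_norm]
      gcongr
      rw [inv_le_comm₀ (by linarith) (by positivity), inv_div]
      exact hx.1
  -- right-hand side
  have hRt : ∀ m, eLpNorm (fun x => ‖x‖ • (schrodingerExpr V (φ m) x - k ^ 2 * φ m x)) 2 volume
      ≤ eLpNorm (fun x => ‖x‖ • (-F x + (V x : ℂ) * w x - k ^ 2 * w x)) 2 volume
        + (ENNReal.ofReal M * N m + ENNReal.ofReal M * N' m) := fun m => by
    have e : (fun x => ‖x‖ • (schrodingerExpr V (φ m) x - k ^ 2 * φ m x))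
        = (fun x => ‖x‖ • (-F x + (V x : ℂ) * w x - k ^ 2 * w x))
          + ((fun x => (‖x‖ : ℂ) * ((V x : ℂ) - k ^ 2) * (mollify (ρ m) w - w) x)
            - fun x => ‖x‖ • (mollify (ρ m) F - F) x) := by
      ext x
      simp only [schrodingerExpr, hlap, hφ, Pi.add_apply, Pi.sub_apply, Complex.real_smul]
      ring
    have sk : AEStronglyMeasurable (fun _ : Euc n => k ^ 2) volume := aestronglyMeasurable_const
    have s1 : AEStronglyMeasurable (fun x => ‖x‖ • (-F x + (V x : ℂ) * w x - k ^ 2 * w x))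
        volume := snorm.smul ((sFm.neg.add (sV.mul swm)).sub (sk.mul swm))
    have s2 : AEStronglyMeasurable
        (fun x => (‖x‖ : ℂ) * ((V x : ℂ) - k ^ 2) * (mollify (ρ m) w - w) x) volume :=
      (((Complex.measurable_ofReal.comp measurable_norm).aestronglyMeasurable).mul
        (sV.sub sk)).mul ((sm hwl m).sub swm)
    have s3 : AEStronglyMeasurable (fun x => ‖x‖ • (mollify (ρ m) F - F) x) volume :=
      snorm.smul ((sm hFl m).sub sFm)
    rw [e]
    refine (eLpNorm_add_le s1 (s2.sub s3) (by norm_num)).trans ?_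
    gcongr
    refine (eLpNorm_sub_le s2 s3 (by norm_num)).trans ?_
    gcongr
    · refine eLpNorm_le_mul_eLpNorm_of_ae_le_mul (Eventually.of_forall fun x => ?_) 2
      by_cases hx : ‖x‖ < r₀ / 2 ∨ r₁ + r₀ / 2 < ‖x‖
      · rw [hzw hw0 m x hx]
        simp
      · push Not at hx
        rw [norm_mul, norm_mul, Complex.norm_real, norm_norm]
        gcongr
        exact (hM x hx.1 hx.2).2
    · refine eLpNorm_le_mul_eLpNorm_of_ae_le_mul (Eventually.of_forall fun x => ?_) 2
      by_cases hx : ‖x‖ < r₀ / 2 ∨ r₁ + r₀ / 2 < ‖x‖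
      · rw [hzw hF0 m x hx]
        simp
      · push Not at hx
        rw [norm_smul, norm_norm]
        gcongr
        exact (hM x hx.1 hx.2).1
  -- limit
  have hlim : Tendsto (fun m => C * (eLpNorm (fun x => ‖x‖ • (-F x + (V x : ℂ) * w x - k ^ 2 * w x))
      2 volume + (ENNReal.ofReal M * N m + ENNReal.ofReal M * N' m))
      + ENNReal.ofReal (2 / r₀) * N m) atTop (𝓝 (C * (eLpNorm (fun x =>
        ‖x‖ • (-F x + (V x : ℂ) * w x - k ^ 2 * w x)) 2 volume + (ENNReal.ofReal M * 0
        + ENNReal.ofReal M * 0)) + ENNReal.ofReal (2 / r₀) * 0)) := by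
    have hm : ∀ (c : ℝ) {a : ℕ → ENNReal}, Tendsto a atTop (𝓝 0) →
        Tendsto (fun m => ENNReal.ofReal c * a m) atTop (𝓝 (ENNReal.ofReal c * 0)) :=
      fun c a ha => ENNReal.Tendsto.const_mul ha (Or.inr ENNReal.ofReal_ne_top)
    exact (ENNReal.Tendsto.const_mul (tendsto_const_nhds.add ((hm M hNt).add (hm M hNt')))
      (Or.inr ENNReal.ofReal_ne_top)).add (hm _ hNt)
  simp only [mul_zero, add_zero] at hlim
  refine ge_of_tendsto' hlim fun m => (hL m).trans ?_
  gcongr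
  exact (eLpNorm_norm_inv_smul_le hn hV hδ hA2 hA3 hk (φ m)).trans (by gcongr; exact hRt m)

end WeakEstimate


/-! ### The weak equation for elements of the domain of the Friedrichs extension -/

section WeakEquation

variable {n : ℕ}

open scoped ContDiff Laplacian ComplexConjugate

lemma integral_smul_eq_inner {g : Euc n → ℝ} (hg : Continuous g) (hc : HasCompactSupport g)
    (f : L2 n) : ∫ x, g x • f x = inner ℂ
      (((Complex.continuous_ofReal.comp hg).memLp_of_hasCompactSupport (p := 2) (μ := volume)
        (hc.comp_left (g := Complex.ofReal) Complex.ofReal_zero)).toLp _) f := by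
  rw [inner_toLp_left]
  simp

/-- Pairing with a continuous compactly supported function is continuous on `L²`. -/
lemma tendsto_integral_smul {g : Euc n → ℝ} (hg : Continuous g) (hc : HasCompactSupport g)
    {f : ℕ → L2 n} {f₀ : L2 n} (hf : Tendsto f atTop (𝓝 f₀)) :
    Tendsto (fun j => ∫ x, g x • f j x) atTop (𝓝 (∫ x, g x • f₀ x)) := by
  simp_rw [integral_smul_eq_inner hg hc]
  exact tendsto_const_nhds.inner hf

lemma tendsto_integral_smul_of_toLp {g : Euc n → ℝ} (hg : Continuous g) (hc : HasCompactSupport g)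
    {f : ℕ → Euc n → ℂ} (hf2 : ∀ j, MemLp (f j) 2 volume) {f₀ : L2 n}
    (hf : Tendsto (fun j => (hf2 j).toLp (f j)) atTop (𝓝 f₀)) :
    Tendsto (fun j => ∫ x, g x • f j x) atTop (𝓝 (∫ x, g x • f₀ x)) := by
  refine (tendsto_integral_smul hg hc hf).congr fun j => integral_congr_ae ?_
  filter_upwards [(hf2 j).coeFn_toLp] with x hx
  rw [hx]

lemma integrable_smul_L2 {g : Euc n → ℝ} (hg : Continuous g) (hc : HasCompactSupport g)
    (f : L2 n) : Integrable fun x => g x • f x :=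
  ((Lp.memLp f).locallyIntegrable (by norm_num)).integrable_smul_left_of_hasCompactSupport hg hc

lemma continuous_laplacian {F : Type*} [NormedAddCommGroup F] [NormedSpace ℝ F] {f : Euc n → F}
    (hf : ContDiff ℝ 2 f) : Continuous (Δ f) := by
  rw [show Δ f = fun x => _ from funext (laplacian_eq_sum_fderiv hf)]
  exact continuous_finsetSum _ fun i _ => continuous_fderiv_fderiv hf _ _

lemma hasCompactSupport_laplacian {F : Type*} [NormedAddCommGroup F] [NormedSpace ℝ F]
    {f : Euc n → F} (hc : HasCompactSupport f) : HasCompactSupport (Δ f) := by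
  refine HasCompactSupport.intro hc fun x hx => ?_
  have h1 := (InnerProductSpace.laplacian_congr_nhds
    (notMem_tsupport_iff_eventuallyEq.1 hx)).self_of_nhds
  rw [h1]
  simp [laplacian_eq_sum]

lemma laplacian_ofReal {f : Euc n → ℝ} (hf : ContDiff ℝ 2 f) (x : Euc n) :
    (Δ fun y => (f y : ℂ)) x = (((Δ f) x : ℝ) : ℂ) :=
  (hf.contDiffAt (x := x)).laplacian_CLM_comp_left (l := Complex.ofRealCLM)

lemma integral_smul_laplacian {f : Euc n → ℝ} {g : Euc n → ℂ} (hf : ContDiff ℝ 2 f)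
    (hg : ContDiff ℝ 2 g) (hc : HasCompactSupport f) :
    ∫ x, f x • (Δ g) x = ∫ x, (Δ f) x • g x := by
  have h := integral_mul_laplacian (f := fun x => (f x : ℂ)) (Complex.ofRealCLM.contDiff.comp hf)
    hg (hc.comp_left (g := Complex.ofReal) Complex.ofReal_zero)
  simp_rw [laplacian_ofReal hf] at h
  simpa only [Complex.real_smul] using h

/-- The equation `P u = -Δu + V u` tested against a real test function. -/
lemma integral_laplacian_smul_friedrichs (hn : n ≠ 0) {V : Euc n → ℝ} (hV : ContinuousOn V {0}ᶜ)
    (u : (friedrichsExtension (schrodingerOp V hV)).domain) {g : Euc n → ℝ} (hg : ContDiff ℝ ∞ g)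
    (hc : HasCompactSupport g) (h0 : (0 : Euc n) ∉ tsupport g)
    (hgV : Continuous fun x => g x * V x) :
    ∫ x, (Δ g) x • (u : L2 n) x = (∫ x, (g x * V x) • (u : L2 n) x)
      - ∫ x, g x • friedrichsExtension (schrodingerOp V hV) u x := by
  have hg2 : ContDiff ℝ 2 g := hg.of_le (WithTop.coe_le_coe.2 (le_top : (2 : ℕ∞) ≤ ⊤))
  set ψ := TestFun.ofReal g hg hc h0
  have hψ : ∀ x, ψ x = (g x : ℂ) := fun _ => rfl
  have h1 := inner_friedrichsExtension (A := schrodingerOp V hV) (dense_range_testToL2 hn) u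
    ⟨testToL2 n ψ, LinearMap.mem_range_self _ ψ⟩
  rw [schrodingerOp_apply] at h1
  have e1 : inner ℂ (testToL2 n ψ) (friedrichsExtension (schrodingerOp V hV) u)
      = ∫ x, g x • friedrichsExtension (schrodingerOp V hV) u x := by
    refine (inner_toLp_left ψ.memLp _).trans ?_
    simp [hψ]
  have e2 : inner ℂ (schrodingerTest V hV ψ) (u : L2 n)
      = (∫ x, (g x * V x) • (u : L2 n) x) - ∫ x, (Δ g) x • (u : L2 n) x := by
    refine (inner_toLp_left (schrodingerExpr_memLp hV ψ) _).trans ?_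
    rw [← integral_sub (integrable_smul_L2 hgV hc.mul_right _)
      (integrable_smul_L2 (continuous_laplacian hg2) (hasCompactSupport_laplacian hc) _)]
    congr 1
    ext x
    have e3 : (Δ (ψ : Euc n → ℂ)) x = (((Δ g) x : ℝ) : ℂ) := laplacian_ofReal hg2 x
    rw [schrodingerExpr, e3, hψ]
    simp
    ring
  have h2 := e1.symm.trans (h1.trans e2)
  rw [h2]
  ring

/-- The weak Laplacian of `χu`, for `u` in the domain of the Friedrichs extension and `χ` a
logarithmic cutoff. -/
lemma integral_laplacian_smul_logCutoff (hn : n ≠ 0) {V : Euc n → ℝ} (hV : ContinuousOn V {0}ᶜ)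
    (u : (friedrichsExtension (schrodingerOp V hV)).domain) {φ : ℕ → TestFun n}
    (hφ : Tendsto (fun j => testToL2 n (φ j)) atTop (𝓝 (u : L2 n))) {G : L2 n}
    (hG : Tendsto (fun j => (memLp_modDeriv 0 (φ j)).toLp (modDeriv 0 (φ j))) atTop (𝓝 G))
    {h : ℝ → ℝ} {R : ℝ} (hR : 0 < R) (hh : ∀ t, 2 ≤ |t| → h t = 0) (hs : ContDiff ℝ ∞ h)
    {ψ : Euc n → ℝ} (hψ : ContDiff ℝ ∞ ψ)
    (hψs : HasCompactSupport ψ) :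
    ∫ x, (Δ ψ) x • (logCutoff h R x • (u : L2 n) x) = ∫ x, ψ x •
      ((logCutoff h R x * V x) • (u : L2 n) x
        - logCutoff h R x • friedrichsExtension (schrodingerOp V hV) u x
        + (logCutoff (deriv h) R x * (2 * R⁻¹ * ‖x‖⁻¹)) • G x
        + (logCutoff (deriv (deriv h)) R x * (R⁻¹ ^ 2 * ‖x‖⁻¹ ^ 2)) • (u : L2 n) x) := by
  have le2 : (2 : WithTop ℕ∞) ≤ ∞ := WithTop.coe_le_coe.2 (le_top : (2 : ℕ∞) ≤ ⊤)
  have hψ2 : ContDiff ℝ 2 ψ := hψ.of_le le2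
  have hs' : ContDiff ℝ ∞ (deriv h) := (contDiff_infty_iff_deriv.1 hs).2
  have hs'' : ContDiff ℝ ∞ (deriv (deriv h)) := (contDiff_infty_iff_deriv.1 hs').2
  have hh' := deriv_eq_zero_of_two_le (hs.of_le (le_trans (by norm_num) le2)) hh
  have hh'' := deriv_eq_zero_of_two_le (hs'.of_le (le_trans (by norm_num) le2)) hh'
  set χ : Euc n → ℝ := logCutoff h R
  set a : Euc n → ℝ := fun x => logCutoff (deriv h) R x * (2 * R⁻¹ * ‖x‖⁻¹) with ha
  set c : Euc n → ℝ := fun x => logCutoff (deriv (deriv h)) R x * (R⁻¹ ^ 2 * ‖x‖⁻¹ ^ 2) with hc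
  have hχs : ContDiff ℝ ∞ χ := contDiff_logCutoff hR hh hs
  have hχc : HasCompactSupport χ := hasCompactSupport_logCutoff hR hh
  have hac : Continuous a := continuous_logCutoff_mul hR hh' hs'.continuous
    (continuousOn_const.mul continuousOn_norm_inv)
  have hcc : Continuous c := continuous_logCutoff_mul hR hh'' hs''.continuous
    (continuousOn_const.mul (continuousOn_norm_inv.pow 2))
  have has : HasCompactSupport a := (hasCompactSupport_logCutoff hR hh').mul_right
  have hcs : HasCompactSupport c := (hasCompactSupport_logCutoff hR hh'').mul_right
  have hψχ : ContDiff ℝ ∞ fun x => ψ x * χ x := hψ.mul hχs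
  have hψχc : HasCompactSupport fun x => ψ x * χ x := hχc.mul_left
  have hψχ2 := hψχ.of_le le2
  have hχV : Continuous fun x => χ x * V x := continuous_logCutoff_mul hR hh hs.continuous hV
  have hψχV : Continuous fun x => ψ x * χ x * V x := by
    simp only [mul_assoc]
    exact hψ.continuous.mul hχV
  -- The function `ψ` may be nonzero at the origin; it is the cutoff that makes the product an
  -- admissible test function.
  have hψχ0 : (0 : Euc n) ∉ tsupport fun x => ψ x * χ x := fun h0 =>
    zero_notMem_tsupport_logCutoff hR hh (closure_mono (Function.support_mul_subset_right ψ χ) h0)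
  have k1 : Continuous fun x => (Δ ψ) x * χ x := (continuous_laplacian hψ2).mul hχs.continuous
  have k1c : HasCompactSupport fun x => (Δ ψ) x * χ x := hχc.mul_left
  have k2 := continuous_laplacian hψχ2
  have k2c := hasCompactSupport_laplacian hψχc
  have k3 : Continuous fun x => ψ x * a x := hψ.continuous.mul hac
  have k3c : HasCompactSupport fun x => ψ x * a x := has.mul_left
  have k4 : Continuous fun x => ψ x * c x := hψ.continuous.mul hcc
  have k4c : HasCompactSupport fun x => ψ x * c x := hcs.mul_left
  have hadd : ∀ {f g k : Euc n → ℂ}, Integrable f → Integrable g → Integrable k →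
      (∫ x, f x) + (∫ x, g x) + ∫ x, k x = ∫ x, (f x + g x + k x) := fun {f g k} i1 i2 i3 => by
    rw [← integral_add i1 i2]
    exact (integral_add (i1.add i2) i3).symm
  -- For smooth `φ_j`, Green's formula moves `Δ` onto `χφ_j`, the product rule for the cutoff is
  -- applied, and Green's formula moves `Δ` back onto `ψχ`. Only `φ_j` and `modDeriv 0 φ_j` remain,
  -- and both converge in `L²`; no weak derivative of `u` is needed.
  have hj : ∀ j, ∫ x, ((Δ ψ) x * χ x) • φ j x = (∫ x, (Δ fun x => ψ x * χ x) x • φ j x)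
      + (∫ x, (ψ x * a x) • modDeriv 0 (φ j) x) + ∫ x, (ψ x * c x) • φ j x := fun j => by
    have hφ2 := (φ j).contDiff_two
    have hm : MemLp (modDeriv 0 (φ j)) 2 volume := memLp_modDeriv 0 (φ j)
    have i1 : Integrable fun x => (ψ x * χ x) • (Δ (φ j : Euc n → ℂ)) x :=
      (hψχ.continuous.smul (continuous_laplacian hφ2)).integrable_of_hasCompactSupport
        hψχc.smul_right
    have i2 : Integrable fun x => (ψ x * a x) • modDeriv 0 (φ j) x :=
      (hm.locallyIntegrable (by norm_num)).integrable_smul_left_of_hasCompactSupport k3 k3c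
    have i3 : Integrable fun x => (ψ x * c x) • φ j x :=
      (k4.smul (φ j).continuous).integrable_of_hasCompactSupport k4c.smul_right
    rw [← integral_smul_laplacian hψχ2 hφ2 hψχc, hadd i1 i2 i3]
    have hχφ : ContDiff ℝ 2 fun x => χ x • φ j x := (hχs.of_le le2).smul hφ2
    simp only [mul_smul]
    rw [← integral_smul_laplacian hψ2 hχφ hψs]
    refine integral_congr_ae ?_
    filter_upwards [ae_ne_zero hn] with x hx
    rw [laplacian_logCutoff_smul hR hh hs hφ2 hx]
    simp only [smul_add, mul_smul, ha, hc]
    rfl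
  have t1 := tendsto_integral_smul_of_toLp k1 k1c (fun j => (φ j).memLp) hφ
  have t2 := tendsto_integral_smul_of_toLp k2 k2c (fun j => (φ j).memLp) hφ
  have t3 := tendsto_integral_smul_of_toLp k3 k3c _ hG
  have t4 := tendsto_integral_smul_of_toLp k4 k4c (fun j => (φ j).memLp) hφ
  have key := tendsto_nhds_unique t1 (((t2.add t3).add t4).congr fun j => (hj j).symm)
  -- Only now does the equation for `u` enter, tested against `ψχ`.
  rw [integral_laplacian_smul_friedrichs hn hV u hψχ hψχc hψχ0 hψχV] at key
  have j1 := integrable_smul_L2 hψχV hψχc.mul_right (u : L2 n)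
  have j2 := integrable_smul_L2 hψχ.continuous hψχc (friedrichsExtension (schrodingerOp V hV) u)
  have j3 := integrable_smul_L2 k3 k3c G
  have j4 := integrable_smul_L2 k4 k4c (u : L2 n)
  rw [← integral_sub j1 j2] at key
  have key' := key.trans (hadd (j1.sub j2) j3 j4)
  simp only [mul_smul] at key'
  rw [key']
  congr 1
  ext x
  simp only [smul_add, smul_sub, mul_smul, ha, hc]

end WeakEquation


/-! ### The weighted resolvent estimate -/

section Resolvent

variable {n : ℕ}

open scoped ContDiff Laplacian

lemma opForm_schrodingerOp {V : Euc n → ℝ} (hV : ContinuousOn V {0}ᶜ)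
    {φ : (schrodingerOp V hV).domain} {ψ : TestFun n} (h : (φ : L2 n) = testToL2 n ψ) :
    opForm (schrodingerOp V hV) φ = (inner ℂ (testToL2 n ψ) (schrodingerTest V hV ψ)).re := by
  have h1 : φ = ⟨testToL2 n ψ, LinearMap.mem_range_self _ ψ⟩ := Subtype.ext h
  rw [h1, opForm, schrodingerOp_apply]

lemma cauchySeq_of_norm_sub_sq_le {E : Type*} [NormedAddCommGroup E] {a : ℕ → E}
    {q : ℕ × ℕ → ℝ} {c : ℝ} (hq : Tendsto q atTop (𝓝 0))
    (h : ∀ p : ℕ × ℕ, ‖a p.1 - a p.2‖ ^ 2 ≤ c * q p) : CauchySeq a := by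
  rw [cauchySeq_iff_tendsto_dist_atTop_0]
  have h1 : Tendsto (fun p => √(c * q p)) atTop (𝓝 0) := by
    simpa using (hq.const_mul c).sqrt
  refine squeeze_zero (fun _ => dist_nonneg) (fun p => ?_) h1
  rw [dist_eq_norm]
  exact Real.le_sqrt_of_sq_le (h p)

lemma modDeriv_sub (k : ℂ) (φ ψ : TestFun n) (x : Euc n) :
    modDeriv k (φ - ψ : TestFun n) x = modDeriv k φ x - modDeriv k ψ x := by
  have h : ((φ - ψ : TestFun n) : Euc n → ℂ) = fun y => φ y - ψ y := rfl
  rw [modDeriv, modDeriv, modDeriv, h, fderiv_fun_sub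
    (φ.contDiff_two.differentiable two_ne_zero x) (ψ.contDiff_two.differentiable two_ne_zero x),
    sub_apply]
  ring

/-- Elements of the form domain of `-Δ + V` are limits of test functions whose modified radial
derivatives converge in `L²`, and they belong to the domain of `Ω⁻¹`. -/
lemma IsFormLimit.exists_testFun (hn : n ≠ 0) {V : Euc n → ℝ} (hV : ContinuousOn V {0}ᶜ) {δ : ℝ}
    (hδ : 0 < δ) (hA2 : PositiveOnSpheres V δ) {u : L2 n}
    (hu : IsFormLimit (schrodingerOp V hV) u) : ∃ φ : ℕ → TestFun n,
      Tendsto (fun j => testToL2 n (φ j)) atTop (𝓝 u) ∧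
      (∃ G : L2 n, Tendsto (fun j => (memLp_modDeriv 0 (φ j)).toLp (modDeriv 0 (φ j)))
        atTop (𝓝 G)) ∧ MemLp (divNorm u) 2 volume := by
  obtain ⟨f, hf, hf'⟩ := hu
  choose φ hφ _ using fun j => exists_testFun_eq hV (f j)
  have hφu : Tendsto (fun j => testToL2 n (φ j)) atTop (𝓝 u) := by simpa only [hφ] using hf
  -- Coercivity applied to differences makes both `modDeriv 0 φ_j` and `φ_j / r` Cauchy in `L²`.
  have hform : ∀ p : ℕ × ℕ, (∫ x, ‖modDeriv 0 (φ p.1 - φ p.2 : TestFun n) x‖ ^ 2)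
      + δ ^ 2 * (∫ x, ‖x‖⁻¹ ^ 2 * ‖(φ p.1 - φ p.2 : TestFun n) x‖ ^ 2)
      ≤ opForm (schrodingerOp V hV) (f p.1 - f p.2) := fun p => by
    rw [opForm_schrodingerOp hV (ψ := φ p.1 - φ p.2) (by
      rw [AddSubgroupClass.coe_sub, hφ, hφ, map_sub])]
    exact opForm_testToL2 hn hV hA2 _
  have h1 : ∀ p : ℕ × ℕ, 0 ≤ ∫ x, ‖modDeriv 0 (φ p.1 - φ p.2 : TestFun n) x‖ ^ 2 := fun p =>
    integral_nonneg fun x => by positivity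
  have h2 : ∀ p : ℕ × ℕ, 0 ≤ ∫ x, ‖x‖⁻¹ ^ 2 * ‖(φ p.1 - φ p.2 : TestFun n) x‖ ^ 2 := fun p =>
    integral_nonneg fun x => by positivity
  have c1 : CauchySeq fun j => (memLp_modDeriv 0 (φ j)).toLp (modDeriv 0 (φ j)) := by
    refine cauchySeq_of_norm_sub_sq_le (c := 1) hf' fun p => ?_
    rw [← MemLp.toLp_sub, norm_toLp_sq, one_mul]
    refine le_trans (le_of_eq ?_) ((le_add_of_nonneg_right (by have := h2 p; positivity)).trans
      (hform p))
    simp only [modDeriv_sub, Pi.sub_apply]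
  have c2 : CauchySeq fun j => (memLp_norm_inv_smul (φ j)).toLp fun x => ‖x‖⁻¹ • φ j x := by
    refine cauchySeq_of_norm_sub_sq_le (c := 1 / δ ^ 2) hf' fun p => ?_
    rw [← MemLp.toLp_sub, norm_toLp_sq, one_div, le_inv_mul_iff₀ (by positivity)]
    refine le_trans (le_of_eq ?_) ((le_add_of_nonneg_left (h1 p)).trans (hform p))
    congr 2
    ext x
    have e : (φ p.1 - φ p.2 : TestFun n) x = φ p.1 x - φ p.2 x := rfl
    rw [Pi.sub_apply, ← smul_sub, norm_smul, mul_pow, e]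
    simp
  obtain ⟨G, hG⟩ := cauchySeq_tendsto_of_complete c1
  obtain ⟨Y, hY⟩ := cauchySeq_tendsto_of_complete c2
  refine ⟨φ, hφu, ⟨G, hG⟩, (Lp.memLp Y).ae_eq ?_⟩
  -- Two successive almost everywhere convergent subsequences identify the limit `Y` of `φ_j / r`
  -- with `u / r`.
  obtain ⟨s, hs, hs'⟩ := (tendstoInMeasure_of_tendsto_Lp hφu).exists_seq_tendsto_ae
  obtain ⟨t, ht, ht'⟩ := (tendstoInMeasure_of_tendsto_Lp
    (hY.comp hs.tendsto_atTop)).exists_seq_tendsto_ae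
  have e1 : ∀ᵐ x, ∀ j, testToL2 n (φ j) x = φ j x :=
    ae_all_iff.2 fun j => (φ j).memLp.coeFn_toLp
  have e2 : ∀ᵐ x, ∀ j, (memLp_norm_inv_smul (φ j)).toLp (fun x => ‖x‖⁻¹ • φ j x) x
      = ‖x‖⁻¹ • φ j x := ae_all_iff.2 fun j => (memLp_norm_inv_smul (φ j)).coeFn_toLp
  filter_upwards [hs', ht', e1, e2] with x x1 x2 x3 x4
  have x5 : Tendsto (fun i => ‖x‖⁻¹ • φ (s (t i)) x) atTop (𝓝 (‖x‖⁻¹ • u x)) := by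
    have := (x1.comp ht.tendsto_atTop).const_smul ‖x‖⁻¹
    refine this.congr fun i => ?_
    rw [Function.comp_apply, x3]
  have x6 : Tendsto (fun i => ‖x‖⁻¹ • φ (s (t i)) x) atTop (𝓝 (Y x)) :=
    x2.congr fun i => x4 _
  rw [tendsto_nhds_unique x6 x5, divNorm, Complex.real_smul]

lemma memLp_smul_of_hasCompactSupport {g : Euc n → ℝ} (hg : Continuous g)
    (hc : HasCompactSupport g) (f : L2 n) : MemLp (fun x => g x • f x) 2 volume := by
  obtain ⟨C, hC⟩ := hc.exists_bound_of_continuous hg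
  refine (Lp.memLp f).of_le_mul (c := C) (hg.aestronglyMeasurable.smul
    (Lp.aestronglyMeasurable f)) (Eventually.of_forall fun x => ?_)
  rw [norm_smul]
  gcongr
  exact hC x

/-- A smooth bump function on the line. -/
def lineBump : ContDiffBump (0 : ℝ) := ⟨1, 2, one_pos, one_lt_two⟩

lemma lineBump_eq_zero (t : ℝ) (ht : 2 ≤ |t|) : lineBump t = 0 :=
  lineBump.zero_of_le_dist (by simpa [lineBump] using ht)

/-- The weak estimate is applied to `w = χu`. The commutator terms carry the weights `1/r` and
`1/r²`, so one factor `r` leaves precisely `G` and `u/r`, with coefficients `O(R⁻¹)` and `O(R⁻²)`: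
functions of `log r` respect the scaling of the problem at both ends. -/
lemma eLpNorm_logCutoff_smul_divNorm_le (hn : n ≠ 0) {V : Euc n → ℝ}
    (hV : ContDiffOn ℝ 1 V {0}ᶜ) {δ : ℝ} (hδ : 0 < δ) (hA2 : PositiveOnSpheres V δ)
    (hA3 : PositiveOnSpheres (tildeV V) δ) {k : ℂ} (hk : 0 < k.im)
    (u : (friedrichsExtension (schrodingerOp V hV.continuousOn)).domain) {f : L2 n}
    (hf : friedrichsExtension (schrodingerOp V hV.continuousOn) u - k ^ 2 • (u : L2 n)
      =ᵐ[volume] divNorm f)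
    {φ : ℕ → TestFun n} (hφ : Tendsto (fun j => testToL2 n (φ j)) atTop (𝓝 (u : L2 n))) {G : L2 n}
    (hG : Tendsto (fun j => (memLp_modDeriv 0 (φ j)).toLp (modDeriv 0 (φ j))) atTop (𝓝 G))
    {h : ℝ → ℝ} {R : ℝ} (hR : 0 < R) (hh : ∀ t, 2 ≤ |t| → h t = 0) (hs : ContDiff ℝ ∞ h)
    {C₁ C₂ : ℝ} (h0 : ∀ t, |h t| ≤ 1) (h1 : ∀ t, |deriv h t| ≤ C₁)
    (h2 : ∀ t, |deriv (deriv h) t| ≤ C₂) :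
    eLpNorm (fun x => logCutoff h R x • divNorm (u : L2 n) x) 2 volume
      ≤ ENNReal.ofReal (max (1 / δ ^ 2) (√2 / δ)) * (eLpNorm f 2 volume
        + ENNReal.ofReal (2 * C₁ * R⁻¹) * eLpNorm G 2 volume
        + ENNReal.ofReal (C₂ * R⁻¹ ^ 2) * eLpNorm (divNorm (u : L2 n)) 2 volume) := by
  set g := friedrichsExtension (schrodingerOp V hV.continuousOn) u with hg
  have le1 : (1 : WithTop ℕ∞) ≤ ∞ := WithTop.coe_le_coe.2 (le_top : (1 : ℕ∞) ≤ ⊤)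
  have hs' : ContDiff ℝ ∞ (deriv h) := (contDiff_infty_iff_deriv.1 hs).2
  have hs'' : ContDiff ℝ ∞ (deriv (deriv h)) := (contDiff_infty_iff_deriv.1 hs').2
  have hh' := deriv_eq_zero_of_two_le (hs.of_le le1) hh
  have hh'' := deriv_eq_zero_of_two_le (hs'.of_le le1) hh'
  set χ : Euc n → ℝ := logCutoff h R with hχ
  set a : Euc n → ℝ := fun x => logCutoff (deriv h) R x * (2 * R⁻¹ * ‖x‖⁻¹) with ha
  set c : Euc n → ℝ := fun x => logCutoff (deriv (deriv h)) R x * (R⁻¹ ^ 2 * ‖x‖⁻¹ ^ 2) with hc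
  have hχc : Continuous χ := (contDiff_logCutoff hR hh hs).continuous
  have hχs : HasCompactSupport χ := hasCompactSupport_logCutoff hR hh
  have hχV : Continuous fun x => χ x * V x :=
    continuous_logCutoff_mul hR hh hs.continuous hV.continuousOn
  have hac : Continuous a := continuous_logCutoff_mul hR hh' hs'.continuous
    (continuousOn_const.mul continuousOn_norm_inv)
  have hcc : Continuous c := continuous_logCutoff_mul hR hh'' hs''.continuous
    (continuousOn_const.mul (continuousOn_norm_inv.pow 2))
  have has : HasCompactSupport a := (hasCompactSupport_logCutoff hR hh').mul_right
  have hcs : HasCompactSupport c := (hasCompactSupport_logCutoff hR hh'').mul_right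
  set w : Euc n → ℂ := fun x => χ x • (u : L2 n) x with hw
  set F : Euc n → ℂ := fun x => (χ x * V x) • (u : L2 n) x - χ x • g x + a x • G x
    + c x • (u : L2 n) x with hF
  have hm : ∀ v : L2 n, Measurable v := fun v => (Lp.stronglyMeasurable v).measurable
  have hFm : Measurable F := (((hχV.measurable.smul (hm _)).sub (hχc.measurable.smul (hm _))).add
    (hac.measurable.smul (hm _))).add (hcc.measurable.smul (hm _))
  have hFL : MemLp F 2 volume := (((memLp_smul_of_hasCompactSupport hχV hχs.mul_right _).sub
    (memLp_smul_of_hasCompactSupport hχc hχs _)).add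
    (memLp_smul_of_hasCompactSupport hac has _)).add (memLp_smul_of_hasCompactSupport hcc hcs _)
  have hz : ∀ {l : ℝ → ℝ}, (∀ t, 2 ≤ |t| → l t = 0) → ∀ x : Euc n,
      ‖x‖ < Real.exp (-(2 * R)) ∨ Real.exp (2 * R) < ‖x‖ → logCutoff l R x = 0 := fun hl x hx =>
    logCutoff_eq_zero hR hl (hx.imp le_of_lt le_of_lt)
  have key := eLpNorm_norm_inv_smul_le_of_weak hn hV hδ hA2 hA3 hk (w := w) (F := F)
    (hχc.measurable.smul (hm _)) (memLp_smul_of_hasCompactSupport hχc hχs _) hFm hFL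
    (Real.exp_pos (-(2 * R))) (r₁ := Real.exp (2 * R))
    (fun x hx => by simp [hw, hχ, hz hh x hx])
    (fun x hx => by simp [hF, ha, hc, hχ, hz hh x hx, hz hh' x hx, hz hh'' x hx])
    (fun ψ hψ hψs => integral_laplacian_smul_logCutoff hn hV.continuousOn u hφ hG hR hh hs hψ hψs)
  have e1 : (fun x => χ x • divNorm (u : L2 n) x) = fun x => ‖x‖⁻¹ • w x := by
    ext x
    simp only [divNorm, hw, Complex.real_smul]
    ring
  rw [e1]
  refine key.trans ?_
  gcongr
  set A₁ : Euc n → ℂ := fun x => χ x • f x with hA₁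
  set A₂ : Euc n → ℂ := fun x => (2 * R⁻¹ * logCutoff (deriv h) R x) • G x with hA₂
  set A₃ : Euc n → ℂ := fun x => (R⁻¹ ^ 2 * logCutoff (deriv (deriv h)) R x)
    • divNorm (u : L2 n) x with hA₃
  -- The potential terms cancel, and the equation for `u` turns the main part into `χf`.
  have e2 : (fun x => ‖x‖ • (-F x + (V x : ℂ) * w x - k ^ 2 * w x)) =ᵐ[volume] A₁ - A₂ - A₃ := by
    filter_upwards [hf, ae_ne_zero hn, Lp.coeFn_sub g (k ^ 2 • (u : L2 n)),
      Lp.coeFn_smul (k ^ 2) (u : L2 n)] with x x1 x2 x3 x4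
    have hr : (‖x‖ : ℂ) ≠ 0 := by exact_mod_cast norm_ne_zero_iff.2 x2
    have hR' : (R : ℂ) ≠ 0 := by exact_mod_cast hR.ne'
    have x5 : g x = k ^ 2 * (u : L2 n) x + (‖x‖⁻¹ : ℝ) * f x := by
      rw [x3, Pi.sub_apply, x4, Pi.smul_apply, smul_eq_mul, divNorm] at x1
      rw [← x1]
      ring
    simp only [hF, hw, x5, Pi.sub_apply, hA₁, hA₂, hA₃, ha, hc, Complex.real_smul, divNorm]
    push_cast
    field_simp
    ring
  have hc1 : Continuous (logCutoff (deriv h) R : Euc n → ℝ) :=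
    (contDiff_logCutoff hR hh' hs').continuous
  have hc2 : Continuous (logCutoff (deriv (deriv h)) R : Euc n → ℝ) :=
    (contDiff_logCutoff hR hh'' hs'').continuous
  have hdm : Measurable (divNorm (u : L2 n)) :=
    (Complex.measurable_ofReal.comp measurable_norm.inv).mul (hm _)
  have s1 : AEStronglyMeasurable A₁ volume :=
    (hχc.measurable.smul (hm _)).aestronglyMeasurable
  have s2 : AEStronglyMeasurable A₂ volume :=
    ((hc1.measurable.const_mul _).smul (hm _)).aestronglyMeasurable
  have s3 : AEStronglyMeasurable A₃ volume :=
    ((hc2.measurable.const_mul _).smul hdm).aestronglyMeasurable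
  have hRi : 0 < R⁻¹ := inv_pos.2 hR
  rw [eLpNorm_congr_ae e2]
  refine (eLpNorm_sub_le (s1.sub s2) s3 (by norm_num)).trans ?_
  gcongr
  · refine (eLpNorm_sub_le s1 s2 (by norm_num)).trans ?_
    gcongr
    · refine eLpNorm_mono fun x => ?_
      rw [hA₁, norm_smul]
      exact mul_le_of_le_one_left (norm_nonneg _) (abs_logCutoff_le h0 x)
    · refine eLpNorm_le_mul_eLpNorm_of_ae_le_mul (Eventually.of_forall fun x => ?_) 2
      rw [hA₂, norm_smul]
      gcongr
      rw [norm_mul, Real.norm_of_nonneg (by positivity)]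
      have := abs_logCutoff_le (R := R) h1 x
      rw [Real.norm_eq_abs]
      nlinarith
  · refine eLpNorm_le_mul_eLpNorm_of_ae_le_mul (Eventually.of_forall fun x => ?_) 2
    rw [hA₃, norm_smul]
    gcongr
    rw [norm_mul, Real.norm_of_nonneg (by positivity), mul_comm]
    gcongr
    exact abs_logCutoff_le h2 x

/-- If `(P - k²)u = |x|⁻¹ f`, then `‖|x|⁻¹ u‖ ≤ max(δ⁻², √2 δ⁻¹) ‖f‖`. -/
lemma eLpNorm_divNorm_le (hn : n ≠ 0) {V : Euc n → ℝ} (hV : ContDiffOn ℝ 1 V {0}ᶜ) {δ : ℝ}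
    (hδ : 0 < δ) (hA2 : PositiveOnSpheres V δ) (hA3 : PositiveOnSpheres (tildeV V) δ) {k : ℂ}
    (hk : 0 < k.im) (u : (friedrichsExtension (schrodingerOp V hV.continuousOn)).domain)
    {f : L2 n} (hf : friedrichsExtension (schrodingerOp V hV.continuousOn) u - k ^ 2 • (u : L2 n)
      =ᵐ[volume] divNorm f) :
    MemLp (divNorm (u : L2 n)) 2 volume ∧ eLpNorm (divNorm (u : L2 n)) 2 volume
      ≤ ENNReal.ofReal (max (1 / δ ^ 2) (√2 / δ)) * eLpNorm f 2 volume := by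
  obtain ⟨φ, hφ, ⟨G, hG⟩, hY⟩ := IsFormLimit.exists_testFun hn hV.continuousOn hδ hA2
    ((schrodingerOp_isSymmNonneg hn hV.continuousOn hA2).isFormLimit u)
  refine ⟨hY, ?_⟩
  set h : ℝ → ℝ := fun t => lineBump t with hh
  have hs : ContDiff ℝ ∞ h := lineBump.contDiff
  have hs' : ContDiff ℝ ∞ (deriv h) := (contDiff_infty_iff_deriv.1 hs).2
  have hs'' : ContDiff ℝ ∞ (deriv (deriv h)) := (contDiff_infty_iff_deriv.1 hs').2
  have hcs : HasCompactSupport h := lineBump.hasCompactSupport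
  obtain ⟨C₁, hC₁⟩ := hcs.deriv.exists_bound_of_continuous hs'.continuous
  obtain ⟨C₂, hC₂⟩ := hcs.deriv.deriv.exists_bound_of_continuous hs''.continuous
  have h0 : ∀ t, |h t| ≤ 1 := fun t => by
    rw [abs_of_nonneg lineBump.nonneg]
    exact lineBump.le_one
  set C := ENNReal.ofReal (max (1 / δ ^ 2) (√2 / δ))
  have hb : ∀ N : ℕ, _ := fun N =>
    eLpNorm_logCutoff_smul_divNorm_le hn hV hδ hA2 hA3 hk u hf hφ hG (R := (N : ℝ) + 1)
      (by positivity) lineBump_eq_zero hs h0 hC₁ hC₂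
  have hinv : Tendsto (fun N : ℕ => ((N : ℝ) + 1)⁻¹) atTop (𝓝 0) := by
    simpa using tendsto_one_div_add_atTop_nhds_zero_nat (𝕜 := ℝ)
  have hlim : Tendsto (fun N : ℕ => C * (eLpNorm f 2 volume
      + ENNReal.ofReal (2 * C₁ * ((N : ℝ) + 1)⁻¹) * eLpNorm G 2 volume
      + ENNReal.ofReal (C₂ * ((N : ℝ) + 1)⁻¹ ^ 2) * eLpNorm (divNorm (u : L2 n)) 2 volume)) atTop
      (𝓝 (C * (eLpNorm f 2 volume + ENNReal.ofReal (2 * C₁ * 0) * eLpNorm G 2 volume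
      + ENNReal.ofReal (C₂ * 0 ^ 2) * eLpNorm (divNorm (u : L2 n)) 2 volume))) := by
    refine ENNReal.Tendsto.const_mul ((tendsto_const_nhds.add (ENNReal.Tendsto.mul_const
      (ENNReal.tendsto_ofReal (hinv.const_mul _)) (Or.inr (Lp.eLpNorm_ne_top G)))).add
      (ENNReal.Tendsto.mul_const (ENNReal.tendsto_ofReal ((hinv.pow 2).const_mul _))
        (Or.inr hY.eLpNorm_ne_top))) (Or.inr ENNReal.ofReal_ne_top)
  simp only [mul_zero, ENNReal.ofReal_zero, zero_mul, add_zero, ne_eq, OfNat.ofNat_ne_zero,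
    not_false_eq_true, zero_pow] at hlim
  -- Fatou's lemma: at each `x ≠ 0` the cutoffs tend to `h(0) = 1`, and the commutator errors vanish
  -- in the limit because `G` and `u/r` have finite norm.
  refine (Lp.eLpNorm_lim_le_liminf_eLpNorm (f := fun (N : ℕ) x =>
    logCutoff h ((N : ℝ) + 1) x • divNorm (u : L2 n) x) (fun N => ?_) _ ?_).trans
    ((liminf_le_liminf (Eventually.of_forall hb)).trans_eq hlim.liminf_eq)
  · exact ((contDiff_logCutoff (by positivity) lineBump_eq_zero
      hs).continuous.aestronglyMeasurable).smul hY.1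
  · filter_upwards [ae_ne_zero hn] with x hx
    have t1 : Tendsto (fun N : ℕ => logCutoff h ((N : ℝ) + 1) x) atTop (𝓝 1) := by
      have t2 : Tendsto (fun N : ℕ => h (Real.log ‖x‖ * ((N : ℝ) + 1)⁻¹)) atTop
          (𝓝 (h (Real.log ‖x‖ * 0))) :=
        (hs.continuous.tendsto _).comp (hinv.const_mul _)
      have t3 : h 0 = 1 := lineBump.one_of_mem_closedBall (by simp [lineBump])
      rw [mul_zero, t3] at t2
      refine t2.congr fun N => ?_
      rw [logCutoff_of_ne hx, div_eq_mul_inv]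
    simpa using t1.smul_const (divNorm (u : L2 n) x)

/-- Of the two square roots one has positive imaginary part, unless they are real; in that case `μ`
would be a nonnegative real. -/
lemma exists_sq_eq_im_pos {μ : ℂ} (hμ : ∀ t : ℝ, 0 ≤ t → μ ≠ t) : ∃ k : ℂ, k ^ 2 = μ ∧ 0 < k.im := by
  obtain ⟨z, hz⟩ := IsAlgClosed.exists_pow_nat_eq μ two_pos
  rcases lt_trichotomy z.im 0 with h | h | h
  · exact ⟨-z, by rw [neg_sq, hz], by simpa using h⟩
  · refine absurd ?_ (hμ (z.re ^ 2) (sq_nonneg _))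
    rw [← hz, Complex.ofReal_pow]
    congr 1
    exact Complex.ext rfl (by simpa using h)
  · exact ⟨z, hz, h⟩

lemma dense_invOmegaDomain (hn : n ≠ 0) : Dense (invOmegaDomain n : Set (L2 n)) := by
  refine (dense_range_testToL2 hn).mono ?_
  rintro _ ⟨φ, rfl⟩
  refine (memLp_norm_inv_smul φ).ae_eq ?_
  filter_upwards [φ.memLp.coeFn_toLp] with x hx
  have hx' : testToL2 n φ x = φ x := hx
  rw [divNorm, hx', Complex.real_smul]

/-- An operator `R` with values in the domain of `Ω⁻¹` on the range of `Ω⁻¹`, and bounded in the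
weighted norms, gives a bounded operator `Ω⁻¹RΩ⁻¹`. -/
lemma exists_extension (hn : n ≠ 0) {R : L2 n →L[ℂ] L2 n} {C : ℝ} (hC : 0 ≤ C)
    (h : ∀ f : (invOmega n).domain, MemLp (divNorm (R (invOmega n f))) 2 volume ∧
      eLpNorm (divNorm (R (invOmega n f))) 2 volume ≤ ENNReal.ofReal C * eLpNorm (f : L2 n) 2 volume) :
    ∃ T : L2 n →L[ℂ] L2 n, (∀ f : (invOmega n).domain,
      ∃ h : R (invOmega n f) ∈ (invOmega n).domain, invOmega n ⟨R (invOmega n f), h⟩ = T f) ∧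
      ∀ f : L2 n, ‖T f‖ ≤ C * ‖f‖ := by
  set S : (invOmega n).domain →ₗ[ℂ] L2 n := (invOmega n).toFun ∘ₗ
    LinearMap.codRestrict (invOmega n).domain ((R : L2 n →ₗ[ℂ] L2 n) ∘ₗ (invOmega n).toFun)
      fun f => (h f).1
  have hd : DenseRange (invOmega n).domain.subtype := by
    rw [DenseRange, Submodule.coe_subtype, Subtype.range_coe]
    exact dense_invOmegaDomain hn
  have hS : ∀ f, ‖S f‖ ≤ C * ‖(invOmega n).domain.subtype f‖ := fun f => by
    have h1 : ‖S f‖ = (eLpNorm (divNorm (R (invOmega n f))) 2 volume).toReal :=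
      Lp.norm_toLp _ (h f).1
    rw [h1, Submodule.subtype_apply, Lp.norm_def]
    refine (ENNReal.toReal_mono (ENNReal.mul_ne_top ENNReal.ofReal_ne_top
      (Lp.eLpNorm_ne_top _)) (h f).2).trans_eq ?_
    rw [ENNReal.toReal_mul, ENNReal.toReal_ofReal hC]
  -- The extension is by continuity from the dense domain of `Ω⁻¹`, with the same norm bound.
  refine ⟨S.extendOfNorm (invOmega n).domain.subtype, fun f => ⟨(h f).1, ?_⟩,
    LinearMap.norm_extendOfNorm_apply_le hd C hS⟩
  exact (LinearMap.extendOfNorm_eq hd ⟨C, hS⟩ f).symm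

end Resolvent

end CriticalDecay

end

/-! ### The uniform weighted resolvent estimate. -/

theorem mainTheorem3 (n : ℕ) (hn : 3 ≤ n) (V : Euc n → ℝ) (hV : ContDiffOn ℝ 1 V {0}ᶜ)
    (hA1 : CriticalBound V) (δ : ℝ) (hδ : 0 < δ)
    (hA2 : PositiveOnSpheres V δ) (hA3 : PositiveOnSpheres (tildeV V) δ)
    (μ : ℂ) (hμ : ∀ t : ℝ, 0 ≤ t → μ ≠ (t : ℂ)) :
    ∃ R : L2 n →L[ℂ] L2 n,
      IsResolvent (friedrichsExtension (schrodingerOp V hV.continuousOn)) μ R ∧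
      ∃ T : L2 n →L[ℂ] L2 n,
        (∀ f : (invOmega n).domain,
          ∃ h : R (invOmega n f) ∈ (invOmega n).domain,
            invOmega n ⟨R (invOmega n f), h⟩ = T f) ∧
        ∀ f : L2 n, ‖T f‖ ≤ max (1 / δ ^ 2) (√2 / δ) * ‖f‖ := by
  have hn0 : n ≠ 0 := by lia
  obtain ⟨R, hR⟩ := exists_isResolvent (schrodingerOp_isSymmNonneg hn0 hV.continuousOn hA2)
    (dense_range_testToL2 hn0) hμ
  obtain ⟨k, rfl, hk⟩ := exists_sq_eq_im_pos hμ
  refine ⟨R, hR, exists_extension hn0 (le_max_of_le_left (by positivity)) fun f => ?_⟩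
  obtain ⟨h, hu⟩ := hR.right_inv (invOmega n f)
  -- Here `u = R Ω⁻¹ f` solves `(P - k²)u = |x|⁻¹ f`, and the constant in the bound does not involve
  -- `k`.
  refine eLpNorm_divNorm_le hn0 hV hδ hA2 hA3 hk ⟨R (invOmega n f), h⟩ ?_
  rw [hu]
  exact (invOmegaDomain.memLp f).coeFn_toLp
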